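/- For $\mu>0$ let $X^0_\mu(\mathbb R^2)$ be the space $H^1(\mathbb R^2)$ of real-valued functions with the norm $\|u\|_{X^0_\mu}^2=\|u\|_{L^2}^2+\mu\|\nabla u\|_{L^2}^2$; a vector field belongs to it if its components do, and $\|\mathbf v\|_{X^0_\mu}^2=\sum_i\|v_i\|_{X^0_\mu}^2$. Consider the Boussinesq-Full dispersion system on $\mathbb R^2$ for $\zeta$ (scalar) and $\mathbf v$ (two components), with $|D|$ the Fourier multiplier of symbol $|\xi|$, $$(1-b\mu\Delta)\partial_t\zeta+\tfrac1\gamma\nabla\cdot\big((1-\epsilon\zeta)\mathbf v\big)-\tfrac{\sqrt\mu}{\gamma^2}|D|\coth(\sqrt{\mu_2}|D|)\nabla\cdot\mathbf v+\tfrac{\mu}{\gamma}\Big(a-\tfrac1{\gamma^2}\coth^2(\sqrt{\mu_2}|D|)\Big)\Delta\nabla\cdot\mathbf v=0,$$ $$(1-d\mu\Delta)\partial_t\mathbf v+(1-\gamma)\nabla\zeta-\tfrac{\epsilon}{2\gamma}\nabla(|\mathbf v|^2)+c\mu(1-\gamma)\Delta\nabla\zeta=0,$$ with initial condition $\zeta|_{t=0}=\zeta_0$,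 $\mathbf v|_{t=0}=\mathbf v_0$; the equations are understood in the sense of tempered distributions in space at every time $t\ge0$. **Theorem.** Let $b=d>0$, $a\le0$, $c<0$, $\gamma\in(0,1)$ and $L\ge1$. There is a constant $C>0$, depending only on $a,b,c,d,\gamma,L$, such that for all $K\ge1$ and $M\ge0$ there is $\epsilon_0>0$ with the following property. Let $0<\epsilon\le\epsilon_0$, let $\mu>0$ satisfy $\mu\sim\epsilon$ in the sense that $\epsilon/K\le\mu\le K\epsilon$, let $\mu_2\sim1$ in the sense that $L^{-1}\le\mu_2\le L$, and let $\zeta_0\in X^0_\mu(\mathbb R^2)$, $\mathbf v_0\in X^0_\mu(\mathbb R^2)$ with $\|\zeta_0\|_{X^0_\mu}+\|\mathbf v_0\|_{X^0_\mu}\le M$. Then the initial value problem has a unique solution $(\zeta,\mathbf v)$ in $C([0,\infty);X^0_\mu(\mathbb R^2)\times X^0_\mu(\mathbb R^2))$, and $$\|\zeta(t)\|_{X^0_\mu}+\|\mathbf v(t)\|_{X^0_\mu}\le C\big(\|\zeta_0\|_{X^0_\mu}+\|\mathbf v_0\|_{X^0_\mu}\big)\qquad\text{for all }t\ge0.$$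 -/

import Mathlib

open MeasureTheory Filter Topology Set
open scoped SchwartzMap FourierTransform LineDeriv Laplacian

noncomputable section

namespace BoussinesqFD

/-- The plane `ℝ²` with its Euclidean norm. -/
abbrev Plane : Type := EuclideanSpace ℝ (Fin 2)

/-- The real Hilbert space `L²(ℝ²; ℝ)`. -/
abbrev L2 : Type := Lp ℝ 2 (volume : Measure Plane)

/-- The `j`-th vector of the standard basis of `ℝ²`. -/
def e (j : Fin 2) : Plane := EuclideanSpace.single j 1

/-! ### Distributions, as functionals on Schwartz functions -/

/-- Functionals on the Schwartz space of the plane. -/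
abbrev Dist : Type := 𝓢(Plane, ℂ) → ℂ

/-- The functional `φ ↦ ∫ f φ dx` of a real function `f`. -/
def ofFun (f : Plane → ℝ) : Dist := fun φ => ∫ x, (f x : ℂ) * φ x

/-- The distributional partial derivative, `⟨∂ⱼ T, φ⟩ = -⟨T, ∂ⱼ φ⟩`. -/
def dPartial (j : Fin 2) (T : Dist) : Dist := fun φ => -T (∂_{e j} φ)

/-- The distributional divergence of a vector field. -/
def dDiv (T : Fin 2 → Dist) : Dist := ∑ j, dPartial j (T j)

/-- The distributional Laplacian, `⟨Δ T, φ⟩ = ⟨T, Δ φ⟩`. -/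
def dLap (T : Dist) : Dist := fun φ => T (Δ φ)

/-- The complexification of a real `L²` function. -/
def toComplex (u : L2) : Lp ℂ 2 (volume : Measure Plane) := Complex.ofRealCLM.compLp u

/-- The Fourier multiplier `m(|D|)` applied to `u ∈ L²`, i.e. the distribution whose Fourier
transform is `m(|ξ|) û(ξ)`. Mathlib's Fourier transform has the kernel `exp(-2πi x·ξ)`, so that
`|D|` has the symbol `2π|ξ|`; `𝓕 (toComplex u)` is the Fourier transform on `L²`. -/
def radialMultiplier (m : ℝ → ℝ) (u : L2) : Dist := fun φ =>
  ∫ ξ : Plane, (m (2 * Real.pi * ‖ξ‖) : ℂ) * (𝓕 (toComplex u)) ξ * (𝓕⁻ φ) ξ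

/-- The hyperbolic cotangent. -/
def coth (x : ℝ) : ℝ := Real.cosh x / Real.sinh x

/-- The symbol `r ↦ r coth(√μ₂ r)` of the operator `|D| coth(√μ₂ |D|)`
(its value at `r = 0` plays no role, since `{0}` is a null set). -/
def cothSymbol (μ₂ : ℝ) (r : ℝ) : ℝ := r * coth (√μ₂ * r)

/-! ### The space `X⁰_μ(ℝ²)`: `H¹(ℝ²)` with a `μ`-weighted norm -/

/-- `g` is the weak partial derivative `∂ⱼ u`. -/
def IsWeakPartial (j : Fin 2) (u g : L2) : Prop := ofFun g = dPartial j (ofFun u)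

/-- `u ∈ H¹(ℝ²)`. -/
def MemH1 (u : L2) : Prop := ∀ j, ∃ g, IsWeakPartial j u g

open Classical in
/-- The weak partial derivative `∂ⱼ u ∈ L²` (unique if it exists; `0` if it does not exist). -/
def weakPartial (j : Fin 2) (u : L2) : L2 :=
  if h : ∃ g, IsWeakPartial j u g then h.choose else 0

/-- `‖u‖² = ‖u‖²_{L²} + μ ‖∇u‖²_{L²}` in `X⁰_μ`. -/
def normX (μ : ℝ) (u : L2) : ℝ := √(‖u‖ ^ 2 + μ * ∑ j, ‖weakPartial j u‖ ^ 2)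

/-- The `X⁰_μ` norm of a vector field. -/
def normXVec (μ : ℝ) (v : Fin 2 → L2) : ℝ := √(∑ i, normX μ (v i) ^ 2)

/-- `u ∈ C([0,∞); X⁰_μ(ℝ²))`. -/
def ContInX (μ : ℝ) (u : ℝ → L2) : Prop :=
  (∀ t, 0 ≤ t → MemH1 (u t)) ∧
    ∀ t, 0 ≤ t → Tendsto (fun s => normX μ (u s - u t)) (𝓝[Ici 0] t) (𝓝 0)

/-! ### The Boussinesq-Full dispersion system -/

/-- The terms other than `(1 - bμΔ)∂ₜζ` in the first equation,
`γ⁻¹ ∇·((1 - εζ)v) - √μ γ⁻² |D| coth(√μ₂|D|) ∇·v + μ γ⁻¹ (a - γ⁻² coth²(√μ₂|D|)) Δ∇·v`,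
where `- coth²(√μ₂|D|) Δ = (|D| coth(√μ₂|D|))²`. -/
def massTerms (a γ ε μ μ₂ : ℝ) (ζ : L2) (v : Fin 2 → L2) : Dist :=
  (1 / γ) • dDiv (fun j => ofFun (fun x => (1 - ε * ζ x) * v j x))
    - (√μ / γ ^ 2) • dDiv (fun j => radialMultiplier (cothSymbol μ₂) (v j))
    + (μ / γ) • (a • dLap (dDiv (fun j => ofFun (v j)))
      + (1 / γ ^ 2) • dDiv (fun j => radialMultiplier (fun r => cothSymbol μ₂ r ^ 2) (v j)))

/-- The terms other than `(1 - dμΔ)∂ₜvᵢ` in the `i`-th component of the second equation,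
`(1 - γ)∂ᵢζ - ε/(2γ) ∂ᵢ(|v|²) + cμ(1 - γ)Δ∂ᵢζ`. -/
def momentumTerms (c γ ε μ : ℝ) (ζ : L2) (v : Fin 2 → L2) (i : Fin 2) : Dist :=
  (1 - γ) • dPartial i (ofFun ζ)
    - (ε / (2 * γ)) • dPartial i (ofFun (fun x => ∑ j, v j x ^ 2))
    + (c * μ * (1 - γ)) • dLap (dPartial i (ofFun ζ))

/-- `(ζ, v)` is a solution in `C([0,∞); X⁰_μ × X⁰_μ)`, with initial value `(ζ₀, v₀)`, of
`(1 - bμΔ)∂ₜζ + γ⁻¹ ∇·((1 - εζ)v) - √μ γ⁻² |D| coth(√μ₂|D|) ∇·v`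
`    + μ γ⁻¹ (a - γ⁻² coth²(√μ₂|D|)) Δ∇·v = 0`,
`(1 - dμΔ)∂ₜv + (1 - γ)∇ζ - ε/(2γ) ∇(|v|²) + cμ(1 - γ)Δ∇ζ = 0`.
The equations hold in the sense of tempered distributions at every time `t ≥ 0`
(the time derivative is one-sided at `t = 0`). -/
structure IsSolution (a b c d γ ε μ μ₂ : ℝ) (ζ₀ : L2) (v₀ : Fin 2 → L2)
    (ζ : ℝ → L2) (v : ℝ → Fin 2 → L2) : Prop where
  cont_ζ : ContInX μ ζ
  cont_v : ∀ i, ContInX μ (fun t => v t i)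
  init_ζ : ζ 0 = ζ₀
  init_v : v 0 = v₀
  mass : ∀ t, 0 ≤ t → ∀ φ : 𝓢(Plane, ℂ),
    HasDerivWithinAt (fun s => (ofFun (ζ s) - (b * μ) • dLap (ofFun (ζ s))) φ)
      (-(massTerms a γ ε μ μ₂ (ζ t) (v t) φ)) (Ici 0) t
  momentum : ∀ i, ∀ t, 0 ≤ t → ∀ φ : 𝓢(Plane, ℂ),
    HasDerivWithinAt (fun s => (ofFun (v s i) - (d * μ) • dLap (ofFun (v s i))) φ)
      (-(momentumTerms c γ ε μ (ζ t) (v t) i φ)) (Ici 0) t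

end BoussinesqFD

end

/-! Write (ζ, v) = (1 - μΔ)^(-1/2) f. This is an isometry of L² onto X⁰_μ, so the problem moves to
triples of L² functions, on which the linear operators are Fourier multipliers. With κ = ε/(2γ), j =
(1 - bμΔ)⁻¹ and radial symbols α, β the system reads ∂ₜζ = -j∇·(βv - 2κζv), ∂ₜv = -j∇(αζ - κ|v|²).
Since b = d, the same j stands in both equations, the operator (ζ, v) ↦ -j(∇·v, ∇ζ) is skew, and the
system is Hamiltonian: ⟨αζ, ζ⟩ + ⟨βv, v⟩ - 2κ∫ζ|v|² is conserved (`Dispersion.energy_eq`).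

Global bound: α and β are comparable to 1 + μ|D|² with constants depending only on a, c, γ, L
(`comparable_alphaSym`, `comparable_betaSym`), so the quadratic part of the energy is equivalent to
the squared X⁰_μ norm. By Ladyzhenskaya's inequality the cubic part is at most a constant times ε
μ^(-1/2) times the cube of the norm, and ε μ^(-1/2) ≤ √(Kε) is small. Hence the energy controls the
norm while the norm stays below a fixed radius, and a continuity argument shows that this radius is
never reached (`Dispersion.apriori`, `DampedGroup.exists_isStrong_of_apriori`).

Well-posedness: in the variables W = (√α ζ, √β v) the linear part is ω(|D|)N, where N is a skew
matrix of Riesz transforms with N³ = -N, so its group is explicitly 1 + sin(ωt)N + (1 - cos(ωt))N²,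
an isometry group on L². The symbol ω has order one, so the generator need not be bounded. The
nonlinearity, however, is locally Lipschitz: products of two X⁰_μ functions lie in L², and j∇√α,
j∇√β are bounded. For S(-t)W the equation is then an ordinary differential equation to which
Picard-Lindelöf applies.

A continuous curve in X⁰_μ that solves the system is differentiable only after a loss of one
derivative, so equations are read after applying R = (1 - μΔ)^(-1/2). Two facts repair the loss:
injectivity of R shows that S(-t)W is differentiable without damping
(`DampedGroup.IsStrong.hasDerivWithinAt`), and the symmetry of ∫ζ|v|² as a trilinear form allows it
to be differentiated when only R f is differentiable (`hasDerivWithinAt_inner_bilin`). Uniqueness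
among distributional solutions holds because each of them comes from such a curve
(`exists_isFlow_of_isSolution`). -/

noncomputable section

namespace BoussinesqFD

/-! ### Conjugation and reflection on the complex `L²` space -/

/-- The complex Hilbert space `L²(ℝ²; ℂ)`. -/
abbrev L2C : Type := Lp ℂ 2 (volume : Measure Plane)

/-- Pointwise complex conjugation. -/
def conjL : L2C →L[ℝ] L2C := (Complex.conjCLE : ℂ →L[ℝ] ℂ).compLpL 2 volume

theorem conjL_coe (f : L2C) : conjL f =ᵐ[volume] fun x => (starRingEnd ℂ) (f x) :=
  ContinuousLinearMap.coeFn_compLpL _ f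

theorem measurePreserving_neg_plane :
    MeasurePreserving (fun x : Plane => -x) volume volume :=
  Measure.measurePreserving_neg volume

/-- The reflection `f ↦ f(-·)`. -/
def reflL (f : L2C) : L2C := Lp.compMeasurePreserving _ measurePreserving_neg_plane f

theorem reflL_coe (f : L2C) : reflL f =ᵐ[volume] fun x => f (-x) :=
  Lp.coeFn_compMeasurePreserving f measurePreserving_neg_plane

theorem continuous_reflL : Continuous reflL :=
  (Lp.isometry_compMeasurePreserving measurePreserving_neg_plane).continuous

theorem fourier_conj_apply (f : 𝓢(Plane, ℂ)) (ξ : Plane) :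
    𝓕 (fun x => (starRingEnd ℂ) (f x)) ξ = (starRingEnd ℂ) (𝓕 (f : Plane → ℂ) (-ξ)) := by
  rw [Real.fourier_eq', Real.fourier_eq', ← integral_conj]
  congr 1
  ext x
  simp only [smul_eq_mul, map_mul, ← Complex.exp_conj]
  congr 2
  simp [Complex.conj_ofNat]

/-- Both sides are continuous in f, so Schwartz functions suffice. The identity translates reality
of u into Hermitian symmetry of its transform, which is what lets multipliers act on real functions.
-/
theorem fourier_conjL (f : L2C) : 𝓕 (conjL f) = reflL (conjL (𝓕 f)) := by
  apply DenseRange.induction_on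
    (p := fun f : L2C => 𝓕 (conjL f) = reflL (conjL (𝓕 f)))
    (SchwartzMap.denseRange_toLpCLM (p := 2) (E := Plane) (F := ℂ) (μ := volume)
      ENNReal.ofNat_ne_top) f
  · apply isClosed_eq
    · exact (Lp.fourierTransformₗᵢ Plane ℂ).continuous.comp conjL.continuous
    · exact continuous_reflL.comp
        (conjL.continuous.comp (Lp.fourierTransformₗᵢ Plane ℂ).continuous)
  intro φ
  simp only [SchwartzMap.toLpCLM_apply]
  set ψ : 𝓢(Plane, ℂ) := φ.postcompCLM (𝕜 := ℝ) (Complex.conjCLE : ℂ →L[ℝ] ℂ) with hψ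
  have h1 : conjL (φ.toLp 2) = ψ.toLp 2 := by
    apply Lp.ext
    filter_upwards [conjL_coe (φ.toLp 2), φ.coeFn_toLp 2 volume, ψ.coeFn_toLp 2 volume]
      with x h1 h2 h3
    rw [h1, h2, h3]
    rfl
  rw [h1, SchwartzMap.toLp_fourier_eq, SchwartzMap.toLp_fourier_eq]
  apply Lp.ext
  have h5 := measurePreserving_neg_plane.quasiMeasurePreserving.ae
    (conjL_coe ((𝓕 φ).toLp 2))
  have h6 := measurePreserving_neg_plane.quasiMeasurePreserving.ae
    ((𝓕 φ).coeFn_toLp 2 volume)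
  filter_upwards [(𝓕 ψ).coeFn_toLp 2 volume, reflL_coe (conjL ((𝓕 φ).toLp 2)), h5, h6]
    with x h1 h2 h3 h4
  rw [h1, h2, h3, h4]
  exact fourier_conj_apply φ x

/-! ### Real functions and their Fourier transforms -/

theorem toComplex_coe (u : L2) : toComplex u =ᵐ[volume] fun x => (u x : ℂ) :=
  ContinuousLinearMap.coeFn_compLp _ u

/-- The map `u ↦ û` from real `L²` functions, as a real linear map. -/
def hat : L2 →L[ℝ] L2C :=
  ((Lp.fourierTransformₗᵢ Plane ℂ).toContinuousLinearEquiv.toContinuousLinearMap.restrictScalars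
    ℝ).comp (Complex.ofRealCLM.compLpL 2 volume)

theorem hat_apply (u : L2) : hat u = 𝓕 (toComplex u) := rfl

theorem norm_toComplex (u : L2) : ‖toComplex u‖ = ‖u‖ := by
  rw [Lp.norm_def, Lp.norm_def]
  congr 1
  apply eLpNorm_congr_norm_ae
  filter_upwards [toComplex_coe u] with x hx
  rw [hx]; simp

theorem norm_hat (u : L2) : ‖hat u‖ = ‖u‖ := by
  rw [hat_apply, Lp.norm_fourier_eq, norm_toComplex]

theorem hat_injective : Function.Injective hat := by
  intro u v h
  have : ‖u - v‖ = 0 := by rw [← norm_hat, map_sub, h, sub_self, norm_zero]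
  exact sub_eq_zero.1 (norm_eq_zero.1 this)

theorem conjL_toComplex (u : L2) : conjL (toComplex u) = toComplex u := by
  apply Lp.ext
  filter_upwards [conjL_coe (toComplex u), toComplex_coe u] with x h1 h2
  rw [h1, h2]; simp

theorem hat_hermitian (u : L2) : reflL (conjL (hat u)) = hat u := by
  rw [hat_apply, ← fourier_conjL, conjL_toComplex]

/-- The real part, from complex to real `L²`. -/
def reL : L2C →L[ℝ] L2 := Complex.reCLM.compLpL 2 volume

theorem toComplex_reL {f : L2C} (hf : conjL f = f) : toComplex (reL f) = f := by
  apply Lp.ext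
  have h0 : conjL f =ᵐ[volume] f := by rw [hf]
  filter_upwards [toComplex_coe (reL f), ContinuousLinearMap.coeFn_compLpL (Complex.reCLM) f,
    conjL_coe f, h0] with x h1 h2 h3 h4
  rw [h1]
  have : reL f x = (f x).re := h2
  rw [this, ← Complex.conj_eq_iff_re, ← h3, h4]

/-- Hermitian symmetry makes the inverse transform invariant under conjugation, so taking its real
part loses nothing. Real multipliers are constructed from this. -/
theorem exists_hat_eq {F : L2C} (hF : reflL (conjL F) = F) : ∃ u, hat u = F := by
  refine ⟨reL (𝓕⁻ F), ?_⟩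
  have : conjL (𝓕⁻ F) = 𝓕⁻ F := by
    have h := fourier_conjL (𝓕⁻ F)
    rw [FourierTransform.fourier_fourierInv_eq, hF] at h
    exact (FourierTransform.fourierInv_fourier_eq _).symm.trans (congrArg _ h)
  rw [hat_apply, toComplex_reL this, FourierTransform.fourier_fourierInv_eq]

theorem inner_hat (u v : L2) : inner ℝ u v = (inner ℂ (hat u) (hat v)).re := by
  have h1 : inner ℂ (hat u) (hat v) = inner ℂ (toComplex u) (toComplex v) := by
    rw [hat_apply, hat_apply, Lp.inner_fourier_eq]
  rw [h1, L2.inner_def, L2.inner_def]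
  have : ∫ a, inner ℂ (toComplex u a) (toComplex v a) = ∫ a, ((inner ℝ (u a) (v a) : ℝ) : ℂ) := by
    apply integral_congr_ae
    filter_upwards [toComplex_coe u, toComplex_coe v] with x h1 h2
    rw [h1, h2]; simp
  rw [this]
  exact ((congrArg Complex.re integral_ofReal).trans (Complex.ofReal_re _)).symm

/-! ### Bounded symbols and their Fourier multipliers -/

/-- Bounded measurable symbols `m` with `m(-ξ) = conj m(ξ)`: those whose Fourier multiplier maps
real functions to real functions. -/
def Symb : Subalgebra ℝ (Plane → ℂ) where
  carrier := {m | Measurable m ∧ (∃ C, ∀ ξ, ‖m ξ‖ ≤ C) ∧ ∀ ξ, m (-ξ) = (starRingEnd ℂ) (m ξ)}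
  mul_mem' := by
    rintro a b ⟨ha, ⟨C, hC⟩, ha'⟩ ⟨hb, ⟨D, hD⟩, hb'⟩
    refine ⟨ha.mul hb, ⟨C * D, fun ξ => ?_⟩, fun ξ => by simp [ha', hb']⟩
    rw [Pi.mul_apply, norm_mul]
    exact mul_le_mul (hC ξ) (hD ξ) (norm_nonneg _) ((norm_nonneg _).trans (hC ξ))
  add_mem' := by
    rintro a b ⟨ha, ⟨C, hC⟩, ha'⟩ ⟨hb, ⟨D, hD⟩, hb'⟩
    exact ⟨ha.add hb, ⟨C + D, fun ξ => (norm_add_le _ _).trans (add_le_add (hC ξ) (hD ξ))⟩,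
      fun ξ => by simp [ha', hb']⟩
  algebraMap_mem' r := ⟨measurable_const, ⟨‖(r : ℂ)‖, fun _ => le_rfl⟩,
    fun _ => (Complex.conj_ofReal r).symm⟩

theorem symb_measurable (m : Symb) : Measurable (m : Plane → ℂ) := m.2.1

theorem symb_bounded (m : Symb) : ∃ C, ∀ ξ, ‖m.1 ξ‖ ≤ C := m.2.2.1

theorem symb_memLp (m : Symb) (f : L2C) : MemLp (fun ξ => m.1 ξ * f ξ) 2 volume := by
  obtain ⟨C, hC⟩ := symb_bounded m
  refine (Lp.memLp f).of_le_mul (c := C)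
    ((symb_measurable m).aestronglyMeasurable.mul (Lp.aestronglyMeasurable f))
    (Eventually.of_forall fun ξ => ?_)
  rw [norm_mul]
  exact mul_le_mul_of_nonneg_right (hC ξ) (norm_nonneg _)

/-- Multiplication by a symbol. -/
def symbMul (m : Symb) (f : L2C) : L2C := (symb_memLp m f).toLp

theorem symbMul_coe (m : Symb) (f : L2C) : symbMul m f =ᵐ[volume] fun ξ => m.1 ξ * f ξ :=
  (symb_memLp m f).coeFn_toLp

theorem symbMul_hermitian (m : Symb) {f : L2C} (hf : reflL (conjL f) = f) :
    reflL (conjL (symbMul m f)) = symbMul m f := by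
  apply Lp.ext
  have q := measurePreserving_neg_plane.quasiMeasurePreserving
  have h0 : reflL (conjL f) =ᵐ[volume] f := by rw [hf]
  filter_upwards [reflL_coe (conjL (symbMul m f)), q.ae (conjL_coe (symbMul m f)),
    q.ae (symbMul_coe m f), symbMul_coe m f, h0, reflL_coe (conjL f), q.ae (conjL_coe f)]
    with x h1 h2 h3 h4 h5 h6 h7
  rw [h1, h2, h3, h4, map_mul, m.2.2.2, Complex.conj_conj, ← h7, ← h6, h5]

theorem norm_symbMul_le (m : Symb) {C : ℝ} (hC : ∀ ξ, ‖m.1 ξ‖ ≤ C) (f : L2C) :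
    ‖symbMul m f‖ ≤ C * ‖f‖ := by
  apply Lp.norm_le_mul_norm_of_ae_le_mul
  filter_upwards [symbMul_coe m f] with x hx
  rw [hx, norm_mul]
  exact mul_le_mul_of_nonneg_right (hC x) (norm_nonneg _)

/-- The Fourier multiplier as a function. -/
def multFun (m : Symb) (u : L2) : L2 :=
  (exists_hat_eq (symbMul_hermitian m (hat_hermitian u))).choose

theorem hat_multFun (m : Symb) (u : L2) : hat (multFun m u) = symbMul m (hat u) :=
  (exists_hat_eq (symbMul_hermitian m (hat_hermitian u))).choose_spec

theorem symbMul_eq_iff (m : Symb) (f g : L2C) :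
    symbMul m f = g ↔ g =ᵐ[volume] fun ξ => m.1 ξ * f ξ := by
  constructor
  · rintro rfl
    exact symbMul_coe m f
  · intro h
    exact Lp.ext ((symbMul_coe m f).trans h.symm)

/-- Injectivity of `hat` reduces every identity between multipliers to an almost everywhere identity
in ξ. -/
theorem multFun_eq_iff (m : Symb) (u v : L2) :
    multFun m u = v ↔ hat v =ᵐ[volume] fun ξ => m.1 ξ * hat u ξ := by
  rw [← hat_injective.eq_iff, hat_multFun, symbMul_eq_iff]

theorem hat_multFun_coe (m : Symb) (u : L2) :
    hat (multFun m u) =ᵐ[volume] fun ξ => m.1 ξ * hat u ξ :=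
  (multFun_eq_iff m u _).1 rfl

theorem hat_add_coe (u v : L2) : hat (u + v) =ᵐ[volume] fun ξ => hat u ξ + hat v ξ := by
  rw [map_add]; exact Lp.coeFn_add _ _

theorem hat_smul_coe (c : ℝ) (u : L2) : hat (c • u) =ᵐ[volume] fun ξ => c * hat u ξ := by
  rw [map_smul]
  filter_upwards [Lp.coeFn_smul c (hat u)] with x hx
  rw [hx]
  exact Complex.real_smul

theorem hat_zero_coe : hat 0 =ᵐ[volume] fun _ => 0 := by
  rw [map_zero]; exact Lp.coeFn_zero _ _ _

/-- The Fourier multiplier as a continuous linear map. -/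
def multCLM (m : Symb) : L2 →L[ℝ] L2 := LinearMap.mkContinuousOfExistsBound
    { toFun := multFun m
      map_add' := fun u v => by
        rw [multFun_eq_iff]
        filter_upwards [hat_add_coe (multFun m u) (multFun m v), hat_add_coe u v,
          hat_multFun_coe m u, hat_multFun_coe m v] with x h1 h2 h3 h4
        rw [h1, h2, h3, h4, mul_add]
      map_smul' := fun c u => by
        rw [multFun_eq_iff]
        filter_upwards [hat_smul_coe c (multFun m u), hat_smul_coe c u,
          hat_multFun_coe m u] with x h1 h2 h3
        rw [RingHom.id_apply, h1, h2, h3]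
        ring }
    (by
      obtain ⟨C, hC⟩ := symb_bounded m
      refine ⟨C, fun u => ?_⟩
      rw [← norm_hat, ← norm_hat u]
      exact (congrArg norm (hat_multFun m u)).le.trans (norm_symbMul_le m hC _))

theorem multCLM_apply (m : Symb) (u : L2) : multCLM m u = multFun m u := rfl

/-- The Fourier multipliers with symbols in `Symb`, as an algebra homomorphism. -/
def mult : Symb →ₐ[ℝ] (L2 →L[ℝ] L2) where
  toFun := multCLM
  map_one' := by
    ext1 u
    rw [multCLM_apply, multFun_eq_iff]
    exact Eventually.of_forall fun ξ => (one_mul _).symm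
  map_mul' m n := by
    ext1 u
    rw [multCLM_apply, multFun_eq_iff]
    refine (hat_multFun_coe m (multFun n u)).trans ?_
    filter_upwards [hat_multFun_coe n u] with x hx
    rw [hx]
    exact (mul_assoc _ _ _).symm
  map_zero' := by
    ext1 u
    rw [multCLM_apply, multFun_eq_iff]
    refine hat_zero_coe.trans (Eventually.of_forall fun ξ => (zero_mul _).symm)
  map_add' m n := by
    ext1 u
    rw [multCLM_apply, multFun_eq_iff]
    refine (hat_add_coe (multFun m u) (multFun n u)).trans ?_
    filter_upwards [hat_multFun_coe m u, hat_multFun_coe n u] with x h2 h3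
    rw [h2, h3]
    exact (add_mul _ _ _).symm
  commutes' r := by
    ext1 u
    rw [multCLM_apply, multFun_eq_iff]
    exact hat_smul_coe r u

theorem hat_mult (m : Symb) (u : L2) : hat (mult m u) =ᵐ[volume] fun ξ => m.1 ξ * hat u ξ :=
  hat_multFun_coe m u

theorem mult_mul_apply (m n : Symb) (u : L2) : mult (m * n) u = mult m (mult n u) := by
  rw [map_mul]; rfl

theorem norm_mult_le (m : Symb) {C : ℝ} (hC : ∀ ξ, ‖m.1 ξ‖ ≤ C) (u : L2) :
    ‖mult m u‖ ≤ C * ‖u‖ := by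
  rw [← norm_hat, ← norm_hat u]
  exact (congrArg norm (hat_multFun m u)).le.trans (norm_symbMul_le m hC _)

/-- The complex conjugate symbol. -/
def symbConj (m : Symb) : Symb :=
  ⟨fun ξ => (starRingEnd ℂ) (m.1 ξ), Complex.continuous_conj.measurable.comp (symb_measurable m),
    by
      obtain ⟨C, hC⟩ := symb_bounded m
      exact ⟨C, fun ξ => by simpa using hC ξ⟩,
    fun ξ => congrArg _ (m.2.2.2 ξ)⟩

theorem inner_mult_left (m : Symb) (u v : L2) :
    inner ℝ (mult m u) v = inner ℝ u (mult (symbConj m) v) := by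
  rw [inner_hat, inner_hat, L2.inner_def, L2.inner_def]
  congr 1
  apply integral_congr_ae
  filter_upwards [hat_mult m u, hat_mult (symbConj m) v] with x h1 h2
  rw [h1, h2]
  simp [symbConj]
  ring

/-- Strong convergence of Fourier multipliers whose symbols converge boundedly pointwise. -/
theorem tendsto_mult {ι : Type*} {l : Filter ι} [l.IsCountablyGenerated] {m : ι → Symb} {n : Symb}
    {C : ℝ} (hC : ∀ᶠ i in l, ∀ ξ, ‖(m i).1 ξ‖ ≤ C)
    (hm : ∀ ξ, Tendsto (fun i => (m i).1 ξ) l (𝓝 (n.1 ξ))) (u : L2) :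
    Tendsto (fun i => mult (m i) u) l (𝓝 (mult n u)) := by
  rw [tendsto_iff_norm_sub_tendsto_zero]
  obtain ⟨D, hD⟩ := symb_bounded n
  have key : ∀ i, ‖mult (m i) u - mult n u‖ ^ 2
      = ∫ ξ, ‖((m i).1 ξ - n.1 ξ) * hat u ξ‖ ^ 2 := fun i => by
    have h : mult (m i) u - mult n u = mult (m i - n) u := by rw [map_sub]; rfl
    rw [h, ← norm_hat, ← RCLike.ofReal_inj (K := ℂ)]
    push_cast
    rw [← inner_self_eq_norm_sq_to_K, L2.inner_def, ← integral_ofReal]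
    apply integral_congr_ae
    filter_upwards [hat_mult (m i - n) u] with x hx
    rw [hx, inner_self_eq_norm_sq_to_K]
    push_cast
    rfl
  -- Plancherel has turned the norm into this integral, to which dominated convergence applies.
  have h0 : Tendsto (fun i => ∫ ξ, ‖((m i).1 ξ - n.1 ξ) * hat u ξ‖ ^ 2) l
      (𝓝 (∫ _ : Plane, (0 : ℝ))) := by
    apply tendsto_integral_filter_of_dominated_convergence
      (fun ξ => (C + D) ^ 2 * ‖hat u ξ‖ ^ 2)
    · refine Eventually.of_forall fun i => ?_
      exact (((((symb_measurable (m i)).sub (symb_measurable n)).aestronglyMeasurable.mul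
        (Lp.aestronglyMeasurable (hat u))).norm).pow 2)
    · filter_upwards [hC] with i hi
      refine Eventually.of_forall fun ξ => ?_
      rw [Real.norm_of_nonneg (by positivity), norm_mul, mul_pow]
      gcongr
      exact (norm_sub_le _ _).trans (add_le_add (hi ξ) (hD ξ))
    · exact ((Lp.memLp (hat u)).integrable_norm_pow (by norm_num)).const_mul _
    · refine Eventually.of_forall fun ξ => ?_
      have h1 : Tendsto (fun i => ‖((m i).1 ξ - n.1 ξ) * hat u ξ‖ ^ 2) l
          (𝓝 (‖(n.1 ξ - n.1 ξ) * hat u ξ‖ ^ 2)) :=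
        ((((hm ξ).sub_const _).mul_const _).norm).pow 2
      simpa using h1
  have h2 : Tendsto (fun i => √(‖mult (m i) u - mult n u‖ ^ 2)) l (𝓝 (√0)) := by
    refine (Real.continuous_sqrt.tendsto _).comp ?_
    simpa [key] using h0
  simpa [Real.sqrt_sq] using h2

/-! ### Distributions given by polynomially growing symbols -/

/-- Measurable symbols of polynomial growth. -/
def PolyGrowth (m : Plane → ℂ) : Prop :=
  Measurable m ∧ ∃ (C : ℝ) (n : ℕ), ∀ ξ, ‖m ξ‖ ≤ C * (1 + ‖ξ‖ ^ 2) ^ n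

theorem PolyGrowth.mul {m n : Plane → ℂ} (hm : PolyGrowth m) (hn : PolyGrowth n) :
    PolyGrowth (fun ξ => m ξ * n ξ) := by
  obtain ⟨hm, C, k, hC⟩ := hm
  obtain ⟨hn, D, l, hD⟩ := hn
  refine ⟨hm.mul hn, C * D, k + l, fun ξ => ?_⟩
  rw [norm_mul, pow_add, mul_mul_mul_comm]
  exact mul_le_mul (hC ξ) (hD ξ) (norm_nonneg _) ((norm_nonneg _).trans (hC ξ))

theorem polyGrowth_of_le {m : Plane → ℂ} (hm : Measurable m) {C : ℝ}
    (h : ∀ ξ, ‖m ξ‖ ≤ C * (1 + ‖ξ‖ ^ 2)) : PolyGrowth m :=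
  ⟨hm, C, 1, by simpa using h⟩

theorem polyGrowth_const (c : ℂ) : PolyGrowth (fun _ => c) :=
  ⟨measurable_const, ‖c‖, 0, by simp⟩

theorem PolyGrowth.add {m n : Plane → ℂ} (hm : PolyGrowth m) (hn : PolyGrowth n) :
    PolyGrowth (fun ξ => m ξ + n ξ) := by
  obtain ⟨hm, C, k, hC⟩ := hm
  obtain ⟨hn, D, l, hD⟩ := hn
  refine ⟨hm.add hn, |C| + |D|, k + l, fun ξ => (norm_add_le _ _).trans ?_⟩
  have h1 : (1 : ℝ) ≤ 1 + ‖ξ‖ ^ 2 := by nlinarith [sq_nonneg ‖ξ‖]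
  rw [add_mul]
  refine add_le_add ((hC ξ).trans ?_) ((hD ξ).trans ?_)
  · exact mul_le_mul (le_abs_self _) (pow_le_pow_right₀ h1 (by omega)) (by positivity)
      (by positivity)
  · exact mul_le_mul (le_abs_self _) (pow_le_pow_right₀ h1 (by omega)) (by positivity)
      (by positivity)

/-- A power of 1 + |ξ|² times a Schwartz function is again Schwartz, hence square integrable. -/
theorem PolyGrowth.memLp_mul_schwartz {m : Plane → ℂ} (hm : PolyGrowth m) (ψ : 𝓢(Plane, ℂ)) :
    MemLp (fun ξ => m ξ * ψ ξ) 2 volume := by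
  obtain ⟨hm, C, n, hC⟩ := hm
  have hg : (fun ξ : Plane => ((1 + ‖ξ‖ ^ 2 : ℝ)) ^ n).HasTemperateGrowth := by fun_prop
  refine ((SchwartzMap.smulLeftCLM ℂ (fun ξ : Plane => ((1 + ‖ξ‖ ^ 2 : ℝ)) ^ n) ψ).memLp
    2 volume).of_le_mul (c := C)
    (hm.aestronglyMeasurable.mul ψ.continuous.aestronglyMeasurable)
    (Eventually.of_forall fun ξ => ?_)
  rw [SchwartzMap.smulLeftCLM_apply_apply hg, norm_mul, norm_smul, ← mul_assoc]
  refine mul_le_mul_of_nonneg_right ((hC ξ).trans_eq ?_) (norm_nonneg _)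
  rw [Real.norm_of_nonneg (by positivity)]

/-- The distribution whose Fourier transform is `m(ξ) û(ξ)`. -/
def symbDist (m : Plane → ℂ) (u : L2) : Dist := fun φ => ∫ ξ, m ξ * hat u ξ * (𝓕⁻ φ) ξ

theorem symbDist_integrable {m : Plane → ℂ} (hm : PolyGrowth m) (u : L2) (φ : 𝓢(Plane, ℂ)) :
    Integrable (fun ξ => m ξ * hat u ξ * (𝓕⁻ φ) ξ) := by
  refine ((hm.memLp_mul_schwartz (𝓕⁻ φ)).integrable_mul (Lp.memLp (hat u))).congr ?_
  exact Eventually.of_forall fun ξ => by simp only [Pi.mul_apply]; ring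

theorem symbDist_add {m : Plane → ℂ} (hm : PolyGrowth m) (u v : L2) (φ : 𝓢(Plane, ℂ)) :
    symbDist m (u + v) φ = symbDist m u φ + symbDist m v φ := by
  rw [symbDist, symbDist, symbDist,
    ← integral_add (symbDist_integrable hm u φ) (symbDist_integrable hm v φ)]
  apply integral_congr_ae
  filter_upwards [hat_add_coe u v] with ξ h
  rw [h]; ring

theorem symbDist_smul (m : Plane → ℂ) (c : ℝ) (u : L2) (φ : 𝓢(Plane, ℂ)) :
    symbDist m (c • u) φ = c * symbDist m u φ := by
  rw [symbDist, symbDist, ← integral_const_mul]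
  apply integral_congr_ae
  filter_upwards [hat_smul_coe c u] with ξ h
  rw [h]; ring

theorem symbDist_symb_add {m n : Plane → ℂ} (hm : PolyGrowth m) (hn : PolyGrowth n) (u : L2)
    (φ : 𝓢(Plane, ℂ)) :
    symbDist (fun ξ => m ξ + n ξ) u φ = symbDist m u φ + symbDist n u φ := by
  rw [symbDist, symbDist, symbDist,
    ← integral_add (symbDist_integrable hm u φ) (symbDist_integrable hn u φ)]
  congr 1
  ext ξ
  ring

theorem symbDist_symb_smul (m : Plane → ℂ) (c : ℂ) (u : L2) (φ : 𝓢(Plane, ℂ)) :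
    symbDist (fun ξ => c * m ξ) u φ = c * symbDist m u φ := by
  rw [symbDist, symbDist, ← integral_const_mul]
  congr 1
  ext ξ
  ring

theorem symbDist_mult (m : Plane → ℂ) (n : Symb) (u : L2) :
    symbDist m (mult n u) = symbDist (fun ξ => m ξ * n.1 ξ) u := by
  ext φ
  apply integral_congr_ae
  filter_upwards [hat_mult n u] with ξ h
  rw [h]; ring

/-- Evaluation of `symbDist m u` on a test function, as a continuous linear map in `u`. -/
def symbDistCLM {m : Plane → ℂ} (hm : PolyGrowth m) (φ : 𝓢(Plane, ℂ)) : L2 →L[ℝ] ℂ :=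
  LinearMap.mkContinuous
    { toFun := fun u => symbDist m u φ
      map_add' := fun u v => symbDist_add hm u v φ
      map_smul' := fun c u => (symbDist_smul m c u φ).trans Complex.real_smul.symm }
    ‖(hm.memLp_mul_schwartz (𝓕⁻ φ)).toLp‖
    (fun u => by
      set g : L2C := (hm.memLp_mul_schwartz (𝓕⁻ φ)).toLp with hg
      -- The pairing is an L² inner product, so Cauchy-Schwarz gives the bound.
      have h : symbDist m u φ = inner ℂ (conjL g) (hat u) := by
        rw [L2.inner_def]
        apply integral_congr_ae
        filter_upwards [(hm.memLp_mul_schwartz (𝓕⁻ φ)).coeFn_toLp, conjL_coe g] with ξ h1 h2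
        rw [h2, hg, h1]
        simp
        ring
      have h2 : ‖conjL g‖ = ‖g‖ := by
        rw [Lp.norm_def, Lp.norm_def]
        congr 1
        apply eLpNorm_congr_norm_ae
        filter_upwards [conjL_coe g] with x hx
        rw [hx]; simp
      rw [← norm_hat u, ← h2]
      exact (congrArg norm h).le.trans (norm_inner_le_norm _ _))

theorem symbDistCLM_apply {m : Plane → ℂ} (hm : PolyGrowth m) (φ : 𝓢(Plane, ℂ)) (u : L2) :
    symbDistCLM hm φ u = symbDist m u φ := rfl

/-- Testing with Fourier transforms of compactly supported smooth functions gives m · (û - v̂) = 0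
almost everywhere, and m has no zeros. The case m = 1 yields uniqueness of weak derivatives; m = 1 +
bμ|D|² cancels the operator in front of ∂ₜ. -/
theorem eq_of_symbDist_eq {m : Plane → ℂ} (hm : Continuous m) (hm0 : ∀ ξ, m ξ ≠ 0)
    {u v : L2} (h : symbDist m u = symbDist m v) (hg : PolyGrowth m) : u = v := by
  have h0 : ∀ φ, symbDist m (u - v) φ = 0 := fun φ => by
    rw [← symbDistCLM_apply hg, map_sub, symbDistCLM_apply, symbDistCLM_apply, h, sub_self]
  have h1 : ∀ᵐ ξ : Plane, m ξ * hat (u - v) ξ = 0 := by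
    apply ae_eq_zero_of_integral_contDiff_smul_eq_zero
    · have h2 : LocallyIntegrable (fun ξ => hat (u - v) ξ) volume :=
        (Lp.memLp (hat (u - v))).locallyIntegrable (by norm_num)
      have h3 := (locallyIntegrableOn_univ.2 h2).continuousOn_mul hm.continuousOn
        isOpen_univ.isLocallyClosed
      exact locallyIntegrableOn_univ.1 h3
    · intro g hgd hgc
      have hd : ContDiff ℝ (↑(⊤ : ℕ∞)) (fun x => (g x : ℂ)) := Complex.ofRealCLM.contDiff.comp hgd
      have hc : HasCompactSupport (fun x => (g x : ℂ)) :=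
        hgc.comp_left (g := Complex.ofReal) Complex.ofReal_zero
      have := h0 (𝓕 (hc.toSchwartzMap hd))
      rw [symbDist, FourierTransform.fourierInv_fourier_eq] at this
      rw [← this]
      congr 1
      ext ξ
      rw [Complex.real_smul]
      exact mul_comm _ _
  have h2 : hat (u - v) = 0 := by
    apply Lp.ext
    filter_upwards [h1, Lp.coeFn_zero ℂ 2 (volume : Measure Plane)] with ξ h3 h4
    rw [h4]
    exact (mul_eq_zero.1 h3).resolve_left (hm0 ξ)
  rw [← sub_eq_zero]
  exact hat_injective (by rw [h2, map_zero])

/-- The Fourier transforms on L² and on tempered distributions agree; test this on 𝓕⁻ φ. From here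
on all distributions linear in u are treated on the Fourier side. -/
theorem ofFun_eq_symbDist (u : L2) : ofFun u = symbDist (fun _ => 1) u := by
  ext φ
  have h := congrArg (fun T => T (𝓕⁻ φ))
    (Lp.fourier_toTemperedDistribution_eq (toComplex u))
  simp only [TemperedDistribution.fourier_apply, Lp.toTemperedDistribution_apply,
    FourierTransform.fourier_fourierInv_eq] at h
  rw [ofFun, symbDist]
  refine Eq.trans (Eq.trans (integral_congr_ae ?_) h) ?_
  · filter_upwards [toComplex_coe u] with x hx
    rw [hx, smul_eq_mul, mul_comm]
  · congr 1
    ext ξ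
    rw [one_mul, smul_eq_mul, mul_comm]
    rfl

/-- The symbol `2πi ξⱼ` of `∂ⱼ`. -/
def dSym (j : Fin 2) (ξ : Plane) : ℂ := 2 * Real.pi * Complex.I * (ξ j : ℂ)

theorem sum_dSym_sq (ξ : Plane) :
    dSym 0 ξ ^ 2 + dSym 1 ξ ^ 2 = -((2 * Real.pi * ‖ξ‖ : ℝ) : ℂ) ^ 2 := by
  have h4 : ((‖ξ‖ : ℝ) : ℂ) ^ 2 = (ξ 0 : ℂ) ^ 2 + (ξ 1 : ℂ) ^ 2 := by
    rw [← Complex.ofReal_pow, EuclideanSpace.norm_sq_eq, Fin.sum_univ_two]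
    simp
  push_cast
  rw [mul_pow, h4]
  simp only [dSym, mul_pow, Complex.I_sq]
  ring

theorem dPartial_symbDist (j : Fin 2) (m : Plane → ℂ) (u : L2) :
    dPartial j (symbDist m u) = symbDist (fun ξ => dSym j ξ * m ξ) u := by
  ext φ
  rw [dPartial, symbDist, symbDist, ← integral_neg]
  congr 1
  ext ξ
  rw [SchwartzMap.fourierInv_lineDerivOp_eq]
  have : (fun x : Plane => inner ℝ x (e j)).HasTemperateGrowth := by fun_prop
  rw [smul_apply, SchwartzMap.smulLeftCLM_apply_apply this]
  simp [dSym, e, EuclideanSpace.inner_single_right]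
  ring

theorem dLap_symbDist (m : Plane → ℂ) (u : L2) :
    dLap (symbDist m u) = symbDist (fun ξ => -((2 * Real.pi * ‖ξ‖ : ℝ) : ℂ) ^ 2 * m ξ) u := by
  ext φ
  rw [dLap, symbDist, symbDist]
  congr 1
  ext ξ
  have h2 : ∀ j, (𝓕⁻ (∂_{e j} (∂_{e j} φ))) ξ = dSym j ξ ^ 2 * (𝓕⁻ φ) ξ := fun j => by
    have : (fun x : Plane => inner ℝ x (e j)).HasTemperateGrowth := by fun_prop
    rw [SchwartzMap.fourierInv_lineDerivOp_eq, SchwartzMap.fourierInv_lineDerivOp_eq]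
    rw [smul_apply, SchwartzMap.smulLeftCLM_apply_apply this, smul_apply,
      SchwartzMap.smulLeftCLM_apply_apply this]
    simp [dSym, e, EuclideanSpace.inner_single_right]
    ring
  have h3 : Δ φ = ∂_{e 0} (∂_{e 0} φ) + ∂_{e 1} (∂_{e 1} φ) := by
    rw [SchwartzMap.laplacian_eq_sum (EuclideanSpace.basisFun (Fin 2) ℝ), Fin.sum_univ_two]
    simp [e]
  rw [h3, FourierTransform.fourierInv_add, add_apply, h2, h2, ← sum_dSym_sq]
  ring

theorem polyGrowth_dSym (j : Fin 2) : PolyGrowth (dSym j) := by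
  refine polyGrowth_of_le (C := 2 * Real.pi) (by unfold dSym; fun_prop) fun ξ => ?_
  have h1 : ‖dSym j ξ‖ = 2 * Real.pi * ‖ξ j‖ := by
    simp [dSym, abs_of_pos Real.pi_pos]
  rw [h1]
  have h2 : ‖ξ j‖ ≤ ‖ξ‖ := PiLp.norm_apply_le ξ j
  have := Real.pi_pos
  gcongr
  nlinarith [sq_nonneg (‖ξ‖ - 1), norm_nonneg ξ]

theorem norm_dSym_le (j : Fin 2) (ξ : Plane) : ‖dSym j ξ‖ ≤ 2 * Real.pi * ‖ξ‖ := by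
  have h1 : ‖dSym j ξ‖ = 2 * Real.pi * ‖ξ j‖ := by
    simp [dSym, abs_of_pos Real.pi_pos]
  rw [h1]
  exact mul_le_mul_of_nonneg_left (PiLp.norm_apply_le ξ j) (by positivity)

/-! ### Radial symbols and their derivatives -/

/-- Profiles of bounded radial symbols. -/
def RadGood (f : ℝ → ℝ) : Prop := Measurable f ∧ ∃ C, ∀ r, 0 ≤ r → |f r| ≤ C

/-- Profiles of bounded symbols of the form `∂ₖ f(|D|)`. -/
def VecGood (f : ℝ → ℝ) : Prop := Measurable f ∧ ∃ C, ∀ r, 0 ≤ r → |r * f r| ≤ C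

theorem two_pi_norm_nonneg (ξ : Plane) : 0 ≤ 2 * Real.pi * ‖ξ‖ := by positivity

/-- The symbol of `f(|D|)`. -/
def rad (f : ℝ → ℝ) (hf : RadGood f) : Symb :=
  ⟨fun ξ => (f (2 * Real.pi * ‖ξ‖) : ℂ),
    Complex.measurable_ofReal.comp (hf.1.comp (by fun_prop)), by
      obtain ⟨C, hC⟩ := hf.2
      refine ⟨C, fun ξ => ?_⟩
      rw [Complex.norm_real]
      exact hC _ (two_pi_norm_nonneg ξ),
    fun ξ => by simp⟩

/-- The symbol of `∂ₖ f(|D|)`. -/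
def vec (k : Fin 2) (f : ℝ → ℝ) (hf : VecGood f) : Symb :=
  ⟨fun ξ => dSym k ξ * (f (2 * Real.pi * ‖ξ‖) : ℂ),
    (polyGrowth_dSym k).1.mul (Complex.measurable_ofReal.comp (hf.1.comp (by fun_prop))), by
      obtain ⟨C, hC⟩ := hf.2
      refine ⟨C, fun ξ => ?_⟩
      rw [norm_mul, Complex.norm_real]
      refine (mul_le_mul_of_nonneg_right (norm_dSym_le k ξ) (norm_nonneg _)).trans ?_
      have := hC _ (two_pi_norm_nonneg ξ)
      rwa [abs_mul, abs_of_nonneg (two_pi_norm_nonneg ξ)] at this,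
    fun ξ => by simp [dSym, Complex.conj_ofNat]⟩

theorem rad_apply {f : ℝ → ℝ} (hf : RadGood f) (ξ : Plane) :
    (rad f hf).1 ξ = (f (2 * Real.pi * ‖ξ‖) : ℂ) := rfl

theorem vec_apply (k : Fin 2) {f : ℝ → ℝ} (hf : VecGood f) (ξ : Plane) :
    (vec k f hf).1 ξ = dSym k ξ * (f (2 * Real.pi * ‖ξ‖) : ℂ) := rfl

theorem symb_ext {m n : Symb} (h : ∀ ξ, m.1 ξ = n.1 ξ) : m = n := Subtype.ext (funext h)

theorem symb_mul_apply (m n : Symb) (ξ : Plane) : (m * n).1 ξ = m.1 ξ * n.1 ξ := rfl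

theorem symb_add_apply (m n : Symb) (ξ : Plane) : (m + n).1 ξ = m.1 ξ + n.1 ξ := rfl

theorem symb_sub_apply (m n : Symb) (ξ : Plane) : (m - n).1 ξ = m.1 ξ - n.1 ξ := rfl

theorem symb_neg_apply (m : Symb) (ξ : Plane) : (-m).1 ξ = -m.1 ξ := rfl

theorem symb_one_apply (ξ : Plane) : (1 : Symb).1 ξ = 1 := rfl

theorem symb_smul_apply (c : ℝ) (m : Symb) (ξ : Plane) : (c • m).1 ξ = c * m.1 ξ :=
  Complex.real_smul

theorem inner_mult_rad {f : ℝ → ℝ} (hf : RadGood f) (u v : L2) :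
    inner ℝ (mult (rad f hf) u) v = inner ℝ u (mult (rad f hf) v) := by
  have h : symbConj (rad f hf) = rad f hf := symb_ext fun ξ => Complex.conj_ofReal _
  rw [inner_mult_left, h]

theorem inner_mult_vec (k : Fin 2) {f : ℝ → ℝ} (hf : VecGood f) (u v : L2) :
    inner ℝ (mult (vec k f hf) u) v = -inner ℝ u (mult (vec k f hf) v) := by
  have h : symbConj (vec k f hf) = -vec k f hf := symb_ext fun ξ => by
    simp [symbConj, symb_neg_apply, vec_apply, dSym, Complex.conj_ofNat]
  rw [inner_mult_left, h, map_neg, neg_apply, inner_neg_right]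

/-! ### The space `H¹` -/

/-- The profile `(1 + μ r²)^(-1/2)`. -/
def rho (μ r : ℝ) : ℝ := (√(1 + μ * r ^ 2))⁻¹

theorem rho_pos {μ : ℝ} (hμ : 0 < μ) (r : ℝ) : 0 < rho μ r := by
  unfold rho; positivity

theorem rho_sq {μ : ℝ} (hμ : 0 < μ) (r : ℝ) : rho μ r ^ 2 = (1 + μ * r ^ 2)⁻¹ := by
  unfold rho
  rw [inv_pow, Real.sq_sqrt (by positivity)]

theorem rho_sq_mul {μ : ℝ} (hμ : 0 < μ) (r : ℝ) : rho μ r ^ 2 * (1 + μ * r ^ 2) = 1 := by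
  rw [rho_sq hμ, inv_mul_cancel₀ (by positivity)]

theorem rho_le_one {μ : ℝ} (hμ : 0 < μ) (r : ℝ) : rho μ r ≤ 1 := by
  have h1 := rho_sq_mul hμ r
  have h2 := rho_pos hμ r
  have : 0 ≤ rho μ r ^ 2 * (μ * r ^ 2) := by positivity
  nlinarith

theorem mul_rho_sq_le {μ : ℝ} (hμ : 0 < μ) (r : ℝ) : μ * (r * rho μ r) ^ 2 ≤ 1 := by
  have h1 := rho_sq_mul hμ r
  nlinarith [sq_nonneg (rho μ r)]

theorem abs_mul_rho_le {μ : ℝ} (hμ : 0 < μ) (r : ℝ) : |r * rho μ r| ≤ (√μ)⁻¹ := by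
  have h1 := mul_rho_sq_le hμ r
  have h2 : 0 < √μ := Real.sqrt_pos.2 hμ
  rw [← one_div, le_div_iff₀ h2, ← Real.sqrt_sq_eq_abs, ← Real.sqrt_mul (sq_nonneg _),
    Real.sqrt_le_one, mul_comm]
  exact h1

theorem measurable_rho (μ : ℝ) : Measurable (rho μ) := by unfold rho; fun_prop

theorem radGood_rho {μ : ℝ} (hμ : 0 < μ) : RadGood (rho μ) :=
  ⟨measurable_rho μ, 1, fun r _ => by
    rw [abs_of_pos (rho_pos hμ r)]; exact rho_le_one hμ r⟩

theorem vecGood_rho {μ : ℝ} (hμ : 0 < μ) : VecGood (rho μ) :=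
  ⟨measurable_rho μ, _, fun r _ => abs_mul_rho_le hμ r⟩

/-- The smoothing operator `(1 - μΔ)^(-1/2)`, an isometry of `L²` onto `X⁰_μ`. -/
def smooth {μ : ℝ} (hμ : 0 < μ) : L2 →L[ℝ] L2 := mult (rad _ (radGood_rho hμ))

theorem isWeakPartial_iff (j : Fin 2) (u g : L2) :
    IsWeakPartial j u g ↔ symbDist (fun _ => 1) g = symbDist (dSym j) u := by
  rw [IsWeakPartial, ofFun_eq_symbDist, ofFun_eq_symbDist, dPartial_symbDist]
  simp only [mul_one]

theorem IsWeakPartial.unique {j : Fin 2} {u g h : L2} (hg : IsWeakPartial j u g)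
    (hh : IsWeakPartial j u h) : g = h :=
  eq_of_symbDist_eq continuous_const (fun _ => one_ne_zero)
    (((isWeakPartial_iff j u g).1 hg).trans ((isWeakPartial_iff j u h).1 hh).symm)
    (polyGrowth_const 1)

theorem IsWeakPartial.weakPartial_eq {j : Fin 2} {u g : L2} (hg : IsWeakPartial j u g) :
    weakPartial j u = g := by
  have h : ∃ g, IsWeakPartial j u g := ⟨g, hg⟩
  rw [weakPartial, dif_pos h]
  exact h.choose_spec.unique hg

theorem isWeakPartial_smooth {μ : ℝ} (hμ : 0 < μ) (j : Fin 2) (f : L2) :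
    IsWeakPartial j (smooth hμ f) (mult (vec j _ (vecGood_rho hμ)) f) := by
  rw [isWeakPartial_iff, smooth, symbDist_mult, symbDist_mult]
  simp only [one_mul, vec_apply, rad_apply]

theorem memH1_smooth {μ : ℝ} (hμ : 0 < μ) (f : L2) : MemH1 (smooth hμ f) :=
  fun j => ⟨_, isWeakPartial_smooth hμ j f⟩

/-- At the level of symbols this is ρ²(1 + μr²) = 1. The minus signs below come from
skew-adjointness of ∂ⱼ. -/
theorem normX_smooth {μ : ℝ} (hμ : 0 < μ) (f : L2) : normX μ (smooth hμ f) = ‖f‖ := by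
  have h1 : ‖smooth hμ f‖ ^ 2 =
      inner ℝ f (mult (rad _ (radGood_rho hμ) * rad _ (radGood_rho hμ)) f) := by
    rw [← real_inner_self_eq_norm_sq, smooth, inner_mult_rad, mult_mul_apply]
  have h2 : ∀ j, ‖weakPartial j (smooth hμ f)‖ ^ 2 =
      -inner ℝ f (mult (vec j _ (vecGood_rho hμ) * vec j _ (vecGood_rho hμ)) f) := fun j => by
    rw [(isWeakPartial_smooth hμ j f).weakPartial_eq, ← real_inner_self_eq_norm_sq,
      inner_mult_vec, mult_mul_apply]
  have h3 : rad _ (radGood_rho hμ) * rad _ (radGood_rho hμ)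
      - (μ • (vec 0 _ (vecGood_rho hμ) * vec 0 _ (vecGood_rho hμ))
      + μ • (vec 1 _ (vecGood_rho hμ) * vec 1 _ (vecGood_rho hμ))) = 1 := symb_ext fun ξ => by
    simp only [symb_sub_apply, symb_add_apply, symb_mul_apply, symb_smul_apply, rad_apply,
      vec_apply, symb_one_apply]
    have h4 := sum_dSym_sq ξ
    have h5 := congrArg Complex.ofReal (rho_sq_mul hμ (2 * Real.pi * ‖ξ‖))
    push_cast at h4 h5 ⊢
    linear_combination h5 - μ * (rho μ (2 * Real.pi * ‖ξ‖) : ℂ) ^ 2 * h4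
  rw [normX, Fin.sum_univ_two, h1, h2, h2]
  have h4 : ‖f‖ ^ 2 = inner ℝ f (mult (1 : Symb) f) := by
    rw [map_one, ← real_inner_self_eq_norm_sq]; rfl
  rw [← Real.sqrt_sq (norm_nonneg f), h4, ← h3, map_sub, map_add, map_smul, map_smul,
    sub_apply, add_apply, smul_apply, smul_apply, inner_sub_right, inner_add_right,
    inner_smul_right, inner_smul_right]
  congr 1
  ring

theorem exists_smooth_eq {μ : ℝ} (hμ : 0 < μ) {u : L2} (hu : MemH1 u) :
    ∃ f, smooth hμ f = u := by
  choose g hg using hu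
  have hc : Continuous fun ξ : Plane => (1 + μ * (2 * Real.pi * ‖ξ‖) ^ 2 : ℂ) := by fun_prop
  have hp : PolyGrowth fun ξ : Plane => (1 + μ * (2 * Real.pi * ‖ξ‖) ^ 2 : ℂ) := by
    refine polyGrowth_of_le hc.measurable (C := 1 + μ * (2 * Real.pi) ^ 2) fun ξ => ?_
    rw [show (1 + μ * (2 * Real.pi * ‖ξ‖) ^ 2 : ℂ)
      = ((1 + μ * (2 * Real.pi * ‖ξ‖) ^ 2 : ℝ) : ℂ) by push_cast; rfl, Complex.norm_real,
      Real.norm_of_nonneg (by positivity)]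
    nlinarith [mul_nonneg hμ.le (sq_nonneg (2 * Real.pi)), sq_nonneg ‖ξ‖]
  have key : ∀ (ξ : Plane), (rho μ (2 * Real.pi * ‖ξ‖) : ℂ) ^ 2
      * (1 + μ * (2 * Real.pi * ‖ξ‖) ^ 2) = 1 := fun ξ => by
    have h5 := congrArg Complex.ofReal (rho_sq_mul hμ (2 * Real.pi * ‖ξ‖))
    push_cast at h5
    exact h5
  have hd : ∀ j φ, symbDist (dSym j) (g j) φ = symbDist (fun ξ => dSym j ξ * dSym j ξ) u φ :=
    fun j φ => by
    rw [← dPartial_symbDist, ← (isWeakPartial_iff j u (g j)).1 (hg j), dPartial_symbDist]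
    simp only [mul_one]
  -- The witness is (1 - μΔ)^(1/2) u, written as (1 - μΔ)^(-1/2)(u - μ ∑ ∂ⱼ∂ⱼu) so that only bounded
  -- operators act on u and on its weak derivatives. Equality is checked after multiplication by 1 +
  -- μ|D|².
  refine ⟨smooth hμ u - μ • (mult (vec 0 _ (vecGood_rho hμ)) (g 0)
    + mult (vec 1 _ (vecGood_rho hμ)) (g 1)), ?_⟩
  refine eq_of_symbDist_eq hc (fun ξ h => ?_) ?_ hp
  · have := key ξ
    rw [h, mul_zero] at this
    exact zero_ne_one this
  ext φ
  have e1 : symbDist (fun ξ : Plane => (1 + μ * (2 * Real.pi * ‖ξ‖) ^ 2 : ℂ))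
      (smooth hμ (smooth hμ u)) φ = symbDist (fun _ => 1) u φ := by
    rw [smooth, symbDist_mult, symbDist_mult]
    congr 1
    ext ξ
    simp only [rad_apply]
    linear_combination key ξ
  have e2 : ∀ j, symbDist (fun ξ : Plane => (1 + μ * (2 * Real.pi * ‖ξ‖) ^ 2 : ℂ))
      (smooth hμ (mult (vec j _ (vecGood_rho hμ)) (g j))) φ = symbDist (dSym j) (g j) φ :=
    fun j => by
    rw [smooth, symbDist_mult, symbDist_mult]
    congr 1
    ext ξ
    simp only [rad_apply, vec_apply]
    linear_combination dSym j ξ * key ξ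
  rw [← symbDistCLM_apply hp, map_sub, map_sub, map_smul, map_smul, map_add, map_add,
    symbDistCLM_apply, symbDistCLM_apply, symbDistCLM_apply, e1, e2, e2, hd, hd,
    Complex.real_smul, ← symbDist_symb_add ((polyGrowth_dSym 0).mul (polyGrowth_dSym 0))
      ((polyGrowth_dSym 1).mul (polyGrowth_dSym 1)), sub_eq_add_neg, ← neg_mul,
    ← symbDist_symb_smul, ← symbDist_symb_add (polyGrowth_const 1)]
  · congr 1
    ext ξ
    have h4 := sum_dSym_sq ξ
    push_cast at h4
    linear_combination -μ * h4
  · exact (polyGrowth_const _).mul (((polyGrowth_dSym 0).mul (polyGrowth_dSym 0)).add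
      ((polyGrowth_dSym 1).mul (polyGrowth_dSym 1)))

/-! ### Ladyzhenskaya's inequality -/

/-- The constant of the Gagliardo-Nirenberg-Sobolev inequality `‖h‖_{L²} ≤ C ‖∇h‖_{L¹}`. -/
def gnsConst : NNReal := SNormLESNormFDerivOfEqConst ℂ (volume : Measure Plane) 1

theorem eLpNorm_two_le_of_hasCompactSupport {h : Plane → ℂ} (hh : ContDiff ℝ 1 h)
    (hc : HasCompactSupport h) :
    eLpNorm h 2 volume ≤ gnsConst * eLpNorm (fderiv ℝ h) 1 volume := by
  have := eLpNorm_le_eLpNorm_fderiv_of_eq (F := ℂ) (volume : Measure Plane) hh hc (p := 1)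
    (p' := 2) le_rfl (by simp) (by simp; norm_num)
  simpa [gnsConst] using this

/-- Dilating one bump function by n + 1 divides its gradient by n + 1. -/
theorem exists_cutoffs : ∃ (η : ℕ → Plane → ℝ) (δ : ℕ → ℝ),
    (∀ n, ContDiff ℝ 1 (η n)) ∧ (∀ n, HasCompactSupport (η n)) ∧ (∀ n x, ‖η n x‖ ≤ 1) ∧
    (∀ n, 0 ≤ δ n) ∧ (∀ n x, ‖fderiv ℝ (η n) x‖ ≤ δ n) ∧ Tendsto δ atTop (𝓝 0) ∧
    ∀ x, Tendsto (fun n => η n x) atTop (𝓝 1) := by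
  let χ : ContDiffBump (0 : Plane) := default
  have hχd : ContDiff ℝ 1 χ := χ.contDiff
  obtain ⟨D, hD⟩ : ∃ D, ∀ x, ‖fderiv ℝ χ x‖ ≤ D :=
    (hχd.continuous_fderiv one_ne_zero).bounded_above_of_compact_support
      (χ.hasCompactSupport.fderiv ℝ)
  have hD0 : 0 ≤ D := (norm_nonneg _).trans (hD 0)
  let s : ℕ → ℝ := fun n => 1 / ((n : ℝ) + 1)
  have hs : ∀ n, 0 < s n := fun n => by positivity
  have hs0 : Tendsto s atTop (𝓝 0) := tendsto_one_div_add_atTop_nhds_zero_nat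
  refine ⟨fun n x => χ (s n • x), fun n => s n * D, fun n => hχd.comp (contDiff_const_smul _),
    fun n => ?_, fun n x => ?_, fun n => mul_nonneg (hs n).le hD0, fun n x => ?_, ?_, fun x => ?_⟩
  · exact χ.hasCompactSupport.comp_homeomorph (Homeomorph.smulOfNeZero (s n) (hs n).ne')
  · rw [Real.norm_of_nonneg χ.nonneg]; exact χ.le_one
  · have : fderiv ℝ (fun x => χ (s n • x)) x = s n • fderiv ℝ χ (s n • x) := fderiv_comp_smul _
    rw [this, norm_smul, Real.norm_of_nonneg (hs n).le]
    exact mul_le_mul_of_nonneg_left (hD _) (hs n).le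
  · simpa using hs0.mul_const D
  · have h1 : Tendsto (fun n => χ (s n • x)) atTop (𝓝 (χ ((0 : ℝ) • x))) :=
      (χ.continuous.tendsto _).comp (hs0.smul_const x)
    have h2 : χ ((0 : ℝ) • x) = 1 := by
      rw [zero_smul]; exact χ.one_of_mem_closedBall (by simp [χ.rIn_pos.le])
    rwa [h2] at h1

theorem norm_fderiv_cutoff_le {h : Plane → ℂ} (hh : ContDiff ℝ 1 h) {η : Plane → ℝ} {δ : ℝ}
    (hηd : ContDiff ℝ 1 η) (hη1 : ∀ x, ‖η x‖ ≤ 1)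
    (hηδ : ∀ x, ‖fderiv ℝ η x‖ ≤ δ) (x : Plane) :
    ‖fderiv ℝ (fun x => η x • h x) x‖ ≤ ‖fderiv ℝ h x‖ + δ * ‖h x‖ := by
    rw [fderiv_fun_smul (hηd.differentiable one_ne_zero x) (hh.differentiable one_ne_zero x)]
    refine (norm_add_le _ _).trans (add_le_add ?_ ?_)
    · rw [norm_smul]
      exact mul_le_of_le_one_left (norm_nonneg _) (hη1 x)
    · rw [ContinuousLinearMap.norm_smulRight_apply]
      exact mul_le_mul_of_nonneg_right (hηδ x) (norm_nonneg _)

theorem eLpNorm_fderiv_cutoff_le {h : Plane → ℂ} (hh : ContDiff ℝ 1 h) {η : Plane → ℝ} {δ : ℝ}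
    (hηd : ContDiff ℝ 1 η) (hη1 : ∀ x, ‖η x‖ ≤ 1) (hδ : 0 ≤ δ)
    (hηδ : ∀ x, ‖fderiv ℝ η x‖ ≤ δ) :
    eLpNorm (fderiv ℝ fun x => η x • h x) 1 volume ≤
      (eLpNorm (fderiv ℝ h) 1 volume + ENNReal.ofReal δ * eLpNorm h 1 volume) := by
  have hm : AEStronglyMeasurable (fderiv ℝ h) volume :=
    (hh.continuous_fderiv one_ne_zero).aestronglyMeasurable
  have hm' : AEStronglyMeasurable (fun x => δ * ‖h x‖) volume :=
    (continuous_const.mul hh.continuous.norm).aestronglyMeasurable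
  refine (eLpNorm_mono_real (norm_fderiv_cutoff_le hh hηd hη1 hηδ)).trans ?_
  refine (eLpNorm_add_le hm.norm hm' le_rfl).trans ?_
  rw [eLpNorm_norm]
  refine add_le_add le_rfl ?_
  refine (eLpNorm_const_smul δ (fun x => ‖h x‖) 1 volume).le.trans ?_
  rw [Real.enorm_eq_ofReal hδ, eLpNorm_norm]

theorem eLpNorm_two_cutoff_le {h : Plane → ℂ} (hh : ContDiff ℝ 1 h) {η : Plane → ℝ} {δ : ℝ}
    (hηd : ContDiff ℝ 1 η) (hηc : HasCompactSupport η) (hη1 : ∀ x, ‖η x‖ ≤ 1) (hδ : 0 ≤ δ)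
    (hηδ : ∀ x, ‖fderiv ℝ η x‖ ≤ δ) :
    eLpNorm (fun x => η x • h x) 2 volume
      ≤ gnsConst * (eLpNorm (fderiv ℝ h) 1 volume + ENNReal.ofReal δ * eLpNorm h 1 volume) := by
  refine (eLpNorm_two_le_of_hasCompactSupport (hηd.smul hh) hηc.smul_right).trans ?_
  exact mul_le_mul_right (eLpNorm_fderiv_cutoff_le hh hηd hη1 hδ hηδ) _

/-- Compact support is removed by cutting off: the gradient of the cutoff costs δₙ‖h‖₁ → 0, and
Fatou's lemma handles the left side. Squares of Schwartz functions, to which this is applied, need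
not have compact support. -/
theorem eLpNorm_two_le {h : Plane → ℂ} (hh : ContDiff ℝ 1 h) (hi : eLpNorm h 1 volume ≠ ⊤) :
    eLpNorm h 2 volume ≤ gnsConst * eLpNorm (fderiv ℝ h) 1 volume := by
  obtain ⟨η, δ, hηd, hηc, hη1, hδ, hηδ, hδ0, hη⟩ := exists_cutoffs
  have hlim : ∀ x, Tendsto (fun n => η n x • h x) atTop (𝓝 (h x)) := fun x => by
    simpa using (hη x).smul_const (h x)
  refine (Lp.eLpNorm_lim_le_liminf_eLpNorm
    (fun n => ((hηd n).continuous.smul hh.continuous).aestronglyMeasurable) h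
    (Eventually.of_forall hlim)).trans ?_
  have ht : Tendsto (fun n => (gnsConst : ENNReal) * (eLpNorm (fderiv ℝ h) 1 volume
        + ENNReal.ofReal (δ n) * eLpNorm h 1 volume)) atTop
      (𝓝 (gnsConst * (eLpNorm (fderiv ℝ h) 1 volume
        + ENNReal.ofReal 0 * eLpNorm h 1 volume))) := by
    refine ENNReal.Tendsto.const_mul (tendsto_const_nhds.add ?_) (Or.inr ENNReal.coe_ne_top)
    exact ENNReal.Tendsto.mul_const (ENNReal.tendsto_ofReal hδ0) (Or.inr hi)
  refine (liminf_le_liminf (Eventually.of_forall fun n =>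
    eLpNorm_two_cutoff_le hh (hηd n) (hηc n) (hη1 n) (hδ n) (hηδ n))).trans ?_
  rw [ht.liminf_eq]
  simp

instance holderTriple_four_four_two : ENNReal.HolderTriple 4 4 2 where
  inv_add_inv_eq_inv := by
    rw [← ENNReal.toReal_eq_toReal_iff' (by simp) (by simp),
      ENNReal.toReal_add (by simp) (by simp)]
    simp
    norm_num

theorem eLpNorm_sq (g : Plane → ℂ) (p : ENNReal) :
    eLpNorm (fun x => g x ^ 2) p volume = eLpNorm g (p * 2) volume ^ 2 := by
  have h := eLpNorm_norm_rpow (p := p) (q := 2) (μ := (volume : Measure Plane)) g (by norm_num)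
  have e : ENNReal.ofReal 2 = 2 := by norm_num
  rw [e] at h
  rw [← ENNReal.rpow_two, ← h]
  apply eLpNorm_congr_norm_ae
  exact Eventually.of_forall fun x => by simp

theorem eLpNorm_fderiv_sq_le {g : Plane → ℂ} (hg : ContDiff ℝ 1 g) :
    eLpNorm (fderiv ℝ fun x => g x ^ 2) 1 volume
      ≤ 2 * (eLpNorm g 2 volume * eLpNorm (fderiv ℝ g) 2 volume) := by
  have h2 : ∀ x, ‖fderiv ℝ (fun x => g x ^ 2) x‖ ≤ 2 * ‖((fun x => ‖g x‖) • fderiv ℝ g) x‖ :=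
    fun x => by
    rw [fderiv_fun_pow 2 (hg.differentiable one_ne_zero x), norm_smul]
    simp [norm_smul, mul_assoc]
  refine (eLpNorm_le_mul_eLpNorm_of_ae_le_mul (Eventually.of_forall h2) 1).trans ?_
  rw [ENNReal.ofReal_ofNat]
  refine mul_le_mul_right ?_ _
  have h3 := eLpNorm_smul_le_mul_eLpNorm (p := 2) (q := 2) (r := 1)
    (hg.continuous_fderiv one_ne_zero).aestronglyMeasurable
    (hg.continuous.norm.aestronglyMeasurable (μ := (volume : Measure Plane)))
  rwa [eLpNorm_norm] at h3

/-- **Ladyzhenskaya's inequality** for Schwartz functions on the plane. -/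
theorem eLpNorm_four_sq_le (g : 𝓢(Plane, ℂ)) :
    eLpNorm g 4 volume ^ 2
      ≤ gnsConst * (2 * (eLpNorm g 2 volume * eLpNorm (fderiv ℝ g) 2 volume)) := by
  have hg : ContDiff ℝ 1 g := g.smooth 1
  have h1 : eLpNorm (fun x => g x ^ 2) 1 volume ≠ ⊤ := by
    rw [eLpNorm_sq]
    exact ENNReal.pow_ne_top (g.eLpNorm_lt_top _ volume).ne
  have h4 := eLpNorm_sq g 2
  rw [show (2 : ENNReal) * 2 = 4 by norm_num] at h4
  rw [← h4]
  -- The L¹ Sobolev inequality is applied to g²; Cauchy-Schwarz bounds its gradient 2g∇g.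
  exact (eLpNorm_two_le (hg.pow 2) h1).trans (mul_le_mul_right (eLpNorm_fderiv_sq_le hg) _)

/-! ### The embedding of `X⁰_μ` into `L⁴` -/

theorem eLpNorm_eq_toLp (g : 𝓢(Plane, ℂ)) :
    eLpNorm g 2 volume = ENNReal.ofReal ‖g.toLp 2 (volume : Measure Plane)‖ := by
  rw [SchwartzMap.norm_toLp, ENNReal.ofReal_toReal (g.eLpNorm_lt_top _ _).ne]

theorem eLpNorm_fourier (g : 𝓢(Plane, ℂ)) :
    eLpNorm (𝓕 g : 𝓢(Plane, ℂ)) 2 volume = eLpNorm g 2 volume := by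
  rw [eLpNorm_eq_toLp, eLpNorm_eq_toLp, SchwartzMap.norm_fourier_toL2_eq]

theorem eLpNorm_fderiv_le (g : 𝓢(Plane, ℂ)) :
    eLpNorm (fderiv ℝ g) 2 volume
      ≤ eLpNorm (∂_{e 0} g : 𝓢(Plane, ℂ)) 2 volume
        + eLpNorm (∂_{e 1} g : 𝓢(Plane, ℂ)) 2 volume := by
  have h : ∀ x, ‖fderiv ℝ g x‖ ≤ ‖(∂_{e 0} g : 𝓢(Plane, ℂ)) x‖ + ‖(∂_{e 1} g : 𝓢(Plane, ℂ)) x‖ :=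
    fun x => by
    refine ContinuousLinearMap.opNorm_le_bound _ (by positivity) fun v => ?_
    have hv : v = v 0 • e 0 + v 1 • e 1 := by
      ext i; fin_cases i <;> simp [e]
    have h0 : ‖v 0‖ ≤ ‖v‖ := PiLp.norm_apply_le v 0
    have h1 : ‖v 1‖ ≤ ‖v‖ := PiLp.norm_apply_le v 1
    rw [SchwartzMap.lineDerivOp_apply_eq_fderiv, SchwartzMap.lineDerivOp_apply_eq_fderiv]
    conv_lhs => rw [hv]
    rw [map_add, map_smul, map_smul]
    refine (norm_add_le _ _).trans ?_
    rw [norm_smul, norm_smul, add_mul, mul_comm _ ‖v‖, mul_comm _ ‖v‖]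
    gcongr
  refine (eLpNorm_mono_real h).trans ((eLpNorm_add_le
    (∂_{e 0} g : 𝓢(Plane, ℂ)).continuous.norm.aestronglyMeasurable
    (∂_{e 1} g : 𝓢(Plane, ℂ)).continuous.norm.aestronglyMeasurable (by norm_num)).trans ?_)
  rw [eLpNorm_norm, eLpNorm_norm]

theorem hasTemperateGrowth_rho {μ : ℝ} (hμ : 0 < μ) :
    (fun ξ : Plane => (rho μ (2 * Real.pi * ‖ξ‖) : ℂ)).HasTemperateGrowth := by
  have h1 := (Function.hasTemperateGrowth_one_add_norm_sq_rpow Plane (-(1/2) : ℝ))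
  have h2 : (fun ξ : Plane => (√μ * (2 * Real.pi)) • ξ).HasTemperateGrowth := by fun_prop
  have h3 := Function.HasTemperateGrowth.comp Function.Complex.hasTemperateGrowth_ofReal
    (h1.comp h2)
  refine Eq.mp (congrArg _ ?_) h3
  ext ξ
  simp only [Function.comp_apply, rho]
  congr 1
  rw [Real.rpow_neg (by positivity), ← Real.sqrt_eq_rpow, norm_smul,
    Real.norm_of_nonneg (by positivity), mul_pow, mul_pow, Real.sq_sqrt hμ.le]
  ring_nf

/-- The operator `(1 - μΔ)^(-1/2)` on Schwartz functions. -/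
def smoothS (μ : ℝ) (f : 𝓢(Plane, ℂ)) : 𝓢(Plane, ℂ) :=
  SchwartzMap.fourierMultiplierCLM ℂ (fun ξ : Plane => (rho μ (2 * Real.pi * ‖ξ‖) : ℂ)) f

theorem fourier_smoothS {μ : ℝ} (hμ : 0 < μ) (f : 𝓢(Plane, ℂ)) (ξ : Plane) :
    (𝓕 (smoothS μ f)) ξ = (rho μ (2 * Real.pi * ‖ξ‖) : ℂ) * (𝓕 f) ξ := by
  rw [smoothS, SchwartzMap.fourierMultiplierCLM_apply, FourierTransform.fourier_fourierInv_eq,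
    SchwartzMap.smulLeftCLM_apply_apply (hasTemperateGrowth_rho hμ), smul_eq_mul]

theorem eLpNorm_smoothS_le {μ : ℝ} (hμ : 0 < μ) (f : 𝓢(Plane, ℂ)) :
    eLpNorm (smoothS μ f) 2 volume ≤ eLpNorm f 2 volume := by
  rw [← eLpNorm_fourier, ← eLpNorm_fourier f]
  refine eLpNorm_mono fun ξ => ?_
  rw [fourier_smoothS hμ, norm_mul, Complex.norm_real, Real.norm_of_nonneg (rho_pos hμ _).le]
  exact mul_le_of_le_one_left (norm_nonneg _) (rho_le_one hμ _)

theorem eLpNorm_lineDeriv_smoothS_le {μ : ℝ} (hμ : 0 < μ) (j : Fin 2) (f : 𝓢(Plane, ℂ)) :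
    eLpNorm (∂_{e j} (smoothS μ f) : 𝓢(Plane, ℂ)) 2 volume
      ≤ ENNReal.ofReal (√μ)⁻¹ * eLpNorm f 2 volume := by
  rw [← eLpNorm_fourier, ← eLpNorm_fourier f]
  refine eLpNorm_le_mul_eLpNorm_of_ae_le_mul (Eventually.of_forall fun ξ => ?_) 2
  have : (fun x : Plane => inner ℝ x (e j)).HasTemperateGrowth := by fun_prop
  have h1 : (𝓕 (∂_{e j} (smoothS μ f))) ξ = dSym j ξ * (𝓕 (smoothS μ f)) ξ := by
    rw [SchwartzMap.fourier_lineDerivOp_eq, smul_apply, SchwartzMap.smulLeftCLM_apply_apply this]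
    simp [dSym, e, EuclideanSpace.inner_single_right]
    ring
  rw [h1, fourier_smoothS hμ, ← mul_assoc, norm_mul, norm_mul, Complex.norm_real]
  refine mul_le_mul_of_nonneg_right ?_ (norm_nonneg _)
  refine (mul_le_mul_of_nonneg_right (norm_dSym_le j ξ) (norm_nonneg _)).trans ?_
  rw [Real.norm_eq_abs, ← abs_of_nonneg (two_pi_norm_nonneg ξ), ← abs_mul,
    abs_of_nonneg (two_pi_norm_nonneg ξ)]
  exact abs_mul_rho_le hμ _

/-- Ladyzhenskaya's inequality uses a single derivative, and ∂ⱼ(1 - μΔ)^(-1/2) costs μ^(-1/2). This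
power decides that ε/√μ is the size of the nonlinearity. The factor 4 is 2 from differentiating a
square times 2 partial derivatives. -/
theorem eLpNorm_four_smoothS_le {μ : ℝ} (hμ : 0 < μ) (f : 𝓢(Plane, ℂ)) :
    eLpNorm (smoothS μ f) 4 volume ^ 2
      ≤ ENNReal.ofReal (4 * gnsConst * (√μ)⁻¹) * eLpNorm f 2 volume ^ 2 := by
  refine (eLpNorm_four_sq_le _).trans ?_
  calc (gnsConst : ENNReal) * (2 * (eLpNorm (smoothS μ f) 2 volume
        * eLpNorm (fderiv ℝ (smoothS μ f)) 2 volume))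
      ≤ gnsConst * (2 * (eLpNorm f 2 volume * (ENNReal.ofReal (√μ)⁻¹ * eLpNorm f 2 volume
        + ENNReal.ofReal (√μ)⁻¹ * eLpNorm f 2 volume))) := by
        gcongr
        · exact eLpNorm_smoothS_le hμ f
        · exact (eLpNorm_fderiv_le _).trans (add_le_add (eLpNorm_lineDeriv_smoothS_le hμ 0 f)
            (eLpNorm_lineDeriv_smoothS_le hμ 1 f))
    _ = _ := by
        rw [ENNReal.ofReal_mul (by positivity), ENNReal.ofReal_mul (by norm_num)]
        have : ENNReal.ofReal (gnsConst : ℝ) = gnsConst := ENNReal.ofReal_coe_nnreal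
        rw [this, show ENNReal.ofReal 4 = 4 by norm_num]
        ring

theorem toComplex_smooth {μ : ℝ} (hμ : 0 < μ) (f : L2) :
    toComplex (smooth hμ f) = 𝓕⁻ (symbMul (rad _ (radGood_rho hμ)) (hat f)) := by
  have h : hat (smooth hμ f) = symbMul (rad _ (radGood_rho hμ)) (hat f) := hat_multFun _ f
  rw [← h, hat_apply, FourierTransform.fourierInv_fourier_eq]

theorem toLp_smoothS {μ : ℝ} (hμ : 0 < μ) (f : 𝓢(Plane, ℂ)) :
    (smoothS μ f).toLp 2 = 𝓕⁻ (symbMul (rad _ (radGood_rho hμ)) (𝓕 (f.toLp 2))) := by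
  have h : 𝓕 ((smoothS μ f).toLp 2) = symbMul (rad _ (radGood_rho hμ)) (𝓕 (f.toLp 2)) := by
    symm
    rw [symbMul_eq_iff, SchwartzMap.toLp_fourier_eq, SchwartzMap.toLp_fourier_eq]
    filter_upwards [(𝓕 (smoothS μ f)).coeFn_toLp 2 volume, (𝓕 f).coeFn_toLp 2 volume]
      with ξ h1 h2
    rw [h1, h2, fourier_smoothS hμ, rad_apply]
  rw [← h, FourierTransform.fourierInv_fourier_eq]

theorem symbMul_sub (m : Symb) (f g : L2C) : symbMul m f - symbMul m g = symbMul m (f - g) := by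
  symm
  rw [symbMul_eq_iff]
  filter_upwards [Lp.coeFn_sub (symbMul m f) (symbMul m g), Lp.coeFn_sub f g, symbMul_coe m f,
    symbMul_coe m g] with x h1 h2 h3 h4
  rw [h1, h2, Pi.sub_apply, Pi.sub_apply, h3, h4, mul_sub]

theorem continuous_symbMul (m : Symb) : Continuous (symbMul m) := by
  obtain ⟨C, hC⟩ := symb_bounded m
  refine (LipschitzWith.of_dist_le_mul (K := C.toNNReal) fun f g => ?_).continuous
  rw [dist_eq_norm, dist_eq_norm, symbMul_sub]
  refine (norm_symbMul_le m hC _).trans ?_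
  exact mul_le_mul_of_nonneg_right (Real.le_coe_toNNReal C) (norm_nonneg _)

theorem exists_seq_smoothS_tendsto {μ : ℝ} (hμ : 0 < μ) (u : L2) :
    ∃ f : ℕ → 𝓢(Plane, ℂ),
      Tendsto (fun n => ‖(f n).toLp 2 (volume : Measure Plane)‖) atTop (𝓝 ‖u‖) ∧
      ∀ᵐ x : Plane, Tendsto (fun n => (smoothS μ (f n)).toLp 2 (volume : Measure Plane) x) atTop
        (𝓝 (toComplex (smooth hμ u) x)) := by
  obtain ⟨y, hy, hyt⟩ := mem_closure_iff_seq_limit.1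
    ((SchwartzMap.denseRange_toLpCLM (p := 2) (E := Plane) (F := ℂ) (μ := volume)
      ENNReal.ofNat_ne_top) (toComplex u))
  choose f hf using hy
  have hf' : Tendsto (fun n => (f n).toLp 2 (volume : Measure Plane)) atTop
      (𝓝 (toComplex u)) := by
    have : (fun n => (f n).toLp 2 (volume : Measure Plane)) = y := funext hf
    rwa [this]
  have hg : Tendsto (fun n => (smoothS μ (f n)).toLp 2 (volume : Measure Plane)) atTop
      (𝓝 (toComplex (smooth hμ u))) := by
    simp only [toLp_smoothS hμ, toComplex_smooth, hat_apply]
    exact (((Lp.fourierTransformₗᵢ Plane ℂ).symm.continuous.comp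
      ((continuous_symbMul _).comp (Lp.fourierTransformₗᵢ Plane ℂ).continuous)).tendsto _).comp hf'
  obtain ⟨ns, hns, hae⟩ := (tendstoInMeasure_of_tendsto_Lp hg).exists_seq_tendsto_ae
  refine ⟨fun n => f (ns n), ?_, hae⟩
  rw [← norm_toComplex]
  exact (hf'.comp hns.tendsto_atTop).norm

/-- Schwartz approximations converge almost everywhere along a subsequence, and Fatou's lemma
carries the L⁴ bound to the limit. -/
theorem eLpNorm_four_smooth_le {μ : ℝ} (hμ : 0 < μ) (u : L2) :
    eLpNorm (smooth hμ u) 4 volume ^ 2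
      ≤ ENNReal.ofReal (4 * gnsConst * (√μ)⁻¹) * ENNReal.ofReal (‖u‖ ^ 2) := by
  obtain ⟨f, hf, hae⟩ := exists_seq_smoothS_tendsto hμ u
  have h1 : eLpNorm (smooth hμ u) 4 volume = eLpNorm (toComplex (smooth hμ u)) 4 volume := by
    apply eLpNorm_congr_norm_ae
    filter_upwards [toComplex_coe (smooth hμ u)] with x hx
    rw [hx, Complex.norm_real]
  have h2 : eLpNorm (toComplex (smooth hμ u)) 4 volume
      ≤ liminf (fun n => eLpNorm ((smoothS μ (f n)).toLp 2 (volume : Measure Plane))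
        4 volume) atTop :=
    Lp.eLpNorm_lim_le_liminf_eLpNorm (fun n => Lp.aestronglyMeasurable _) _ hae
  have h3 : ∀ n, eLpNorm ((smoothS μ (f n)).toLp 2 (volume : Measure Plane)) 4 volume
      ≤ (ENNReal.ofReal (4 * gnsConst * (√μ)⁻¹)
        * ENNReal.ofReal (‖(f n).toLp 2 (volume : Measure Plane)‖ ^ 2)) ^ (2 : ℝ)⁻¹ :=
    fun n => by
    rw [eLpNorm_congr_ae ((smoothS μ (f n)).coeFn_toLp 2 volume),
      ENNReal.le_rpow_inv_iff (by norm_num), ENNReal.rpow_two]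
    refine (eLpNorm_four_smoothS_le hμ _).trans (le_of_eq ?_)
    rw [eLpNorm_eq_toLp, ENNReal.ofReal_pow (norm_nonneg _)]
  have h4 : Tendsto (fun n => (ENNReal.ofReal (4 * gnsConst * (√μ)⁻¹) * ENNReal.ofReal
      (‖(f n).toLp 2 (volume : Measure Plane)‖ ^ 2)) ^ (2 : ℝ)⁻¹) atTop
      (𝓝 ((ENNReal.ofReal (4 * gnsConst * (√μ)⁻¹) * ENNReal.ofReal (‖u‖ ^ 2)) ^ (2 : ℝ)⁻¹)) :=
    (ENNReal.continuous_rpow_const.tendsto _).comp (ENNReal.Tendsto.const_mul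
      (ENNReal.tendsto_ofReal (hf.pow 2)) (Or.inr ENNReal.ofReal_ne_top))
  have h5 := h2.trans (liminf_le_liminf (Eventually.of_forall h3))
  rw [h4.liminf_eq, ENNReal.le_rpow_inv_iff (by norm_num), ENNReal.rpow_two] at h5
  rw [h1]
  exact h5

/-- The constant in the embedding of `X⁰_μ` into `L⁴`. -/
def embConst (μ : ℝ) : ℝ := 4 * gnsConst * (√μ)⁻¹

theorem memLp_four_smooth {μ : ℝ} (hμ : 0 < μ) (u : L2) : MemLp (smooth hμ u) 4 volume := by
  refine ⟨Lp.aestronglyMeasurable _, ?_⟩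
  have h := (eLpNorm_four_smooth_le hμ u).trans_lt
    (ENNReal.mul_lt_top ENNReal.ofReal_lt_top ENNReal.ofReal_lt_top)
  by_contra hcon
  rw [not_lt_top_iff.1 hcon] at h
  simp at h

instance fact_one_le_four : Fact ((1 : ENNReal) ≤ 4) := ⟨by norm_num⟩

/-- The map `f ↦ (1 - μΔ)^(-1/2) f` from `L²` to `L⁴`. -/
def smoothFour {μ : ℝ} (hμ : 0 < μ) : L2 →L[ℝ] Lp ℝ 4 (volume : Measure Plane) :=
  LinearMap.mkContinuous
    { toFun := fun u => (memLp_four_smooth hμ u).toLp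
      map_add' := fun u v => by
        rw [← MemLp.toLp_add]
        refine MemLp.toLp_congr _ _ ?_
        rw [map_add]
        exact Lp.coeFn_add _ _
      map_smul' := fun c u => by
        rw [RingHom.id_apply, ← MemLp.toLp_const_smul]
        refine MemLp.toLp_congr _ _ ?_
        rw [map_smul]
        exact Lp.coeFn_smul _ _ }
    (√(embConst μ))
    (fun u => by
      have h := eLpNorm_four_smooth_le hμ u
      have hc : 0 ≤ embConst μ := by unfold embConst; positivity
      have h' := ENNReal.toReal_mono (ENNReal.mul_lt_top ENNReal.ofReal_lt_top
        ENNReal.ofReal_lt_top).ne h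
      rw [ENNReal.toReal_pow, ENNReal.toReal_mul, ENNReal.toReal_ofReal (by positivity),
        ENNReal.toReal_ofReal (by positivity)] at h'
      change ‖(memLp_four_smooth hμ u).toLp‖ ≤ _
      rw [Lp.norm_toLp]
      refine (sq_le_sq₀ ENNReal.toReal_nonneg (by positivity)).1 ?_
      rwa [mul_pow, Real.sq_sqrt hc])

theorem smoothFour_coe {μ : ℝ} (hμ : 0 < μ) (u : L2) :
    smoothFour hμ u =ᵐ[volume] smooth hμ u :=
  (memLp_four_smooth hμ u).coeFn_toLp

/-- The product `(f, g) ↦ (1 - μΔ)^(-1/2) f · (1 - μΔ)^(-1/2) g` from `L² × L²` to `L²`. -/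
def prodX {μ : ℝ} (hμ : 0 < μ) : L2 →L[ℝ] L2 →L[ℝ] L2 :=
  ((ContinuousLinearMap.mul ℝ ℝ).holderL volume 4 4 2).bilinearComp (smoothFour hμ) (smoothFour hμ)

theorem prodX_coe {μ : ℝ} (hμ : 0 < μ) (f g : L2) :
    prodX hμ f g =ᵐ[volume] fun x => smooth hμ f x * smooth hμ g x := by
  have h : prodX hμ f g =ᵐ[volume] fun x => smoothFour hμ f x * smoothFour hμ g x :=
    (ContinuousLinearMap.mul ℝ ℝ).coeFn_holder _ _
  filter_upwards [h, smoothFour_coe hμ f, smoothFour_coe hμ g] with x h1 h2 h3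
  rw [h1, h2, h3]

theorem norm_prodX_le {μ : ℝ} (hμ : 0 < μ) (f g : L2) :
    ‖prodX hμ f g‖ ≤ embConst μ * ‖f‖ * ‖g‖ := by
  have hc : 0 ≤ embConst μ := by unfold embConst; positivity
  have hs : ∀ u, ‖smoothFour hμ u‖ ≤ √(embConst μ) * ‖u‖ := fun u =>
    (smoothFour hμ).le_of_opNorm_le (LinearMap.mkContinuous_norm_le _ (Real.sqrt_nonneg _) _) u
  have h : ‖prodX hμ f g‖ ≤ ‖ContinuousLinearMap.mul ℝ ℝ‖ * ‖smoothFour hμ f‖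
      * ‖smoothFour hμ g‖ :=
    (ContinuousLinearMap.mul ℝ ℝ).norm_holder_apply_apply_le _ _
  rw [ContinuousLinearMap.opNorm_mul, one_mul] at h
  refine h.trans ((mul_le_mul (hs f) (hs g) (norm_nonneg _) (by positivity)).trans (le_of_eq ?_))
  rw [mul_mul_mul_comm, Real.mul_self_sqrt hc, mul_assoc]

theorem prodX_comm {μ : ℝ} (hμ : 0 < μ) (f g : L2) : prodX hμ f g = prodX hμ g f := by
  apply Lp.ext
  filter_upwards [prodX_coe hμ f g, prodX_coe hμ g f] with x h1 h2
  rw [h1, h2, mul_comm]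

/-- Both sides integrate the same triple product. This symmetry is what makes the cubic energy
differentiable along solutions. -/
theorem inner_prodX_swap {μ : ℝ} (hμ : 0 < μ) (f g h : L2) :
    inner ℝ (smooth hμ f) (prodX hμ g h) = inner ℝ (smooth hμ g) (prodX hμ f h) := by
  rw [L2.inner_def, L2.inner_def]
  apply integral_congr_ae
  filter_upwards [prodX_coe hμ g h, prodX_coe hμ f h] with x h1 h2
  rw [h1, h2]
  simp
  ring

/-! ### Semilinear evolution equations -/

/-- A strongly continuous isometry group `S(t) = exp(t G)` together with an injective bounded
operator `R`, commuting with the group, such that `A = R G` is bounded. -/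
structure DampedGroup (Y : Type*) [NormedAddCommGroup Y] [NormedSpace ℝ Y] where
  /-- The group. -/
  S : ℝ → Y →L[ℝ] Y
  /-- The damping operator. -/
  R : Y →L[ℝ] Y
  /-- The damped generator. -/
  A : Y →L[ℝ] Y
  S_zero : ∀ y, S 0 y = y
  S_add : ∀ s t y, S (s + t) y = S s (S t y)
  norm_S : ∀ t y, ‖S t y‖ = ‖y‖
  continuous_S : ∀ y, Continuous fun t => S t y
  R_injective : Function.Injective R
  R_comm : ∀ t y, R (S t y) = S t (R y)
  A_comm : ∀ t y, A (S t y) = S t (A y)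
  hasDerivAt : ∀ y t, HasDerivAt (fun t => R (S t y)) (A (S t y)) t

namespace DampedGroup

variable {Y : Type*} [NormedAddCommGroup Y] [NormedSpace ℝ Y] (G : DampedGroup Y)

/-- `W` is a solution of `W' = G W + F(W)` on `I`, where the equation is damped by `R`. -/
structure IsStrong (F : Y → Y) (W : ℝ → Y) (I : Set ℝ) : Prop where
  cont : ContinuousOn W I
  deriv : ∀ t ∈ I, HasDerivWithinAt (fun s => G.R (W s)) (G.A (W t) + G.R (F (W t))) I t

variable {G}

theorem IsStrong.mono {F : Y → Y} {W : ℝ → Y} {I J : Set ℝ} (h : G.IsStrong F W I) (hJ : J ⊆ I) :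
    G.IsStrong F W J :=
  ⟨h.cont.mono hJ, fun t ht => (h.deriv t (hJ ht)).mono hJ⟩

theorem IsStrong.congr {F F' : Y → Y} {W W' : ℝ → Y} {I : Set ℝ} (h : G.IsStrong F W I)
    (hW : EqOn W' W I) (hF : ∀ t ∈ I, F' (W t) = F (W t)) : G.IsStrong F' W' I := by
  refine ⟨h.cont.congr hW, fun t ht => ?_⟩
  have := (h.deriv t ht).congr (f₁ := fun s => G.R (W' s)) (fun s hs => by rw [hW hs])
    (by rw [hW ht])
  rwa [hW ht, hF t ht]

variable (G)

theorem S_S_neg (t : ℝ) (y : Y) : G.S t (G.S (-t) y) = y := by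
  rw [← G.S_add, add_neg_cancel, G.S_zero]

/-- Isometries are equicontinuous, so strong continuity becomes joint continuity. -/
theorem tendsto_S {ι : Type*} {l : Filter ι} {σ : ι → ℝ} {a : ι → Y} {s : ℝ} {y : Y}
    (hσ : Tendsto σ l (𝓝 s)) (ha : Tendsto a l (𝓝 y)) :
    Tendsto (fun i => G.S (σ i) (a i)) l (𝓝 (G.S s y)) := by
  have h1 : Tendsto (fun i => G.S (σ i) y) l (𝓝 (G.S s y)) :=
    ((G.continuous_S y).tendsto s).comp hσ
  have h2 : Tendsto (fun i => G.S (σ i) (a i - y)) l (𝓝 0) := by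
    rw [tendsto_zero_iff_norm_tendsto_zero]
    simp only [G.norm_S]
    exact tendsto_iff_norm_sub_tendsto_zero.1 ha
  simpa using h1.add h2

theorem continuousOn_S {σ : ℝ → ℝ} {a : ℝ → Y} {I : Set ℝ} (hσ : Continuous σ)
    (ha : ContinuousOn a I) : ContinuousOn (fun t => G.S (σ t) (a t)) I := fun t ht =>
  G.tendsto_S ((hσ.tendsto t).mono_left nhdsWithin_le_nhds) (ha t ht)

/-- A product rule for a group that is only strongly continuous: the increment splits into the moved
increment of y and the increment of the orbit of the fixed vector y t, whose derivative D is a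
hypothesis. -/
theorem hasDerivWithinAt_S {y : ℝ → Y} {y' D : Y} {σ : ℝ → ℝ} {t : ℝ} {I : Set ℝ}
    (hσ : Continuous σ) (hy : HasDerivWithinAt y y' I t)
    (hD : HasDerivWithinAt (fun s => G.S (σ s) (y t)) D I t) :
    HasDerivWithinAt (fun s => G.S (σ s) (y s)) (G.S (σ t) y' + D) I t := by
  rw [hasDerivWithinAt_iff_tendsto_slope] at hy hD ⊢
  have h1 := (G.tendsto_S ((hσ.tendsto t).mono_left nhdsWithin_le_nhds) hy).add hD
  refine h1.congr fun s => ?_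
  simp only [slope_def_module, map_smul, map_sub]
  rw [← smul_add, sub_add_sub_cancel]

/-- Variation of constants: with W = S(t)w the generator disappears from the equation for w. The
solutions given by Picard-Lindelöf enter through this direction. -/
theorem isStrong_of_hasDerivWithinAt {F : Y → Y} {w : ℝ → Y} {I : Set ℝ}
    (hw : ∀ t ∈ I, HasDerivWithinAt w (G.S (-t) (F (G.S t (w t)))) I t) :
    G.IsStrong F (fun t => G.S t (w t)) I := by
  have hc : ContinuousOn w I := fun t ht => (hw t ht).continuousWithinAt
  refine ⟨G.continuousOn_S continuous_id hc, fun t ht => ?_⟩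
  have h2 : HasDerivWithinAt (fun s => G.R (w s)) (G.R (G.S (-t) (F (G.S t (w t))))) I t :=
    G.R.hasFDerivAt.comp_hasDerivWithinAt t (hw t ht)
  have h3 : HasDerivWithinAt (fun s => G.S s (G.R (w t))) (G.A (G.S t (w t))) I t := by
    have := (G.hasDerivAt (w t) t).hasDerivWithinAt (s := I)
    simpa only [G.R_comm] using this
  have h4 := G.hasDerivWithinAt_S continuous_id h2 h3
  simp only [id, ← G.R_comm, G.S_S_neg] at h4
  rwa [add_comm]

/-- The converse, with the damping removed. In the derivative of R S(-t)W the generator terms cancel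
and R g remains, where g = S(-t)F(W) is continuous. A primitive v of g has the same image under R,
and R is injective, so S(-t)W equals v. -/
theorem IsStrong.hasDerivWithinAt {F : Y → Y} [CompleteSpace Y] {W : ℝ → Y} {T : ℝ}
    (h : G.IsStrong F W (Icc 0 T)) (hF : Continuous F) {t : ℝ} (ht : t ∈ Icc 0 T) :
    HasDerivWithinAt (fun s => G.S (-s) (W s)) (G.S (-t) (F (W t))) (Icc 0 T) t := by
  set I := Icc 0 T with hI
  have hT : 0 ≤ T := ht.1.trans ht.2
  set g : ℝ → Y := fun t => G.S (-t) (F (W t)) with hg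
  have hgc : ContinuousOn g I := G.continuousOn_S continuous_neg (hF.comp_continuousOn h.cont)
  have hRw : ∀ t ∈ I, HasDerivWithinAt (fun s => G.R (G.S (-s) (W s))) (G.R (g t)) I t :=
    fun t ht => by
    have h3 : HasDerivWithinAt (fun s => G.S (-s) (G.R (W t))) (-(G.A (G.S (-t) (W t)))) I t := by
      have := ((G.hasDerivAt (W t) (-t)).scomp t (hasDerivAt_neg t)).hasDerivWithinAt (s := I)
      simpa only [G.R_comm, Function.comp_def, neg_smul, one_smul] using this
    have h4 := G.hasDerivWithinAt_S continuous_neg (h.deriv t ht) h3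
    simp only [← G.R_comm, map_add, ← G.A_comm] at h4
    convert h4 using 1
    rw [hg, add_assoc, add_comm, add_assoc]
    simp
  -- A continuous extension of g to the line, so that its primitive is differentiable at the
  -- endpoints too.
  set g' : ℝ → Y := IccExtend hT (I.domRestrict g) with hg'
  have hg'c : Continuous g' := (continuousOn_iff_continuous_domRestrict.1 hgc).Icc_extend'
  have hg'g : EqOn g' g I := fun s hs => IccExtend_of_mem hT _ hs
  set v : ℝ → Y := fun t => W 0 + ∫ s in (0 : ℝ)..t, g' s with hv
  have hvd : ∀ t ∈ I, HasDerivWithinAt v (g t) I t := fun t ht => by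
    rw [← hg'g ht]
    exact ((intervalIntegral.integral_hasDerivAt_right (hg'c.intervalIntegrable _ _)
      (hg'c.stronglyMeasurableAtFilter _ _) hg'c.continuousAt).const_add _).hasDerivWithinAt
  have hz : ∀ t ∈ I, G.R (v t) - G.R (G.S (-t) (W t))
      = G.R (v 0) - G.R (G.S (-0) (W 0)) := by
    refine constant_of_has_deriv_right_zero (f := fun t => G.R (v t) - G.R (G.S (-t) (W t)))
      ?_ ?_
    · exact fun t ht => ((G.R.hasFDerivAt.comp_hasDerivWithinAt t (hvd t ht)).sub
        (hRw t ht)).continuousWithinAt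
    · intro t ht
      have ht' : t ∈ I := Ico_subset_Icc_self ht
      have h5 := (G.R.hasFDerivAt.comp_hasDerivWithinAt t (hvd t ht')).sub (hRw t ht')
      rw [sub_self] at h5
      refine h5.mono_of_mem_nhdsWithin ?_
      exact mem_of_superset (Icc_mem_nhdsGE ht.2) (Icc_subset_Icc_left ht.1)
  have hwv : EqOn (fun s => G.S (-s) (W s)) v I := fun s hs => by
    have h6 := hz s hs
    have h7 : v 0 = G.S (-0) (W 0) := by simp [hv, G.S_zero]
    rw [h7, sub_self, sub_eq_zero] at h6
    exact (G.R_injective h6).symm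
  exact (hvd t ht).congr hwv (hwv ht)

theorem lipschitzOnWith_conj {F : Y → Y} {r : ℝ} {K : NNReal}
    (hF : LipschitzOnWith K F (Metric.closedBall 0 r)) (t : ℝ) :
    LipschitzOnWith K (fun w => G.S (-t) (F (G.S t w))) (Metric.closedBall 0 r) := by
  refine LipschitzOnWith.of_dist_le_mul fun x hx y hy => ?_
  rw [dist_eq_norm, ← map_sub, G.norm_S, ← dist_eq_norm]
  have hb : ∀ z ∈ Metric.closedBall (0 : Y) r, G.S t z ∈ Metric.closedBall (0 : Y) r :=
    fun z hz => by
    rw [mem_closedBall_zero_iff, G.norm_S]; exact mem_closedBall_zero_iff.1 hz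
  refine (hF.dist_le_mul _ (hb x hx) _ (hb y hy)).trans (le_of_eq ?_)
  rw [dist_eq_norm, ← map_sub, G.norm_S, ← dist_eq_norm]

variable {G}

/-- On a compact interval both curves stay in one ball, where F is Lipschitz; uniqueness for
ordinary differential equations applies to S(-t)W and S(-t)V. -/
theorem IsStrong.eqOn [CompleteSpace Y] {F : Y → Y} (hFc : Continuous F)
    (hF : ∀ r, ∃ K : NNReal, LipschitzOnWith K F (Metric.closedBall 0 r)) {W V : ℝ → Y} {T : ℝ}
    (hW : G.IsStrong F W (Icc 0 T)) (hV : G.IsStrong F V (Icc 0 T)) (h0 : W 0 = V 0) :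
    EqOn W V (Icc 0 T) := by
  obtain ⟨C, hC⟩ := isCompact_Icc.exists_bound_of_continuousOn hW.cont
  obtain ⟨D, hD⟩ := isCompact_Icc.exists_bound_of_continuousOn hV.cont
  obtain ⟨K, hK⟩ := hF (max C D)
  have key : ∀ {U : ℝ → Y}, G.IsStrong F U (Icc 0 T) →
      ContinuousOn (fun s => G.S (-s) (U s)) (Icc 0 T) ∧ ∀ t ∈ Ico 0 T,
      HasDerivWithinAt (fun s => G.S (-s) (U s)) (G.S (-t) (F (G.S t (G.S (-t) (U t))))) (Ici t) t
      := fun {U} hU => by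
    refine ⟨G.continuousOn_S continuous_neg hU.cont, fun t ht => ?_⟩
    rw [G.S_S_neg]
    refine (hU.hasDerivWithinAt G hFc (Ico_subset_Icc_self ht)).mono_of_mem_nhdsWithin ?_
    exact mem_of_superset (Icc_mem_nhdsGE ht.2) (Icc_subset_Icc_left ht.1)
  have := ODE_solution_unique_of_mem_Icc_right (v := fun t w => G.S (-t) (F (G.S t w)))
    (s := fun _ => Metric.closedBall 0 (max C D)) (K := K)
    (fun t _ => G.lipschitzOnWith_conj hK t) (key hW).1 (key hW).2
    (fun t ht => by
      rw [mem_closedBall_zero_iff, G.norm_S]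
      exact (hC t (Ico_subset_Icc_self ht)).trans (le_max_left _ _)) (key hV).1 (key hV).2
    (fun t ht => by
      rw [mem_closedBall_zero_iff, G.norm_S]
      exact (hD t (Ico_subset_Icc_self ht)).trans (le_max_right _ _))
    (by simp only [h0])
  intro t ht
  have h1 := congrArg (G.S t) (this ht)
  simpa only [G.S_S_neg] using h1

end DampedGroup

/-! ### Truncation by the radial projection -/

section RadialProjection

variable {Y : Type*} [NormedAddCommGroup Y] [NormedSpace ℝ Y]

/-- The radial projection onto the closed ball of radius `r`. -/
def radialProj (r : ℝ) (y : Y) : Y := (r / max r ‖y‖) • y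

theorem radialProj_of_norm_le {r : ℝ} (hr : 0 < r) {y : Y} (hy : ‖y‖ ≤ r) :
    radialProj r y = y := by
  rw [radialProj, max_eq_left hy, div_self hr.ne', one_smul]

theorem norm_radialProj_le {r : ℝ} (hr : 0 < r) (y : Y) : ‖radialProj r y‖ ≤ r := by
  have hm : 0 < max r ‖y‖ := lt_max_of_lt_left hr
  rw [radialProj, norm_smul, Real.norm_of_nonneg (by positivity), div_mul_eq_mul_div,
    div_le_iff₀ hm]
  exact mul_le_mul_of_nonneg_left (le_max_right _ _) hr.le

/-- One unit of the constant 2 accounts for moving the vector with its scaling factor frozen, the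
other for the change of the factor. -/
theorem lipschitzWith_radialProj {r : ℝ} (hr : 0 < r) :
    LipschitzWith 2 (radialProj r : Y → Y) := by
  refine LipschitzWith.of_dist_le_mul fun x y => ?_
  have hx : 0 < max r ‖x‖ := lt_max_of_lt_left hr
  have hy : 0 < max r ‖y‖ := lt_max_of_lt_left hr
  rw [dist_eq_norm, dist_eq_norm]
  have e : radialProj r x - radialProj r y
      = (r / max r ‖x‖) • (x - y) + (r / max r ‖x‖ - r / max r ‖y‖) • y := by
    simp only [radialProj]; module
  have h1 : ‖(r / max r ‖x‖) • (x - y)‖ ≤ ‖x - y‖ := by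
    rw [norm_smul, Real.norm_of_nonneg (by positivity)]
    exact mul_le_of_le_one_left (norm_nonneg _) ((div_le_one hx).2 (le_max_left _ _))
  have h2 : ‖(r / max r ‖x‖ - r / max r ‖y‖) • y‖ ≤ ‖x - y‖ := by
    have e2 : r / max r ‖x‖ - r / max r ‖y‖
        = (r / max r ‖x‖) * ((max r ‖y‖ - max r ‖x‖) / max r ‖y‖) := by
      field_simp
    have h3 : |max r ‖y‖ - max r ‖x‖| ≤ ‖x - y‖ := by
      have h := abs_max_sub_max_le_max r ‖y‖ r ‖x‖
      rw [sub_self, abs_zero, max_eq_right (abs_nonneg (‖y‖ - ‖x‖))] at h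
      exact h.trans (norm_sub_rev x y ▸ abs_norm_sub_norm_le y x)
    rw [e2, norm_smul, norm_mul, norm_div, norm_div, Real.norm_of_nonneg hr.le,
      Real.norm_of_nonneg hx.le, Real.norm_of_nonneg hy.le, Real.norm_eq_abs]
    have h4 : r / max r ‖x‖ ≤ 1 := (div_le_one hx).2 (le_max_left _ _)
    have h5 : ‖y‖ / max r ‖y‖ ≤ 1 := (div_le_one hy).2 (le_max_right _ _)
    calc r / max r ‖x‖ * (|max r ‖y‖ - max r ‖x‖| / max r ‖y‖) * ‖y‖
        = (r / max r ‖x‖) * (‖y‖ / max r ‖y‖) * |max r ‖y‖ - max r ‖x‖| := by ring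
      _ ≤ 1 * 1 * ‖x - y‖ := by gcongr
      _ = ‖x - y‖ := by ring
  rw [e]
  refine (norm_add_le _ _).trans ?_
  push_cast
  linarith

end RadialProjection

/-! ### Global existence from an a priori bound -/

namespace DampedGroup

variable {Y : Type*} [NormedAddCommGroup Y] [NormedSpace ℝ Y] {G : DampedGroup Y}

/-- The truncated nonlinearity is bounded and globally Lipschitz, so a single application of
Picard-Lindelöf covers [0, T]. -/
theorem exists_isStrong_radialProj [CompleteSpace Y] {F : Y → Y}
    (hF : ∀ r, ∃ K : NNReal, LipschitzOnWith K F (Metric.closedBall 0 r)) {r : ℝ} (hr : 0 < r)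
    (y₀ : Y) {T : ℝ} (hT : 0 ≤ T) :
    ∃ W : ℝ → Y, W 0 = y₀ ∧ G.IsStrong (fun y => F (radialProj r y)) W (Icc 0 T) := by
  obtain ⟨K, hK⟩ := hF r
  have hmem : ∀ y : Y, radialProj r y ∈ Metric.closedBall (0 : Y) r := fun y =>
    mem_closedBall_zero_iff.2 (norm_radialProj_le hr y)
  have hL : LipschitzWith (K * 2) fun y : Y => F (radialProj r y) := by
    rw [← lipschitzOnWith_univ] at *
    exact hK.comp (lipschitzOnWith_univ.2 (lipschitzWith_radialProj hr)) fun y _ => hmem y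
  set B : NNReal := ‖F 0‖₊ + K * r.toNNReal with hB
  have hbd : ∀ y : Y, ‖F (radialProj r y)‖ ≤ B := fun y => by
    have h0 : (0 : Y) ∈ Metric.closedBall (0 : Y) r := by simp [hr.le]
    have h1 := hK.dist_le_mul _ (hmem y) _ h0
    rw [dist_eq_norm, dist_zero_right] at h1
    have h2 : ‖F (radialProj r y)‖ ≤ ‖F 0‖ + ‖F (radialProj r y) - F 0‖ := by
      have := norm_add_le (F 0) (F (radialProj r y) - F 0)
      rwa [add_sub_cancel] at this
    refine h2.trans ?_
    rw [hB]
    push_cast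
    rw [Real.coe_toNNReal _ hr.le]
    have := mul_le_mul_of_nonneg_left (norm_radialProj_le hr y) K.coe_nonneg
    linarith
  -- The radius B T is the farthest that speed at most B can carry the solution.
  have hPL : IsPicardLindelof (fun t w => G.S (-t) (F (radialProj r (G.S t w))))
      (tmin := 0) (tmax := T) ⟨0, left_mem_Icc.2 hT⟩ y₀ (B * T.toNNReal) 0 B (K * 2) := by
    refine ⟨fun t _ => ?_, fun w _ => ?_, fun t _ w _ => ?_, ?_⟩
    · refine LipschitzWith.lipschitzOnWith (LipschitzWith.of_dist_le_mul fun x y => ?_)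
      rw [dist_eq_norm, ← map_sub, G.norm_S, ← dist_eq_norm]
      refine (hL.dist_le_mul _ _).trans (le_of_eq ?_)
      rw [dist_eq_norm, ← map_sub, G.norm_S, ← dist_eq_norm]
    · exact G.continuousOn_S continuous_neg
        (hL.continuous.comp (G.continuous_S w)).continuousOn
    · rw [G.norm_S]; exact hbd _
    · simp [hT]
  obtain ⟨w, hw0, hw⟩ := hPL.exists_eq_forall_mem_Icc_hasDerivWithinAt₀
  refine ⟨fun t => G.S t (w t), ?_, G.isStrong_of_hasDerivWithinAt hw⟩
  simp only [G.S_zero]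
  exact hw0

/-- An a priori bound that holds as long as the solution stays in a larger ball yields solutions
on every bounded time interval. -/
theorem exists_isStrong_of_apriori [CompleteSpace Y] {F : Y → Y}
    (hF : ∀ r, ∃ K : NNReal, LipschitzOnWith K F (Metric.closedBall 0 r)) {r₀ r : ℝ}
    (hr₀ : 0 ≤ r₀) (hr : r₀ < r) {y₀ : Y} (hy₀ : ‖y₀‖ ≤ r₀)
    (hap : ∀ (T : ℝ) (W : ℝ → Y), 0 ≤ T → W 0 = y₀ → G.IsStrong F W (Icc 0 T) →
      (∀ t ∈ Icc 0 T, ‖W t‖ ≤ r) → ∀ t ∈ Icc 0 T, ‖W t‖ ≤ r₀) {T : ℝ} (hT : 0 ≤ T) :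
    ∃ W : ℝ → Y, W 0 = y₀ ∧ G.IsStrong F W (Icc 0 T) ∧ ∀ t ∈ Icc 0 T, ‖W t‖ ≤ r₀ := by
  have hrp : 0 < r := hr₀.trans_lt hr
  obtain ⟨W, hW0, hW⟩ := exists_isStrong_radialProj (G := G) hF hrp y₀ hT
  have hstrong : ∀ t ∈ Icc 0 T, (∀ s ∈ Icc 0 t, ‖W s‖ ≤ r) → G.IsStrong F W (Icc 0 t) :=
    fun t ht h => (hW.mono (Icc_subset_Icc_right ht.2)).congr (fun _ _ => rfl)
      fun s hs => by rw [radialProj_of_norm_le hrp (h s hs)]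
  have hnc : ContinuousOn (fun t => ‖W t‖) (Icc 0 T) := hW.cont.norm
  -- Otherwise there is a first time τ at which the norm reaches r. Up to τ the truncation is
  -- inactive, so the a priori bound gives norm at most r₀ < r at τ, a contradiction.
  have hlt : ∀ t ∈ Icc 0 T, ‖W t‖ < r := by
    by_contra! hcon
    obtain ⟨t₁, ht₁, hrt₁⟩ := hcon
    have hclosed : IsClosed (Icc 0 T ∩ (fun t => ‖W t‖) ⁻¹' Ici r) :=
      hnc.preimage_isClosed_of_isClosed isClosed_Icc isClosed_Ici
    obtain ⟨τ, hτ, hτm⟩ := (isCompact_Icc.of_isClosed_subset hclosed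
      inter_subset_left).exists_isLeast
      ⟨t₁, ht₁, hrt₁⟩
    have hbelow : ∀ s ∈ Icc 0 τ, ‖W s‖ ≤ r := fun s hs => by
      by_contra! hs'
      obtain ⟨s', hs'm, hs'r⟩ := intermediate_value_Icc hs.1
        (hnc.mono (Icc_subset_Icc_right (hs.2.trans hτ.1.2)))
        (show r ∈ Icc ‖W 0‖ ‖W s‖ from ⟨by rw [hW0]; exact hy₀.trans hr.le, hs'.le⟩)
      have h1 := hτm ⟨⟨hs'm.1, hs'm.2.trans (hs.2.trans hτ.1.2)⟩, hs'r.ge⟩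
      have h2 : s' = s := le_antisymm hs'm.2 (hs.2.trans h1)
      rw [← h2] at hs'
      exact hs'.ne hs'r.symm
    have h3 := hap τ W hτ.1.1 hW0 (hstrong τ hτ.1 hbelow) hbelow τ (right_mem_Icc.2 hτ.1.1)
    exact absurd hτ.2 (not_le.2 (h3.trans_lt hr))
  have hs := hstrong T (right_mem_Icc.2 hT) fun s hs => (hlt s hs).le
  exact ⟨W, hW0, hs, hap T W hT hW0 hs fun s hs => (hlt s hs).le⟩

/-- Gluing the solutions on bounded intervals. -/
theorem exists_global_isStrong [CompleteSpace Y] {F : Y → Y} (hFc : Continuous F)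
    (hF : ∀ r, ∃ K : NNReal, LipschitzOnWith K F (Metric.closedBall 0 r)) {r₀ : ℝ} {y₀ : Y}
    (hex : ∀ T : ℝ, 0 ≤ T →
      ∃ W : ℝ → Y, W 0 = y₀ ∧ G.IsStrong F W (Icc 0 T) ∧ ∀ t ∈ Icc 0 T, ‖W t‖ ≤ r₀) :
    ∃ W : ℝ → Y, W 0 = y₀ ∧ (∀ T, G.IsStrong F W (Icc 0 T)) ∧ ∀ t, 0 ≤ t → ‖W t‖ ≤ r₀ := by
  choose W hW0 hW hWb using fun n : ℕ => hex n n.cast_nonneg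
  have hmem : ∀ t : ℝ, 0 ≤ t → t ∈ Icc (0 : ℝ) (⌈t⌉₊ : ℕ) := fun t ht => ⟨ht, Nat.le_ceil t⟩
  -- The value at time t is taken from the solution on [0, ⌈t⌉₊]; uniqueness identifies it with
  -- every longer one.
  have heq : ∀ n : ℕ, EqOn (fun t => W ⌈t⌉₊ t) (W n) (Icc 0 n) := fun n t ht => by
    have h1 : (t : ℝ) ≤ (⌈t⌉₊ : ℕ) := Nat.le_ceil t
    have h2 : ((⌈t⌉₊ : ℕ) : ℝ) ≤ n := by exact_mod_cast Nat.ceil_le.2 ht.2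
    exact IsStrong.eqOn hFc hF (hW _) ((hW n).mono (Icc_subset_Icc_right h2))
      ((hW0 _).trans (hW0 n).symm) ⟨ht.1, h1⟩
  refine ⟨fun t => W ⌈t⌉₊ t, hW0 _, fun T => ?_, fun t ht => hWb _ t (hmem t ht)⟩
  exact ((hW ⌈T⌉₊).congr (heq _) fun _ _ => rfl).mono (Icc_subset_Icc_right (Nat.le_ceil T))

end DampedGroup

/-! ### Matrices of Fourier multipliers -/

/-- Triples of real `L²` functions. -/
abbrev State : Type := PiLp 2 (fun _ : Fin 3 => L2)

theorem hasDerivWithinAt_state {y : ℝ → State} {y' : State} {I : Set ℝ} {t : ℝ}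
    (h : ∀ i, HasDerivWithinAt (fun s => y s i) (y' i) I t) : HasDerivWithinAt y y' I t :=
  (PiLp.continuousLinearEquiv 2 ℝ (fun _ : Fin 3 => L2)).symm.hasFDerivAt.comp_hasDerivWithinAt t
    (hasDerivWithinAt_pi.2 h)

theorem hasDerivWithinAt_state_apply {y : ℝ → State} {y' : State} {I : Set ℝ} {t : ℝ}
    (h : HasDerivWithinAt y y' I t) (i : Fin 3) : HasDerivWithinAt (fun s => y s i) (y' i) I t :=
  (PiLp.proj (𝕜 := ℝ) 2 (fun _ : Fin 3 => L2) i).hasFDerivAt.comp_hasDerivWithinAt t h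

theorem continuous_state_apply (i : Fin 3) : Continuous fun y : State => y i :=
  (PiLp.proj (𝕜 := ℝ) 2 (fun _ : Fin 3 => L2) i).continuous

theorem continuousOn_state {y : ℝ → State} {I : Set ℝ}
    (h : ∀ i, ContinuousOn (fun s => y s i) I) : ContinuousOn y I :=
  (PiLp.continuousLinearEquiv 2 ℝ (fun _ : Fin 3 => L2)).symm.continuous.comp_continuousOn
    (continuousOn_pi.2 h)

theorem norm_state_sq (y : State) : ‖y‖ ^ 2 = ‖y 0‖ ^ 2 + ‖y 1‖ ^ 2 + ‖y 2‖ ^ 2 := by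
  rw [PiLp.norm_sq_eq_of_L2, Fin.sum_univ_three]

theorem inner_state (x y : State) :
    inner ℝ x y = inner ℝ (x 0) (y 0) + inner ℝ (x 1) (y 1) + inner ℝ (x 2) (y 2) := by
  rw [PiLp.inner_apply, Fin.sum_univ_three]

/-- The operator given by a matrix of symbols. -/
def opMat (M : Matrix (Fin 3) (Fin 3) Symb) : State →L[ℝ] State :=
  (PiLp.continuousLinearEquiv 2 ℝ (fun _ : Fin 3 => L2)).symm.toContinuousLinearMap.comp
    (ContinuousLinearMap.pi fun i =>
      ∑ j, (mult (M i j)).comp (PiLp.proj 2 (fun _ : Fin 3 => L2) j))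

theorem opMat_apply (M : Matrix (Fin 3) (Fin 3) Symb) (y : State) (i : Fin 3) :
    opMat M y i = mult (M i 0) (y 0) + mult (M i 1) (y 1) + mult (M i 2) (y 2) := by
  have : opMat M y i = (∑ j, (mult (M i j)).comp (PiLp.proj 2 (fun _ : Fin 3 => L2) j)) y := rfl
  rw [this, Fin.sum_univ_three]
  rfl

theorem opMat_one (y : State) : opMat 1 y = y := by
  ext1 i
  have h : ∀ j, mult ((1 : Matrix (Fin 3) (Fin 3) Symb) i j) (y j) = if i = j then y i else 0 :=
    fun j => by
    rw [Matrix.one_apply]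
    split_ifs with hij
    · rw [map_one, hij]; rfl
    · rw [map_zero]; rfl
  rw [opMat_apply, h, h, h]
  fin_cases i <;> simp

theorem opMat_add (M N : Matrix (Fin 3) (Fin 3) Symb) (y : State) :
    opMat (M + N) y = opMat M y + opMat N y := by
  ext1 i
  rw [PiLp.add_apply, opMat_apply, opMat_apply, opMat_apply]
  simp only [Matrix.add_apply, map_add, add_apply]
  abel

theorem opMat_neg (M : Matrix (Fin 3) (Fin 3) Symb) (y : State) :
    opMat (-M) y = -opMat M y := by
  ext1 i
  rw [PiLp.neg_apply, opMat_apply, opMat_apply]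
  simp only [Matrix.neg_apply, map_neg, neg_apply]
  abel

theorem opMat_mul (M N : Matrix (Fin 3) (Fin 3) Symb) (y : State) :
    opMat (M * N) y = opMat M (opMat N y) := by
  ext1 i
  rw [opMat_apply, opMat_apply, opMat_apply, opMat_apply, opMat_apply]
  simp only [Matrix.mul_apply, Fin.sum_univ_three, map_add, add_apply, mult_mul_apply]
  abel

theorem opMat_smul_one (m : Symb) (y : State) (i : Fin 3) :
    opMat (m • 1) y i = mult m (y i) := by
  rw [opMat_apply]
  fin_cases i <;> simp

theorem opMat_neg_smul_one (m : Symb) (y : State) : opMat ((-m) • 1) y = -opMat (m • 1) y := by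
  ext1 i
  rw [PiLp.neg_apply, opMat_smul_one, opMat_smul_one, map_neg, neg_apply]

/-- The matrix `diag(f(|D|), g(|D|), g(|D|))`. -/
def dia (f g : ℝ → ℝ) (hf : RadGood f) (hg : RadGood g) : Matrix (Fin 3) (Fin 3) Symb :=
  !![rad f hf, 0, 0; 0, rad g hg, 0; 0, 0, rad g hg]

/-- The matrix `(ζ, v) ↦ (f(|D|) ∇·v, g(|D|) ∇ζ)`. -/
def offd (f g : ℝ → ℝ) (hf : VecGood f) (hg : VecGood g) : Matrix (Fin 3) (Fin 3) Symb :=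
  !![0, vec 0 f hf, vec 1 f hf; vec 0 g hg, 0, 0; vec 1 g hg, 0, 0]

theorem rad_mul_rad {f g h : ℝ → ℝ} (hf : RadGood f) (hg : RadGood g) (hh : RadGood h)
    (e : ∀ r, 0 ≤ r → f r * g r = h r) : rad f hf * rad g hg = rad h hh := symb_ext fun ξ => by
  rw [symb_mul_apply, rad_apply, rad_apply, rad_apply, ← e _ (two_pi_norm_nonneg ξ)]
  push_cast; rfl

/-- Positive r suffices because `dSym` vanishes at the origin; this admits profiles such as -1/r. -/
theorem rad_mul_vec {k : Fin 2} {f g h : ℝ → ℝ} (hf : RadGood f) (hg : VecGood g) (hh : VecGood h)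
    (e : ∀ r, 0 < r → f r * g r = h r) : rad f hf * vec k g hg = vec k h hh := symb_ext fun ξ => by
  rw [symb_mul_apply, rad_apply, vec_apply, vec_apply]
  rcases eq_or_ne ξ 0 with rfl | hξ
  · simp [dSym]
  · have := norm_pos_iff.2 hξ
    rw [← e _ (by positivity)]
    push_cast; ring

theorem dia_mul_dia {f g f' g' f'' g'' : ℝ → ℝ} (hf : RadGood f) (hg : RadGood g)
    (hf' : RadGood f') (hg' : RadGood g') (hf'' : RadGood f'') (hg'' : RadGood g'')
    (e₁ : ∀ r, 0 ≤ r → f r * f' r = f'' r) (e₂ : ∀ r, 0 ≤ r → g r * g' r = g'' r) :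
    dia f g hf hg * dia f' g' hf' hg' = dia f'' g'' hf'' hg'' := by
  have h1 := rad_mul_rad hf hf' hf'' e₁
  have h2 := rad_mul_rad hg hg' hg'' e₂
  ext1 i j
  fin_cases i <;> fin_cases j <;> simp [dia, Matrix.mul_apply, Fin.sum_univ_three, h1, h2]

theorem dia_mul_offd {f g f' g' f'' g'' : ℝ → ℝ} (hf : RadGood f) (hg : RadGood g)
    (hf' : VecGood f') (hg' : VecGood g') (hf'' : VecGood f'') (hg'' : VecGood g'')
    (e₁ : ∀ r, 0 < r → f r * f' r = f'' r) (e₂ : ∀ r, 0 < r → g r * g' r = g'' r) :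
    dia f g hf hg * offd f' g' hf' hg' = offd f'' g'' hf'' hg'' := by
  have h1 := fun k => rad_mul_vec (k := k) hf hf' hf'' e₁
  have h2 := fun k => rad_mul_vec (k := k) hg hg' hg'' e₂
  ext1 i j
  fin_cases i <;> fin_cases j <;> simp [dia, offd, Matrix.mul_apply, Fin.sum_univ_three, h1, h2]

theorem offd_mul_dia {f g f' g' f'' g'' : ℝ → ℝ} (hf : RadGood f) (hg : RadGood g)
    (hf' : VecGood f') (hg' : VecGood g') (hf'' : VecGood f'') (hg'' : VecGood g'')
    (e₁ : ∀ r, 0 < r → g r * f' r = f'' r) (e₂ : ∀ r, 0 < r → f r * g' r = g'' r) :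
    offd f' g' hf' hg' * dia f g hf hg = offd f'' g'' hf'' hg'' := by
  have h1 := fun k => rad_mul_vec (k := k) hg hf' hf'' e₁
  have h2 := fun k => rad_mul_vec (k := k) hf hg' hg'' e₂
  ext1 i j
  fin_cases i <;> fin_cases j <;>
    simp [dia, offd, Matrix.mul_apply, Fin.sum_univ_three, mul_comm _ (rad _ _), h1, h2]

theorem dia_eq_smul {f : ℝ → ℝ} (hf : RadGood f) : dia f f hf hf = rad f hf • 1 := by
  ext1 i j
  fin_cases i <;> fin_cases j <;> simp [dia]

/-- Integration by parts: divergence and gradient are adjoint up to sign, so the two profiles change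
places. Equal profiles give a skew operator. -/
theorem inner_offd {f g : ℝ → ℝ} (hf : VecGood f) (hg : VecGood g) (x y : State) :
    inner ℝ (opMat (offd f g hf hg) x) y = -inner ℝ x (opMat (offd g f hg hf) y) := by
  rw [inner_state, inner_state]
  simp only [opMat_apply]
  simp [offd, inner_add_left, inner_add_right, inner_mult_vec]
  ring

theorem inner_rad_smul {f : ℝ → ℝ} (hf : RadGood f) (x y : State) :
    inner ℝ (opMat (rad f hf • 1) x) y = inner ℝ x (opMat (rad f hf • 1) y) := by
  rw [inner_state, inner_state]
  simp only [opMat_smul_one, inner_mult_rad]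

theorem norm_dia_le {f g : ℝ → ℝ} (hf : RadGood f) (hg : RadGood g) {C : ℝ}
    (hC : 0 ≤ C) (hfC : ∀ r, 0 ≤ r → |f r| ≤ C) (hgC : ∀ r, 0 ≤ r → |g r| ≤ C) (y : State) :
    ‖opMat (dia f g hf hg) y‖ ≤ C * ‖y‖ := by
  have h1 : ∀ {h : ℝ → ℝ} (hh : RadGood h) (hhC : ∀ r, 0 ≤ r → |h r| ≤ C) (u : L2),
      ‖mult (rad h hh) u‖ ^ 2 ≤ C ^ 2 * ‖u‖ ^ 2 := fun hh hhC u => by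
    rw [← mul_pow]
    refine pow_le_pow_left₀ (norm_nonneg _) (norm_mult_le _ (fun ξ => ?_) u) 2
    rw [rad_apply, Complex.norm_real]
    exact hhC _ (two_pi_norm_nonneg ξ)
  refine (sq_le_sq₀ (norm_nonneg _) (by positivity)).1 ?_
  rw [mul_pow, norm_state_sq, norm_state_sq]
  simp only [opMat_apply]
  simp only [dia, Matrix.of_apply, Matrix.cons_val', Matrix.cons_val_zero, Matrix.cons_val_one,
    Matrix.cons_val, map_zero, zero_apply, add_zero, zero_add]
  linarith [h1 hf hfC (y 0), h1 hg hgC (y 1), h1 hg hgC (y 2)]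

/-! ### The group generated by `ω(|D|) N` -/

theorem vecGood_neg_inv : VecGood fun r => -r⁻¹ :=
  ⟨by fun_prop, 1, fun r _ => by
    rcases eq_or_ne r 0 with rfl | h
    · simp
    · simp [h]⟩

/-- The skew symmetric matrix of Riesz transforms. -/
def rieszMat : Matrix (Fin 3) (Fin 3) Symb := offd _ _ vecGood_neg_inv vecGood_neg_inv

theorem riesz_sq_mul (k : Fin 2) :
    (vec 0 _ vecGood_neg_inv * vec 0 _ vecGood_neg_inv
      + vec 1 _ vecGood_neg_inv * vec 1 _ vecGood_neg_inv) * vec k _ vecGood_neg_inv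
      = -vec k _ vecGood_neg_inv := symb_ext fun ξ => by
  simp only [symb_mul_apply, symb_add_apply, symb_neg_apply, vec_apply]
  rcases eq_or_ne ξ 0 with rfl | h
  · simp
  · have h1 := sum_dSym_sq ξ
    have h2 : ((2 * Real.pi * ‖ξ‖ : ℝ) : ℂ) ≠ 0 := by
      rw [Complex.ofReal_ne_zero]
      have := norm_pos_iff.2 h
      positivity
    set z : ℂ := ((2 * Real.pi * ‖ξ‖ : ℝ) : ℂ)
    rw [Complex.ofReal_neg, Complex.ofReal_inv]
    change (dSym 0 ξ * -z⁻¹ * (dSym 0 ξ * -z⁻¹) + dSym 1 ξ * -z⁻¹ * (dSym 1 ξ * -z⁻¹))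
      * (dSym k ξ * -z⁻¹) = -(dSym k ξ * -z⁻¹)
    have h3 : z ^ 2 * z⁻¹ ^ 2 = 1 := by field_simp
    linear_combination (-(z⁻¹) ^ 3 * dSym k ξ) * h1 + dSym k ξ * z⁻¹ * h3

/-- N annihilates divergence-free fields, so -N² is only the projection onto ζ and the gradient part
of v, and N² = -1 fails. -/
theorem rieszMat_cube : rieszMat * (rieszMat * rieszMat) = -rieszMat := by
  have h0 := riesz_sq_mul 0
  have h1 := riesz_sq_mul 1
  ext1 i j
  fin_cases i <;> fin_cases j <;>
    simp [rieszMat, offd, Matrix.mul_apply, Fin.sum_univ_three]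
  all_goals first | linear_combination h0 | linear_combination h1

/-- N³ = -N gives exp(θN) = 1 + sin θ N + (1 - cos θ)N². With a = sin and b = 1 - cos, the
coefficients on the right are the addition formulas. -/
theorem group_mul {S : Type*} [CommRing S] {N : Matrix (Fin 3) (Fin 3) S}
    (h : N * (N * N) = -N) (a b a' b' : S) :
    (1 + a • N + b • (N * N)) * (1 + a' • N + b' • (N * N))
      = 1 + (a * (1 - b') + a' * (1 - b)) • N + (b + b' - b * b' + a * a') • (N * N) := by
  have h2 : N * N * N = -N := by rw [mul_assoc, h]
  have h3 : N * N * (N * N) = -(N * N) := by rw [mul_assoc, h, mul_neg]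
  simp only [add_mul, mul_add, one_mul, mul_one, smul_mul_assoc, mul_smul_comm, h, h2, h3]
  module

theorem radGood_sin {ω : ℝ → ℝ} (hω : Measurable ω) (t : ℝ) : RadGood fun r => Real.sin (ω r * t) :=
  ⟨by fun_prop, 1, fun _ _ => Real.abs_sin_le_one _⟩

theorem radGood_cos {ω : ℝ → ℝ} (hω : Measurable ω) (t : ℝ) :
    RadGood fun r => 1 - Real.cos (ω r * t) :=
  ⟨by fun_prop, 2, fun r _ => by
    rw [abs_le]
    constructor <;> linarith [Real.neg_one_le_cos (ω r * t), Real.cos_le_one (ω r * t)]⟩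

/-- The matrix `exp(t ω(|D|) N)`. -/
def groupMat {ω : ℝ → ℝ} (hω : Measurable ω) (t : ℝ) : Matrix (Fin 3) (Fin 3) Symb :=
  1 + rad _ (radGood_sin hω t) • rieszMat + rad _ (radGood_cos hω t) • (rieszMat * rieszMat)

theorem groupMat_mul {ω : ℝ → ℝ} (hω : Measurable ω) (s t : ℝ) :
    groupMat hω s * groupMat hω t = groupMat hω (s + t) := by
  rw [groupMat, groupMat, group_mul rieszMat_cube, groupMat]
  congr 3
  · refine symb_ext fun ξ => ?_
    simp only [symb_add_apply, symb_mul_apply, symb_sub_apply, symb_one_apply, rad_apply]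
    rw [mul_add, Real.sin_add]
    push_cast; ring
  · refine symb_ext fun ξ => ?_
    simp only [symb_add_apply, symb_mul_apply, symb_sub_apply, rad_apply]
    rw [mul_add, Real.cos_add]
    push_cast; ring

theorem groupMat_zero {ω : ℝ → ℝ} (hω : Measurable ω) : groupMat hω 0 = 1 := by
  have h1 : rad _ (radGood_sin hω 0) = 0 := symb_ext fun ξ => by
    rw [rad_apply]; simp
  have h2 : rad _ (radGood_cos hω 0) = 0 := symb_ext fun ξ => by
    rw [rad_apply]; simp
  rw [groupMat, h1, h2, zero_smul, zero_smul, add_zero, add_zero]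

theorem opMat_groupMat {ω : ℝ → ℝ} (hω : Measurable ω) (t : ℝ) (y : State) :
    opMat (groupMat hω t) y = y + opMat (rad _ (radGood_sin hω t) • 1) (opMat rieszMat y)
      + opMat (rad _ (radGood_cos hω t) • 1) (opMat rieszMat (opMat rieszMat y)) := by
  rw [groupMat, opMat_add, opMat_add, opMat_one, ← opMat_mul, ← opMat_mul, ← opMat_mul,
    smul_one_mul, smul_one_mul, smul_mul_assoc]

theorem groupMat_comm {ω : ℝ → ℝ} (hω : Measurable ω) (t : ℝ) (m : Symb) :
    (m • rieszMat) * groupMat hω t = groupMat hω t * (m • rieszMat) := by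
  simp only [groupMat, mul_add, add_mul, mul_one, one_mul, smul_mul_assoc, mul_smul_comm,
    mul_assoc, smul_add]
  rw [smul_comm m (rad _ (radGood_sin hω t)), smul_comm m (rad _ (radGood_cos hω t))]

/-- N is skew, and the self-adjoint multipliers sin and 1 - cos commute with it. Together with the
group law this makes the group isometric. -/
theorem inner_groupMat {ω : ℝ → ℝ} (hω : Measurable ω) (t : ℝ) (x y : State) :
    inner ℝ (opMat (groupMat hω t) x) y = inner ℝ x (opMat (groupMat hω (-t)) y) := by
  have hN : ∀ x y : State, inner ℝ (opMat rieszMat x) y = -inner ℝ x (opMat rieszMat y) :=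
    inner_offd _ _
  have hc : ∀ (m : Symb) (x : State), opMat rieszMat (opMat (m • 1) x)
      = opMat (m • 1) (opMat rieszMat x) := fun m x => by
    rw [← opMat_mul, ← opMat_mul, smul_one_mul, mul_smul_one]
  have h1 : rad _ (radGood_sin hω (-t)) = -rad _ (radGood_sin hω t) := symb_ext fun ξ => by
    rw [symb_neg_apply, rad_apply, rad_apply]; simp
  have h2 : rad _ (radGood_cos hω (-t)) = rad _ (radGood_cos hω t) := symb_ext fun ξ => by
    rw [rad_apply, rad_apply]; simp
  rw [opMat_groupMat, opMat_groupMat, h1, h2, opMat_neg_smul_one]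
  simp only [inner_add_left, inner_add_right, inner_rad_smul, hN, hc, inner_neg_right]
  ring

theorem norm_groupMat {ω : ℝ → ℝ} (hω : Measurable ω) (t : ℝ) (y : State) :
    ‖opMat (groupMat hω t) y‖ = ‖y‖ := by
  have h : ‖opMat (groupMat hω t) y‖ ^ 2 = ‖y‖ ^ 2 := by
    rw [← real_inner_self_eq_norm_sq, inner_groupMat, ← opMat_mul, groupMat_mul, neg_add_cancel,
      groupMat_zero, opMat_one, real_inner_self_eq_norm_sq]
  exact (sq_eq_sq₀ (norm_nonneg _) (norm_nonneg _)).1 h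

theorem continuous_mult_rad {f : ℝ → ℝ → ℝ} (hf : ∀ t, RadGood (f t)) {C : ℝ}
    (hC : ∀ t r, 0 ≤ r → |f t r| ≤ C) (hc : ∀ r, Continuous fun t => f t r) (u : L2) :
    Continuous fun t => mult (rad (f t) (hf t)) u := by
  rw [continuous_iff_continuousAt]
  intro t
  refine tendsto_mult (C := C) (Eventually.of_forall fun s ξ => ?_) (fun ξ => ?_) u
  · rw [rad_apply, Complex.norm_real]
    exact hC _ _ (two_pi_norm_nonneg ξ)
  · exact (Complex.continuous_ofReal.tendsto _).comp ((hc _).tendsto t)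

/-- The mean value inequality bounds the difference quotients of the symbols by C uniformly in ξ, so
`tendsto_mult` applies. -/
theorem hasDerivAt_mult_rad {f f' : ℝ → ℝ → ℝ} (hf : ∀ t, RadGood (f t))
    (hf' : ∀ t, RadGood (f' t)) {C : ℝ} (hC : ∀ t r, 0 ≤ r → |f' t r| ≤ C)
    (hd : ∀ t r, HasDerivAt (fun t => f t r) (f' t r) t) (u : L2) (t : ℝ) :
    HasDerivAt (fun t => mult (rad (f t) (hf t)) u) (mult (rad (f' t) (hf' t)) u) t := by
  rw [hasDerivAt_iff_tendsto_slope]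
  have e : ∀ s, slope (fun t => mult (rad (f t) (hf t)) u) t s
      = mult ((s - t)⁻¹ • (rad (f s) (hf s) - rad (f t) (hf t))) u := fun s => by
    rw [slope_def_module, map_smul, map_sub, smul_apply, sub_apply]
  refine Tendsto.congr (fun s => (e s).symm) (tendsto_mult (C := C) ?_ (fun ξ => ?_) u)
  · filter_upwards [self_mem_nhdsWithin] with s hs ξ
    have h1 := convex_univ.norm_image_sub_le_of_norm_hasDerivWithin_le
      (fun x _ => (hd x (2 * Real.pi * ‖ξ‖)).hasDerivWithinAt)
      (fun x _ => hC x _ (two_pi_norm_nonneg ξ)) (mem_univ t) (mem_univ s)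
    have h2 : 0 < ‖s - t‖ := norm_pos_iff.2 (sub_ne_zero.2 hs)
    rw [symb_smul_apply, symb_sub_apply, rad_apply, rad_apply, ← Complex.ofReal_sub,
      ← Complex.ofReal_mul, Complex.norm_real, norm_mul, norm_inv, inv_mul_le_iff₀ h2,
      mul_comm ‖s - t‖]
    exact h1
  · have h1 := hasDerivAt_iff_tendsto_slope.1 (hd t (2 * Real.pi * ‖ξ‖))
    refine ((Complex.continuous_ofReal.tendsto _).comp h1).congr fun s => ?_
    rw [symb_smul_apply, symb_sub_apply, rad_apply, rad_apply, ← Complex.ofReal_sub,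
      ← Complex.ofReal_mul, Function.comp_apply, slope_def_module, smul_eq_mul]

theorem smooth_injective {μ : ℝ} (hμ : 0 < μ) : Function.Injective (smooth hμ) := by
  refine (injective_iff_map_eq_zero (smooth hμ)).2 fun f hf => ?_
  have h0 := normX_smooth hμ 0
  rw [map_zero, norm_zero] at h0
  rw [← norm_eq_zero, ← normX_smooth hμ f, hf, h0]

theorem radGood_mul {f g : ℝ → ℝ} (hf : RadGood f) (hg : RadGood g) :
    RadGood fun r => f r * g r := by
  obtain ⟨hf, C, hC⟩ := hf
  obtain ⟨hg, D, hD⟩ := hg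
  refine ⟨hf.mul hg, C * D, fun r hr => ?_⟩
  rw [abs_mul]
  exact mul_le_mul (hC r hr) (hD r hr) (abs_nonneg _) ((abs_nonneg _).trans (hC r hr))

/-! ### The damped group and its generator -/

section Group

variable {μ : ℝ} (hμ : 0 < μ) {ω : ℝ → ℝ} (hω : Measurable ω)
  (hρω : RadGood fun r => rho μ r * ω r)

theorem opMat_riesz_groupMat (y : State) (t : ℝ) :
    opMat rieszMat (opMat (groupMat hω t) y) = opMat rieszMat y
      + opMat (rad _ (radGood_sin hω t) • 1) (opMat rieszMat (opMat rieszMat y))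
      - opMat (rad _ (radGood_cos hω t) • 1) (opMat rieszMat y) := by
  have hc : ∀ (m : Symb) (x : State), opMat rieszMat (opMat (m • 1) x)
      = opMat (m • 1) (opMat rieszMat x) := fun m x => by
    rw [← opMat_mul, ← opMat_mul, smul_one_mul, mul_smul_one]
  have h3 : opMat rieszMat (opMat rieszMat (opMat rieszMat y)) = -opMat rieszMat y := by
    rw [← opMat_mul, ← opMat_mul, mul_assoc, rieszMat_cube, opMat_neg]
  rw [opMat_groupMat, map_add, map_add, hc, hc, h3, map_neg, ← sub_eq_add_neg]

/-- The symbol ω may be unbounded, but ρω is bounded; differentiability for every y in L² therefore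
holds after damping by ρ. -/
theorem hasDerivAt_rho_groupMat (y : State) (t : ℝ) :
    HasDerivAt (fun t => opMat (rad _ (radGood_rho hμ) • 1) (opMat (groupMat hω t) y))
      (opMat (rad _ hρω • rieszMat) (opMat (groupMat hω t) y)) t := by
  obtain ⟨C, hC⟩ := hρω.2
  have hrs := fun t => radGood_mul (radGood_rho hμ) (radGood_sin hω t)
  have hrc := fun t => radGood_mul (radGood_rho hμ) (radGood_cos hω t)
  have hcos : ∀ t, RadGood fun r => Real.cos (ω r * t) := fun t =>
    ⟨by fun_prop, 1, fun _ _ => Real.abs_cos_le_one _⟩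
  have hrs' := fun t => radGood_mul hρω (hcos t)
  have hrc' := fun t => radGood_mul hρω (radGood_sin hω t)
  have hb : ∀ {x r : ℝ}, 0 ≤ r → |x| ≤ 1 → |rho μ r * ω r * x| ≤ C := fun {x r} hr hx => by
    rw [abs_mul]
    exact (mul_le_of_le_one_right (abs_nonneg _) hx).trans (hC r hr)
  have h1 := fun (u : L2) (t : ℝ) => hasDerivAt_mult_rad hrs hrs' (C := C)
    (fun t r hr => hb hr (Real.abs_cos_le_one _)) (fun t r => by
      have := (((hasDerivAt_id t).const_mul (ω r)).sin).const_mul (rho μ r)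
      refine this.congr_deriv ?_
      simp only [id]; ring) u t
  have h2 := fun (u : L2) (t : ℝ) => hasDerivAt_mult_rad hrc hrc' (C := C)
    (fun t r hr => hb hr (Real.abs_sin_le_one _)) (fun t r => by
      have := ((((hasDerivAt_id t).const_mul (ω r)).cos).const_sub 1).const_mul (rho μ r)
      refine this.congr_deriv ?_
      simp only [id]; ring) u t
  rw [← hasDerivWithinAt_univ]
  refine hasDerivWithinAt_state fun i => ?_
  rw [hasDerivWithinAt_univ]
  have e1 : ∀ s, opMat (rad _ (radGood_rho hμ) • 1) (opMat (groupMat hω s) y) i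
      = mult (rad _ (radGood_rho hμ)) (y i) + mult (rad _ (hrs s)) (opMat rieszMat y i)
        + mult (rad _ (hrc s)) (opMat rieszMat (opMat rieszMat y) i) := fun s => by
    rw [opMat_smul_one, opMat_groupMat, PiLp.add_apply, PiLp.add_apply, map_add, map_add,
      opMat_smul_one, opMat_smul_one, ← mult_mul_apply, ← mult_mul_apply,
      rad_mul_rad _ _ (hrs s) fun _ _ => rfl, rad_mul_rad _ _ (hrc s) fun _ _ => rfl]
  -- By N³ = -N, the product N exp(ωtN) is cos(ωt)N + sin(ωt)N².
  have e2 : opMat (rad _ hρω • rieszMat) (opMat (groupMat hω t) y) i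
      = mult (rad _ (hrs' t)) (opMat rieszMat y i)
        + mult (rad _ (hrc' t)) (opMat rieszMat (opMat rieszMat y) i) := by
    have e3 : opMat (rad _ hρω • rieszMat) (opMat (groupMat hω t) y)
        = opMat (rad _ hρω • 1) (opMat rieszMat (opMat (groupMat hω t) y)) := by
      rw [← opMat_mul (rad _ hρω • 1), smul_one_mul]
    have e4 : rad _ hρω - rad _ hρω * rad _ (radGood_cos hω t) = rad _ (hrs' t) :=
      symb_ext fun ξ => by
        simp only [symb_sub_apply, symb_mul_apply, rad_apply]
        push_cast; ring
    rw [e3, opMat_smul_one, opMat_riesz_groupMat, PiLp.sub_apply, PiLp.add_apply, map_sub, map_add,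
      opMat_smul_one, opMat_smul_one, ← mult_mul_apply, ← mult_mul_apply,
      rad_mul_rad _ _ (hrc' t) fun _ _ => rfl, ← e4, map_sub, sub_apply]
    abel
  rw [e2]
  refine (((h1 _ t).const_add (mult (rad _ (radGood_rho hμ)) (y i))).add
    (h2 _ t)).congr_of_eventuallyEq ?_
  exact Eventually.of_forall fun s => e1 s

/-- The group `exp(t ω(|D|) N)`, damped by `(1 - μΔ)^(-1/2)`. -/
def dampedGroup : DampedGroup State where
  S t := opMat (groupMat hω t)
  R := opMat (rad _ (radGood_rho hμ) • 1)
  A := opMat (rad _ hρω • rieszMat)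
  S_zero y := by rw [groupMat_zero, opMat_one]
  S_add s t y := by rw [← groupMat_mul, opMat_mul]
  norm_S := norm_groupMat hω
  continuous_S y := by
    rw [← continuousOn_univ]
    refine continuousOn_state fun i => ?_
    rw [continuousOn_univ]
    simp only [opMat_groupMat, PiLp.add_apply, opMat_smul_one]
    refine (continuous_const.add ?_).add ?_
    · exact continuous_mult_rad (radGood_sin hω) (C := 1)
        (fun t r _ => Real.abs_sin_le_one _) (fun r => by fun_prop) _
    · exact continuous_mult_rad (radGood_cos hω) (C := 2)
        (fun t r _ => by
          rw [abs_le]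
          constructor <;> linarith [Real.neg_one_le_cos (ω r * t), Real.cos_le_one (ω r * t)])
        (fun r => by fun_prop) _
  R_injective x y h := by
    ext1 i
    refine smooth_injective hμ ?_
    have := congrArg (fun z : State => z i) h
    simp only [opMat_smul_one] at this
    exact this
  R_comm t y := by rw [← opMat_mul, ← opMat_mul, smul_one_mul, mul_smul_one]
  A_comm t y := by
    rw [← opMat_mul, ← opMat_mul, groupMat_comm]
  hasDerivAt := hasDerivAt_rho_groupMat hμ hω hρω

end Group

/-! ### The cubic energy -/

/-- Only J f, J g, J h are differentiable. The trilinear form is symmetric, so each increment can be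
moved into the slot under J, while the other arguments need only be continuous. -/
theorem hasDerivWithinAt_inner_bilin {H : Type*} [NormedAddCommGroup H] [InnerProductSpace ℝ H]
    {J : H →L[ℝ] H} {B : H →L[ℝ] H →L[ℝ] H} {f g h : ℝ → H} {u v w : H} {I : Set ℝ} {t : ℝ}
    (hB : ∀ x y, B x y = B y x)
    (hJ : ∀ x y z, inner ℝ (J x) (B y z) = inner ℝ (J y) (B x z)) (ht : t ∈ I)
    (hg : ContinuousOn g I) (hh : ContinuousOn h I)
    (hu : HasDerivWithinAt (fun s => J (f s)) u I t)
    (hv : HasDerivWithinAt (fun s => J (g s)) v I t)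
    (hw : HasDerivWithinAt (fun s => J (h s)) w I t) :
    HasDerivWithinAt (fun s => inner ℝ (J (f s)) (B (g s) (h s)))
      (inner ℝ u (B (g t) (h t)) + inner ℝ v (B (f t) (h t))
        + inner ℝ w (B (f t) (g t))) I t := by
  rw [hasDerivWithinAt_iff_tendsto_slope] at hu hv hw ⊢
  have hsub : 𝓝[I \ {t}] t ≤ 𝓝[I] t := nhdsWithin_mono _ sdiff_subset
  have hg' := (hg t ht).mono_left hsub
  have hh' := (hh t ht).mono_left hsub
  have hp : ∀ {a b : ℝ → H} {x y : H}, Tendsto a (𝓝[I \ {t}] t) (𝓝 x) →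
      Tendsto b (𝓝[I \ {t}] t) (𝓝 y) →
      Tendsto (fun s => B (a s) (b s)) (𝓝[I \ {t}] t) (𝓝 (B x y)) :=
    fun ha hb => (B.continuous₂.tendsto _).comp (ha.prodMk_nhds hb)
  -- The increment is telescoped one argument at a time: first f, then g with f frozen at t, then h
  -- with f and g frozen.
  have key := ((hu.inner (𝕜 := ℝ) (hp hg' hh')).add
    (hv.inner (𝕜 := ℝ) (hp (tendsto_const_nhds (x := f t)) hh'))).add
    (hw.inner (𝕜 := ℝ) (tendsto_const_nhds (x := B (f t) (g t))))
  refine key.congr fun s => ?_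
  have e1 := hJ (g s) (f t) (h s)
  have e2 := hJ (g t) (f t) (h s)
  have e3 := hJ (h s) (f t) (g t)
  have e4 := hJ (h t) (f t) (g t)
  rw [hB (h s)] at e3
  rw [hB (h t)] at e4
  simp only [slope_def_module, real_inner_smul_left, smul_eq_mul, inner_sub_left]
  linear_combination (s - t)⁻¹ * (e1 - e2 + e3 - e4)

section Cubic

variable {μ : ℝ} (hμ : 0 < μ)

/-- The symmetric bilinear map behind the gradient of the cubic energy. -/
def bilX (f g : State) : State :=
  WithLp.toLp 2 ![prodX hμ (f 1) (g 1) + prodX hμ (f 2) (g 2),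
    prodX hμ (f 0) (g 1) + prodX hμ (g 0) (f 1), prodX hμ (f 0) (g 2) + prodX hμ (g 0) (f 2)]

theorem bilX_zero (f g : State) :
    bilX hμ f g 0 = prodX hμ (f 1) (g 1) + prodX hμ (f 2) (g 2) := rfl

theorem bilX_one (f g : State) :
    bilX hμ f g 1 = prodX hμ (f 0) (g 1) + prodX hμ (g 0) (f 1) := rfl

theorem bilX_two (f g : State) :
    bilX hμ f g 2 = prodX hμ (f 0) (g 2) + prodX hμ (g 0) (f 2) := rfl

theorem state_ext {x y : State} (h0 : x 0 = y 0) (h1 : x 1 = y 1) (h2 : x 2 = y 2) : x = y := by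
  ext1 i
  fin_cases i <;> assumption

theorem norm_state_le (y : State) : ‖y‖ ≤ ‖y 0‖ + ‖y 1‖ + ‖y 2‖ := by
  refine (sq_le_sq₀ (norm_nonneg _) (by positivity)).1 ?_
  rw [norm_state_sq]
  nlinarith [mul_nonneg (norm_nonneg (y 0)) (norm_nonneg (y 1)),
    mul_nonneg (norm_nonneg (y 0)) (norm_nonneg (y 2)),
    mul_nonneg (norm_nonneg (y 1)) (norm_nonneg (y 2))]

theorem embConst_nonneg (μ : ℝ) : 0 ≤ embConst μ := by unfold embConst; positivity

theorem norm_bilX_le (f g : State) : ‖bilX hμ f g‖ ≤ 6 * embConst μ * ‖f‖ * ‖g‖ := by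
  have h : ∀ (f g : State) i j, ‖prodX hμ (f i) (g j)‖ ≤ embConst μ * ‖f‖ * ‖g‖ :=
    fun f g i j => by
    refine (norm_prodX_le hμ _ _).trans ?_
    have := embConst_nonneg μ
    have h1 := PiLp.norm_apply_le f i
    have h2 := PiLp.norm_apply_le g j
    gcongr
  have h2 : ∀ (f g : State) i j, ‖prodX hμ (g i) (f j)‖ ≤ embConst μ * ‖f‖ * ‖g‖ :=
    fun f g i j => (h g f i j).trans_eq (by ring)
  refine (norm_state_le _).trans ?_
  rw [bilX_zero, bilX_one, bilX_two]
  refine (add_le_add (add_le_add ((norm_add_le _ _).trans (add_le_add (h f g 1 1) (h f g 2 2)))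
    ((norm_add_le _ _).trans (add_le_add (h f g 0 1) (h2 f g 0 1))))
    ((norm_add_le _ _).trans (add_le_add (h f g 0 2) (h2 f g 0 2)))).trans (le_of_eq ?_)
  ring

/-- A difference of squares for a symmetric bilinear map, from which the local Lipschitz bound
follows. -/
theorem bilX_self_sub (f g : State) :
    bilX hμ f f - bilX hμ g g = bilX hμ (f + g) (f - g) := by
  refine state_ext ?_ ?_ ?_
  · simp only [PiLp.sub_apply, bilX_zero, PiLp.add_apply, map_add, map_sub, add_apply]
    rw [prodX_comm hμ (g 1) (f 1), prodX_comm hμ (g 2) (f 2)]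
    abel
  · simp only [PiLp.sub_apply, bilX_one, PiLp.add_apply, map_add, map_sub, add_apply, sub_apply]
    abel
  · simp only [PiLp.sub_apply, bilX_two, PiLp.add_apply, map_add, map_sub, add_apply, sub_apply]
    abel

theorem lipschitzOnWith_bilX (r : ℝ) :
    ∃ K : NNReal, LipschitzOnWith K (fun f => bilX hμ f f) (Metric.closedBall 0 r) := by
  refine ⟨(6 * embConst μ * (r + r)).toNNReal, LipschitzOnWith.of_dist_le_mul fun f hf g hg => ?_⟩
  rw [mem_closedBall_zero_iff] at hf hg
  rw [dist_eq_norm, dist_eq_norm, bilX_self_sub]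
  refine (norm_bilX_le hμ _ _).trans (mul_le_mul_of_nonneg_right ?_ (norm_nonneg _))
  refine (mul_le_mul_of_nonneg_left ((norm_add_le f g).trans (add_le_add hf hg)) ?_).trans
    (Real.le_coe_toNNReal _)
  have := embConst_nonneg μ
  positivity

/-- The cubic energy `∫ ζ |v|²`. -/
def cubicX (f : State) : ℝ :=
  inner ℝ (smooth hμ (f 0)) (bilX hμ f f 0)

theorem norm_smooth_le (f : L2) : ‖smooth hμ f‖ ≤ ‖f‖ := by
  refine (norm_mult_le _ (C := 1) (fun ξ => ?_) f).trans_eq (one_mul _)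
  rw [rad_apply, Complex.norm_real, Real.norm_of_nonneg (rho_pos hμ _).le]
  exact rho_le_one hμ _

theorem abs_cubicX_le (f : State) : |cubicX hμ f| ≤ 6 * embConst μ * ‖f‖ ^ 3 := by
  refine (abs_real_inner_le_norm _ _).trans ?_
  have h1 := (norm_smooth_le hμ (f 0)).trans (PiLp.norm_apply_le f 0)
  have h2 := (PiLp.norm_apply_le (bilX hμ f f) 0).trans (norm_bilX_le hμ f f)
  exact (mul_le_mul h1 h2 (norm_nonneg _) (norm_nonneg _)).trans_eq (by ring)

/-- The gradient of ∫ζ|v|² is (|v|², 2ζv), which is `bilX` on the diagonal. -/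
theorem hasDerivWithinAt_cubicX {f : ℝ → State} {u : State} {I : Set ℝ} {t : ℝ} (ht : t ∈ I)
    (hf : ContinuousOn f I)
    (hu : HasDerivWithinAt (fun s => opMat (rad _ (radGood_rho hμ) • 1) (f s)) u I t) :
    HasDerivWithinAt (fun s => cubicX hμ (f s)) (inner ℝ u (bilX hμ (f t) (f t))) I t := by
  have hu' : ∀ i, HasDerivWithinAt (fun s => smooth hμ (f s i)) (u i) I t := fun i => by
    have := hasDerivWithinAt_state_apply hu i
    simp only [opMat_smul_one] at this
    exact this
  have hf' : ∀ i, ContinuousOn (fun s => f s i) I := fun i =>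
    (continuous_state_apply i).comp_continuousOn hf
  have h1 := hasDerivWithinAt_inner_bilin (prodX_comm hμ) (inner_prodX_swap hμ) ht (hf' 1)
    (hf' 1) (hu' 0) (hu' 1) (hu' 1)
  have h2 := hasDerivWithinAt_inner_bilin (prodX_comm hμ) (inner_prodX_swap hμ) ht (hf' 2)
    (hf' 2) (hu' 0) (hu' 2) (hu' 2)
  have h3 := h1.add h2
  have e : (fun s => cubicX hμ (f s)) = (fun s => inner ℝ (smooth hμ (f s 0))
      (prodX hμ (f s 1) (f s 1))) + fun s => inner ℝ (smooth hμ (f s 0))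
      (prodX hμ (f s 2) (f s 2)) := by
    ext s
    rw [cubicX, bilX_zero, inner_add_right]
    rfl
  rw [e]
  refine h3.congr_deriv ?_
  rw [inner_state, bilX_zero, bilX_one, bilX_two, inner_add_right, inner_add_right,
    inner_add_right]
  ring

end Cubic

/-! ### The system in diagonal variables -/

/-- The profile `f` is comparable to `1 + μ r²`. -/
structure Comparable (μ m : ℝ) (f : ℝ → ℝ) : Prop where
  measurable : Measurable f
  ge : ∀ r, 0 ≤ r → 1 + μ * r ^ 2 ≤ m * f r
  le : ∀ r, 0 ≤ r → f r ≤ m * (1 + μ * r ^ 2)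

/-- The profile `√f (1 + μ r²)^(-1/2)`. -/
def ratio (μ : ℝ) (f : ℝ → ℝ) (r : ℝ) : ℝ := √(f r) * rho μ r

namespace Comparable

variable {μ m : ℝ} {f : ℝ → ℝ} (hμ : 0 < μ) (hm : 0 < m) (hf : Comparable μ m f)

theorem measurable_ratio (hf : Comparable μ m f) : Measurable (ratio μ f) :=
  hf.measurable.sqrt.mul (measurable_rho μ)

include hμ hm hf

theorem pos {r : ℝ} (hr : 0 ≤ r) : 0 < f r := by
  have h1 := hf.ge r hr
  have h2 : 0 < m * f r := lt_of_lt_of_le (by positivity) h1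
  exact pos_of_mul_pos_right h2 hm.le

theorem ratio_pos {r : ℝ} (hr : 0 ≤ r) : 0 < ratio μ f r :=
  mul_pos (Real.sqrt_pos.2 (hf.pos hμ hm hr)) (rho_pos hμ r)

theorem ratio_sq {r : ℝ} (hr : 0 ≤ r) : ratio μ f r ^ 2 = f r * rho μ r ^ 2 := by
  rw [ratio, mul_pow, Real.sq_sqrt (hf.pos hμ hm hr).le]

/-- Comparability multiplied by ρ², as 1 + μr² = ρ⁻². With the bound for the inverse, the passage to
diagonal variables is an isomorphism of L². -/
theorem ratio_le {r : ℝ} (hr : 0 ≤ r) : |ratio μ f r| ≤ √m := by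
  refine Real.abs_le_sqrt ?_
  rw [hf.ratio_sq hμ hm hr]
  have h1 := mul_le_mul_of_nonneg_right (hf.le r hr) (sq_nonneg (rho μ r))
  have h2 := rho_sq_mul hμ r
  linear_combination h1 + m * h2

theorem inv_ratio_le {r : ℝ} (hr : 0 ≤ r) : |(ratio μ f r)⁻¹| ≤ √m := by
  refine Real.abs_le_sqrt ?_
  have h0 := hf.ratio_pos hμ hm hr
  rw [inv_pow, inv_le_iff_one_le_mul₀ (by positivity), hf.ratio_sq hμ hm hr]
  have h1 := mul_le_mul_of_nonneg_right (hf.ge r hr) (sq_nonneg (rho μ r))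
  have h2 := rho_sq_mul hμ r
  linear_combination h1 - h2

theorem radGood : RadGood (ratio μ f) :=
  ⟨hf.measurable_ratio, _, fun _ => hf.ratio_le hμ hm⟩

theorem radGood_inv : RadGood fun r => (ratio μ f r)⁻¹ :=
  ⟨hf.measurable_ratio.inv, _, fun _ => hf.inv_ratio_le hμ hm⟩

end Comparable

theorem offd_neg {f : ℝ → ℝ} (hf : VecGood f) (hf' : VecGood fun r => -f r) :
    offd _ _ hf' hf' = -offd _ _ hf hf := by
  have h : ∀ k, vec k _ hf' = -vec k _ hf := fun k => symb_ext fun ξ => by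
    rw [symb_neg_apply, vec_apply, vec_apply]
    push_cast; ring
  ext1 i j
  fin_cases i <;> fin_cases j <;> simp [offd, h]

/-- Decay like ρ pays for one derivative, at the price μ^(-1/2). -/
theorem vecGood_of_le {μ C : ℝ} (hμ : 0 < μ) {f : ℝ → ℝ} (hf : Measurable f)
    (h : ∀ r, 0 ≤ r → |f r| ≤ C * rho μ r) : VecGood f := by
  have hC : 0 ≤ C :=
    nonneg_of_mul_nonneg_left ((abs_nonneg _).trans (h 0 le_rfl)) (rho_pos hμ 0)
  refine ⟨hf, C * (√μ)⁻¹, fun r hr => ?_⟩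
  have h1 := mul_le_mul_of_nonneg_left (abs_mul_rho_le hμ r) hC
  rw [abs_mul, abs_of_pos (rho_pos hμ r)] at h1
  rw [abs_mul]
  exact (mul_le_mul_of_nonneg_left (h r hr) (abs_nonneg r)).trans
    (le_trans (le_of_eq (by ring)) h1)

/-- The symbols of the system `∂ₜζ = -j(|D|) β(|D|) ∇·v + …`, `∂ₜv = -j(|D|) α(|D|) ∇ζ + …`. -/
structure Dispersion where
  /-- The weight. -/
  μ : ℝ
  /-- The constant in the comparison of `α` and `β` with `1 + μ r²`. -/
  m : ℝ
  /-- The constant in the bound of `j`. -/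
  B : ℝ
  /-- The symbol acting on `ζ`. -/
  α : ℝ → ℝ
  /-- The symbol acting on `v`. -/
  β : ℝ → ℝ
  /-- The regularizing symbol. -/
  j : ℝ → ℝ
  μ_pos : 0 < μ
  m_pos : 0 < m
  α_comp : Comparable μ m α
  β_comp : Comparable μ m β
  j_meas : Measurable j
  j_le : ∀ r, 0 ≤ r → |j r| ≤ B * rho μ r ^ 2

namespace Dispersion

variable (P : Dispersion)

theorem B_nonneg : 0 ≤ P.B :=
  nonneg_of_mul_nonneg_left ((abs_nonneg _).trans (P.j_le 0 le_rfl))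
    (pow_pos (rho_pos P.μ_pos 0) 2)

theorem sqrt_eq {f : ℝ → ℝ} (r : ℝ) : √(f r) = ratio P.μ f r * (rho P.μ r)⁻¹ := by
  rw [ratio, mul_assoc, mul_inv_cancel₀ (rho_pos P.μ_pos r).ne', mul_one]

/-- The symbol j gains two derivatives; a factor of order one uses the first and ∂ₖ the second. -/
theorem vecGood_j_mul {f : ℝ → ℝ} (hf : Measurable f) {C : ℝ}
    (h : ∀ r, 0 ≤ r → |f r| ≤ C * (rho P.μ r)⁻¹) : VecGood fun r => P.j r * f r := by
  refine vecGood_of_le P.μ_pos (C := P.B * C) (P.j_meas.mul hf) fun r hr => ?_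
  have hρ := rho_pos P.μ_pos r
  rw [abs_mul]
  refine (mul_le_mul (P.j_le r hr) (h r hr) (abs_nonneg _)
    (mul_nonneg P.B_nonneg (sq_nonneg _))).trans (le_of_eq ?_)
  field_simp

theorem vecGood_j : VecGood P.j := by
  have := P.vecGood_j_mul (f := fun _ => 1) measurable_const (C := 1) fun r _ => by
    rw [abs_one, one_mul]
    exact (one_le_inv₀ (rho_pos P.μ_pos r)).2 (rho_le_one P.μ_pos r)
  simpa using this

theorem vecGood_j_sqrt {f : ℝ → ℝ} (hf : Comparable P.μ P.m f) :
    VecGood fun r => P.j r * √(f r) := by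
  refine P.vecGood_j_mul hf.measurable.sqrt (C := √P.m) fun r hr => ?_
  rw [P.sqrt_eq, abs_mul, abs_of_pos (inv_pos.2 (rho_pos P.μ_pos r))]
  exact mul_le_mul_of_nonneg_right (hf.ratio_le P.μ_pos P.m_pos hr)
    (inv_pos.2 (rho_pos P.μ_pos r)).le

theorem vecGood_j_rho {f : ℝ → ℝ} (hf : Comparable P.μ P.m f) :
    VecGood fun r => P.j r * (f r * rho P.μ r) := by
  refine P.vecGood_j_mul (hf.measurable.mul (measurable_rho _)) (C := P.m) fun r hr => ?_
  have hρ := rho_pos P.μ_pos r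
  rw [abs_of_pos (mul_pos (hf.pos P.μ_pos P.m_pos hr) hρ), le_mul_inv_iff₀ hρ]
  have h1 := mul_le_mul_of_nonneg_right (hf.le r hr) (sq_nonneg (rho P.μ r))
  have h2 := rho_sq_mul P.μ_pos r
  linear_combination h1 + P.m * h2

/-- The dispersion relation. -/
def ω (r : ℝ) : ℝ := P.j r * √(P.α r) * √(P.β r) * r

theorem measurable_ω : Measurable P.ω :=
  ((P.j_meas.mul P.α_comp.measurable.sqrt).mul P.β_comp.measurable.sqrt).mul measurable_id

/-- The order of ω is at most -2 + 1 + 1 + 1 = 1, so a single ρ compensates it. -/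
theorem radGood_ω : RadGood fun r => rho P.μ r * P.ω r := by
  refine ⟨(measurable_rho _).mul P.measurable_ω, P.B * √P.m * √P.m * (√P.μ)⁻¹, fun r hr => ?_⟩
  have hρ := rho_pos P.μ_pos r
  have e : rho P.μ r * P.ω r
      = P.j r * (rho P.μ r ^ 2)⁻¹ * ratio P.μ P.α r * ratio P.μ P.β r * (r * rho P.μ r) := by
    rw [ω, P.sqrt_eq, P.sqrt_eq]
    field_simp
  have h1 : |P.j r * (rho P.μ r ^ 2)⁻¹| ≤ P.B := by
    rw [abs_mul, abs_of_pos (inv_pos.2 (pow_pos hρ 2)), mul_inv_le_iff₀ (pow_pos hρ 2)]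
    exact P.j_le r hr
  change |rho P.μ r * P.ω r| ≤ _
  rw [e, abs_mul, abs_mul, abs_mul]
  have hB := P.B_nonneg
  gcongr
  · exact P.α_comp.ratio_le P.μ_pos P.m_pos hr
  · exact P.β_comp.ratio_le P.μ_pos P.m_pos hr
  · exact abs_mul_rho_le P.μ_pos r

/-- The group of the linear system. -/
def group : DampedGroup State := dampedGroup P.μ_pos P.measurable_ω P.radGood_ω

/-- The change of variables `f ↦ W`. -/
def toW : State →L[ℝ] State := opMat (dia _ _ (P.α_comp.radGood P.μ_pos P.m_pos)
  (P.β_comp.radGood P.μ_pos P.m_pos))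

/-- The change of variables `W ↦ f`. -/
def ofW : State →L[ℝ] State := opMat (dia _ _ (P.α_comp.radGood_inv P.μ_pos P.m_pos)
  (P.β_comp.radGood_inv P.μ_pos P.m_pos))

/-- The linear part of the system. -/
def lin : State →L[ℝ] State := opMat (offd _ _ (P.vecGood_j_rho P.β_comp)
  (P.vecGood_j_rho P.α_comp))

/-- The operator acting on the nonlinearity. -/
def nl : State →L[ℝ] State := opMat (offd _ _ P.vecGood_j P.vecGood_j)

/-- The operator acting on the nonlinearity, in diagonal variables. -/
def nlW : State →L[ℝ] State := opMat (offd _ _ (P.vecGood_j_sqrt P.α_comp)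
  (P.vecGood_j_sqrt P.β_comp))

theorem radGood_one : RadGood fun _ => 1 := ⟨measurable_const, 1, by simp⟩

theorem dia_one : dia _ _ radGood_one radGood_one = 1 := by
  have h : rad _ radGood_one = 1 := symb_ext fun ξ => by simp [rad_apply, symb_one_apply]
  rw [dia_eq_smul, h, one_smul]

theorem ofW_toW (y : State) : P.ofW (P.toW y) = y := by
  rw [toW, ofW, ← opMat_mul, dia_mul_dia _ _ _ _ radGood_one radGood_one, dia_one, opMat_one]
  · exact fun r hr => inv_mul_cancel₀ (P.α_comp.ratio_pos P.μ_pos P.m_pos hr).ne'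
  · exact fun r hr => inv_mul_cancel₀ (P.β_comp.ratio_pos P.μ_pos P.m_pos hr).ne'

theorem norm_toW_le (y : State) : ‖P.toW y‖ ≤ √P.m * ‖y‖ :=
  norm_dia_le _ _ (Real.sqrt_nonneg _) (fun _ => P.α_comp.ratio_le P.μ_pos P.m_pos)
    (fun _ => P.β_comp.ratio_le P.μ_pos P.m_pos) y

theorem norm_ofW_le (y : State) : ‖P.ofW y‖ ≤ √P.m * ‖y‖ :=
  norm_dia_le _ _ (Real.sqrt_nonneg _) (fun _ => P.α_comp.inv_ratio_le P.μ_pos P.m_pos)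
    (fun _ => P.β_comp.inv_ratio_le P.μ_pos P.m_pos) y

theorem group_A : P.group.A = opMat (rad _ P.radGood_ω • rieszMat) := rfl

theorem group_R : P.group.R = opMat (rad _ (radGood_rho P.μ_pos) • 1) := rfl

theorem toW_R (y : State) : P.toW (P.group.R y) = P.group.R (P.toW y) := by
  rw [group_R, toW, ← opMat_mul, ← opMat_mul, smul_one_mul, mul_smul_one]

theorem ofW_R (y : State) : P.ofW (P.group.R y) = P.group.R (P.ofW y) := by
  rw [group_R, ofW, ← opMat_mul, ← opMat_mul, smul_one_mul, mul_smul_one]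

/-- The factor ρ contained in `ratio` comes out in front as the damping, leaving j∇√α and j∇√β,
which are bounded. This is the form R F(W) that `DampedGroup.IsStrong` requires. -/
theorem toW_nl (y : State) : P.toW (P.nl y) = P.group.R (P.nlW y) := by
  have hg : ∀ {f : ℝ → ℝ}, Comparable P.μ P.m f → VecGood fun r => ratio P.μ f r * P.j r :=
    fun {f} hf => vecGood_of_le P.μ_pos (C := √P.m * P.B) (hf.measurable_ratio.mul P.j_meas)
      fun r hr => by
    have hρ := rho_pos P.μ_pos r
    have hB := P.B_nonneg
    rw [abs_mul, mul_assoc]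
    refine mul_le_mul (hf.ratio_le P.μ_pos P.m_pos hr) ((P.j_le r hr).trans ?_) (abs_nonneg _)
      (Real.sqrt_nonneg _)
    refine mul_le_mul_of_nonneg_left ?_ hB
    rw [pow_two]
    exact mul_le_of_le_one_left hρ.le (rho_le_one P.μ_pos r)
  rw [group_R, ← dia_eq_smul, toW, nl, nlW, ← opMat_mul, ← opMat_mul,
    dia_mul_offd _ _ _ _ (hg P.α_comp) (hg P.β_comp) (fun _ _ => rfl) (fun _ _ => rfl),
    dia_mul_offd _ _ _ _ (hg P.α_comp) (hg P.β_comp)]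
  · intro r _; rw [ratio]; ring
  · intro r _; rw [ratio]; ring

theorem lin_ofW (y : State) : P.lin (P.ofW y)
    = opMat (offd _ _ (P.vecGood_j_sqrt P.β_comp) (P.vecGood_j_sqrt P.α_comp)) y := by
  have h : ∀ {f : ℝ → ℝ}, Comparable P.μ P.m f → ∀ r, 0 < r →
      (ratio P.μ f r)⁻¹ * (P.j r * (f r * rho P.μ r)) = P.j r * √(f r) := fun {f} hf r hr => by
    have h1 := hf.pos P.μ_pos P.m_pos hr.le
    have h2 := rho_pos P.μ_pos r
    have h3 := Real.sqrt_pos.2 h1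
    rw [ratio]
    field_simp
    rw [Real.sq_sqrt h1.le, mul_comm]
  rw [lin, ofW, ← opMat_mul, offd_mul_dia]
  · exact h P.β_comp
  · exact h P.α_comp

/-- Conjugation replaces the unequal profiles jβρ and jαρ by the common profile jρ√α√β = ρω/r, which
makes the linear part skew. -/
theorem toW_lin (y : State) : P.toW (P.lin (P.ofW y)) = -P.group.A y := by
  have hg : VecGood fun r => rho P.μ r * P.ω r * (-r⁻¹) := by
    obtain ⟨C, hC⟩ := P.radGood_ω.2
    refine ⟨P.radGood_ω.1.mul (by fun_prop), C, fun r hr => ?_⟩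
    rcases hr.eq_or_lt with rfl | hr'
    · simpa using (abs_nonneg _).trans (hC 0 le_rfl)
    · have : r * (rho P.μ r * P.ω r * (-r⁻¹)) = -(rho P.μ r * P.ω r) := by
        field_simp
      rw [this, abs_neg]
      exact hC r hr
  have hg' : VecGood fun r => -(rho P.μ r * P.ω r * (-r⁻¹)) :=
    ⟨hg.1.neg, by simpa only [mul_neg, abs_neg] using hg.2⟩
  have e1 : rad _ P.radGood_ω • rieszMat = offd _ _ hg hg := by
    rw [← smul_one_mul, ← dia_eq_smul, rieszMat,
      dia_mul_offd _ _ _ _ hg hg (fun _ _ => rfl) (fun _ _ => rfl)]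
  have e2 : offd _ _ hg' hg' = -offd _ _ hg hg := offd_neg hg hg'
  have h : ∀ r, 0 < r → ratio P.μ P.α r * (P.j r * √(P.β r)) = -(rho P.μ r * P.ω r * (-r⁻¹)) :=
    fun r hr => by
    rw [ratio, ω]; field_simp
  have h' : ∀ r, 0 < r → ratio P.μ P.β r * (P.j r * √(P.α r)) = -(rho P.μ r * P.ω r * (-r⁻¹)) :=
    fun r hr => by
    rw [ratio, ω]; field_simp
  rw [lin_ofW, toW, ← opMat_mul, dia_mul_offd _ _ _ _ hg' hg' h h', e2, opMat_neg, ← e1, group_A]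

theorem ofW_A (y : State) : P.ofW (P.group.A y) = -P.lin (P.ofW y) := by
  rw [← neg_eq_iff_eq_neg, ← map_neg, ← toW_lin, ofW_toW]

theorem ofW_R_nlW (y : State) : P.ofW (P.group.R (P.nlW y)) = P.nl y := by
  rw [← toW_nl, ofW_toW]

end Dispersion

theorem continuous_of_lipschitzOnWith_balls {Y : Type*} [NormedAddCommGroup Y] {F : Y → Y}
    (hF : ∀ r, ∃ K : NNReal, LipschitzOnWith K F (Metric.closedBall 0 r)) : Continuous F := by
  rw [continuous_iff_continuousAt]
  intro x
  obtain ⟨K, hK⟩ := hF (‖x‖ + 1)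
  refine hK.continuousOn.continuousAt ?_
  refine mem_of_superset (Metric.ball_mem_nhds x one_pos) fun y hy => ?_
  rw [mem_closedBall_zero_iff]
  have h1 := norm_add_le (y - x) x
  rw [sub_add_cancel] at h1
  rw [mem_ball_iff_norm] at hy
  linarith

/-! ### The nonlinear flow, its Hamiltonian and global solutions -/

namespace Dispersion

variable (P : Dispersion) (κ : ℝ)

/-- The nonlinearity in diagonal variables. -/
def force (W : State) : State := P.nlW (κ • bilX P.μ_pos (P.ofW W) (P.ofW W))

theorem lipschitzOnWith_force (r : ℝ) :
    ∃ K : NNReal, LipschitzOnWith K (P.force κ) (Metric.closedBall 0 r) := by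
  obtain ⟨K, hK⟩ := lipschitzOnWith_bilX P.μ_pos (√P.m * r)
  have h1 := hK.comp (P.ofW.lipschitz.lipschitzOnWith (s := Metric.closedBall 0 r)) fun W hW => by
    rw [mem_closedBall_zero_iff] at hW ⊢
    exact (P.norm_ofW_le W).trans (mul_le_mul_of_nonneg_left hW (Real.sqrt_nonneg _))
  have h2 := ((κ • P.nlW).lipschitz.lipschitzOnWith (s := univ)).comp h1 fun _ _ => mem_univ _
  have e : P.force κ = (κ • P.nlW) ∘ (fun f => bilX P.μ_pos f f) ∘ P.ofW := by
    ext1 W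
    simp [force]
  exact ⟨_, e ▸ h2⟩

theorem continuous_force : Continuous (P.force κ) :=
  continuous_of_lipschitzOnWith_balls (P.lipschitzOnWith_force κ)

/-- The right-hand side of the system in the variables `f`. -/
def rhs (f : State) : State := P.nl (κ • bilX P.μ_pos f f) - P.lin f

theorem continuous_rhs : Continuous (P.rhs κ) :=
  (P.nl.continuous.comp ((continuous_of_lipschitzOnWith_balls
    (lipschitzOnWith_bilX P.μ_pos)).const_smul κ)).sub P.lin.continuous

/-- Solutions of the system, in the variables `f` for which `(ζ, v) = (1 - μΔ)^(-1/2) f`. -/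
structure IsFlow (f : ℝ → State) (I : Set ℝ) : Prop where
  cont : ContinuousOn f I
  deriv : ∀ t ∈ I, HasDerivWithinAt (fun s => P.group.R (f s)) (P.rhs κ (f t)) I t

variable {P κ}

theorem IsFlow.isStrong {f : ℝ → State} {I : Set ℝ} (h : P.IsFlow κ f I) :
    P.group.IsStrong (P.force κ) (fun t => P.toW (f t)) I := by
  refine ⟨P.toW.continuous.comp_continuousOn h.cont, fun t ht => ?_⟩
  have h1 := P.toW.hasFDerivAt.comp_hasDerivWithinAt t (h.deriv t ht)
  have e : P.toW (P.rhs κ (f t))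
      = P.group.A (P.toW (f t)) + P.group.R (P.force κ (P.toW (f t))) := by
    have h2 := P.toW_lin (P.toW (f t))
    rw [ofW_toW] at h2
    rw [rhs, map_sub, toW_nl, h2, force, ofW_toW]
    abel
  rw [e] at h1
  exact h1.congr_of_eventuallyEq (Eventually.of_forall fun s => (P.toW_R _).symm) (P.toW_R _).symm

theorem isFlow_of_isStrong {W : ℝ → State} {I : Set ℝ} (h : P.group.IsStrong (P.force κ) W I) :
    P.IsFlow κ (fun t => P.ofW (W t)) I := by
  refine ⟨P.ofW.continuous.comp_continuousOn h.cont, fun t ht => ?_⟩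
  have h1 := P.ofW.hasFDerivAt.comp_hasDerivWithinAt t (h.deriv t ht)
  have e : P.ofW (P.group.A (W t) + P.group.R (P.force κ (W t))) = P.rhs κ (P.ofW (W t)) := by
    rw [map_add, ofW_A, force, ofW_R_nlW, rhs]
    abel
  rw [e] at h1
  exact h1.congr_of_eventuallyEq (Eventually.of_forall fun s => (P.ofW_R _).symm) (P.ofW_R _).symm

variable (P κ)

/-- Both entries of `nl` carry the same j. For the Boussinesq system this is where b = d matters. -/
theorem inner_nl_self (y : State) : inner ℝ (P.nl y) y = 0 := by
  have h := inner_offd P.vecGood_j P.vecGood_j y y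
  change inner ℝ (P.nl y) y = -inner ℝ y (P.nl y) at h
  rw [real_inner_comm (P.nl y) y] at h
  linarith

/-- The effect of the nonlinearity on the quadratic energy is thus opposite to the effect of the
linear flow on the cubic energy. -/
theorem inner_nlW (x y : State) : inner ℝ x (P.nlW y) = -inner ℝ (P.lin (P.ofW x)) y := by
  rw [lin_ofW, inner_offd, neg_neg, nlW]

/-- The Hamiltonian. -/
def energy (W : State) : ℝ := ‖W‖ ^ 2 - 2 * κ * cubicX P.μ_pos (P.ofW W)

variable {P κ}

/-- The norm of W equals that of S(-t)W, whose derivative S(-t)F(W) does not contain the generator.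
-/
theorem hasDerivWithinAt_norm_sq {W : ℝ → State} {T : ℝ}
    (h : P.group.IsStrong (P.force κ) W (Icc 0 T)) {t : ℝ} (ht : t ∈ Icc 0 T) :
    HasDerivWithinAt (fun s => ‖W s‖ ^ 2) (2 * inner ℝ (W t) (P.force κ (W t))) (Icc 0 T) t := by
  have h1 := (h.hasDerivWithinAt P.group (P.continuous_force κ) ht).norm_sq
  simp only [P.group.norm_S] at h1
  have h2 : ∀ x y : State, inner ℝ (P.group.S (-t) x) (P.group.S (-t) y) = inner ℝ x y :=
    (⟨(P.group.S (-t)).toLinearMap, P.group.norm_S (-t)⟩ : State →ₗᵢ[ℝ] State).inner_map_map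
  rwa [h2] at h1

/-- With q = κ `bilX` f f, the quadratic part contributes -2⟨lin f, q⟩ and the cubic part -2⟨nl q -
lin f, q⟩. Their sum is -2⟨nl q, q⟩ = 0. -/
theorem energy_eq {W : ℝ → State} {T : ℝ} (h : P.group.IsStrong (P.force κ) W (Icc 0 T)) {t : ℝ}
    (ht : t ∈ Icc 0 T) : P.energy κ (W t) = P.energy κ (W 0) := by
  have hd : ∀ t ∈ Icc 0 T, HasDerivWithinAt (fun s => P.energy κ (W s)) 0 (Icc 0 T) t :=
    fun t ht => by
    have hf := isFlow_of_isStrong h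
    have h1 := hasDerivWithinAt_cubicX P.μ_pos ht hf.cont (hf.deriv t ht)
    refine ((hasDerivWithinAt_norm_sq h ht).sub (h1.const_mul (2 * κ))).congr_deriv ?_
    have h2 := P.inner_nl_self (κ • bilX P.μ_pos (P.ofW (W t)) (P.ofW (W t)))
    rw [real_inner_smul_right] at h2
    rw [force, inner_nlW, rhs, inner_sub_left, real_inner_smul_right]
    linear_combination -2 * h2
  refine constant_of_has_deriv_right_zero (fun s hs => (hd s hs).continuousWithinAt)
    (fun s hs => (hd s (Ico_subset_Icc_self hs)).mono_of_mem_nhdsWithin ?_) t ht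
  exact mem_of_superset (Icc_mem_nhdsGE hs.2) (Icc_subset_Icc_left hs.1)

theorem abs_cubicX_ofW_le (W : State) :
    |cubicX P.μ_pos (P.ofW W)| ≤ 6 * embConst P.μ * √P.m ^ 3 * ‖W‖ ^ 3 := by
  refine (abs_cubicX_le P.μ_pos _).trans ?_
  have h1 := embConst_nonneg P.μ
  have h2 := P.norm_ofW_le W
  calc 6 * embConst P.μ * ‖P.ofW W‖ ^ 3 ≤ 6 * embConst P.μ * (√P.m * ‖W‖) ^ 3 := by gcongr
    _ = _ := by ring

/-- In the ball of radius r the cubic term is at most a quarter of the quadratic one, so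
conservation gives (3/4)‖W t‖² ≤ (5/4)‖W 0‖². -/
theorem apriori {W : ℝ → State} {T r : ℝ} (hκ : 0 ≤ κ)
    (hr : κ * (6 * embConst P.μ * √P.m ^ 3) * r ≤ 1 / 8)
    (h : P.group.IsStrong (P.force κ) W (Icc 0 T)) (hW : ∀ t ∈ Icc 0 T, ‖W t‖ ≤ r) {t : ℝ}
    (ht : t ∈ Icc 0 T) : ‖W t‖ ≤ 2 * ‖W 0‖ := by
  have h0 : (0 : ℝ) ∈ Icc 0 T := ⟨le_rfl, ht.1.trans ht.2⟩
  have key : ∀ s ∈ Icc 0 T, |2 * κ * cubicX P.μ_pos (P.ofW (W s))| ≤ 1 / 4 * ‖W s‖ ^ 2 :=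
    fun s hs => by
    rw [abs_mul, abs_of_nonneg (by positivity)]
    have h1 := mul_le_mul_of_nonneg_left (abs_cubicX_ofW_le (P := P) (W s))
      (show 0 ≤ 2 * κ by positivity)
    have hc : 0 ≤ κ * (6 * embConst P.μ * √P.m ^ 3) := by
      have := embConst_nonneg P.μ
      positivity
    have h2 := (mul_le_mul_of_nonneg_left (hW s hs) hc).trans hr
    have h3 := mul_le_mul_of_nonneg_right h2 (sq_nonneg ‖W s‖)
    linarith
  have h1 := energy_eq h ht
  simp only [energy] at h1
  have h2 := (abs_le.1 (key t ht)).2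
  have h3 := (abs_le.1 (key 0 h0)).1
  refine (sq_le_sq₀ (norm_nonneg _) (by positivity)).1 ?_
  nlinarith [sq_nonneg ‖W 0‖]

theorem exists_isStrong {r : ℝ} (hκ : 0 ≤ κ) (hr : κ * (6 * embConst P.μ * √P.m ^ 3) * r ≤ 1 / 8)
    {W₀ : State} (hW₀ : 2 * ‖W₀‖ < r) :
    ∃ W : ℝ → State, W 0 = W₀ ∧ (∀ T, P.group.IsStrong (P.force κ) W (Icc 0 T)) ∧
      ∀ t, 0 ≤ t → ‖W t‖ ≤ 2 * ‖W₀‖ := by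
  refine DampedGroup.exists_global_isStrong (P.continuous_force κ) (P.lipschitzOnWith_force κ)
    fun T hT => DampedGroup.exists_isStrong_of_apriori (P.lipschitzOnWith_force κ)
      (by positivity) hW₀ (by linarith [norm_nonneg W₀]) ?_ hT
  intro T W _ h0 hW hb t ht
  rw [← h0]
  exact apriori hκ hr hW hb ht

theorem IsFlow.mono {f : ℝ → State} {I J : Set ℝ} (h : P.IsFlow κ f I) (hJ : J ⊆ I) :
    P.IsFlow κ f J :=
  ⟨h.cont.mono hJ, fun t ht => (h.deriv t (hJ ht)).mono hJ⟩

theorem IsFlow.eqOn {f g : ℝ → State} (hf : P.IsFlow κ f (Ici 0)) (hg : P.IsFlow κ g (Ici 0))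
    (h0 : f 0 = g 0) {t : ℝ} (ht : 0 ≤ t) : f t = g t := by
  have h := DampedGroup.IsStrong.eqOn (P.continuous_force κ) (P.lipschitzOnWith_force κ)
    (hf.mono Icc_subset_Ici_self).isStrong (hg.mono (J := Icc 0 t) Icc_subset_Ici_self).isStrong
    (by simp only [h0]) ⟨ht, le_rfl⟩
  have h1 := congrArg P.ofW h
  simpa only [ofW_toW] using h1

theorem exists_isFlow {r : ℝ} (hκ : 0 ≤ κ) (hr : κ * (6 * embConst P.μ * √P.m ^ 3) * r ≤ 1 / 8)
    {f₀ : State} (hf₀ : 2 * √P.m * ‖f₀‖ < r) :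
    ∃ f : ℝ → State, f 0 = f₀ ∧ P.IsFlow κ f (Ici 0) ∧ ∀ t, 0 ≤ t → ‖f t‖ ≤ 2 * P.m * ‖f₀‖ := by
  have h1 := P.norm_toW_le f₀
  obtain ⟨W, hW0, hW, hWb⟩ := exists_isStrong (W₀ := P.toW f₀) hκ hr (by linarith)
  have hfl := fun T => isFlow_of_isStrong (hW T)
  have hm : ∀ t : ℝ, 0 ≤ t → t ∈ Icc 0 (t + 1) ∧ Icc 0 (t + 1) ∈ 𝓝[Ici 0] t := fun t ht => by
    refine ⟨⟨ht, by linarith⟩, ?_⟩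
    rw [← Ici_inter_Iic]
    exact inter_mem self_mem_nhdsWithin (mem_nhdsWithin_of_mem_nhds (Iic_mem_nhds (by linarith)))
  refine ⟨fun t => P.ofW (W t), by simp only [hW0, ofW_toW], ⟨fun t ht => ?_, fun t ht => ?_⟩,
    fun t ht => ?_⟩
  · exact ((hfl (t + 1)).cont t (hm t ht).1).mono_of_mem_nhdsWithin (hm t ht).2
  · exact ((hfl (t + 1)).deriv t (hm t ht).1).mono_of_mem_nhdsWithin (hm t ht).2
  · have hs := Real.sqrt_nonneg P.m
    calc ‖P.ofW (W t)‖ ≤ √P.m * ‖W t‖ := P.norm_ofW_le _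
      _ ≤ √P.m * (2 * (√P.m * ‖f₀‖)) := by
        gcongr
        linarith [hWb t ht]
      _ = 2 * (√P.m * √P.m) * ‖f₀‖ := by ring
      _ = _ := by rw [Real.mul_self_sqrt P.m_pos.le]

end Dispersion

/-! ### The symbols of the Boussinesq system -/

theorem le_cothSymbol {μ₂ r : ℝ} (hμ₂ : 0 < μ₂) (hr : 0 ≤ r) : r ≤ cothSymbol μ₂ r := by
  rcases hr.eq_or_lt with rfl | hr'
  · simp [cothSymbol]
  · have hy : 0 < √μ₂ * r := mul_pos (Real.sqrt_pos.2 hμ₂) hr'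
    rw [cothSymbol, coth]
    refine le_mul_of_one_le_right hr ?_
    rw [one_le_div (Real.sinh_pos_iff.2 hy)]
    exact (Real.sinh_lt_cosh _).le

theorem cothSymbol_le {μ₂ r : ℝ} (hμ₂ : 0 < μ₂) (hr : 0 ≤ r) :
    cothSymbol μ₂ r ≤ r + (√μ₂)⁻¹ := by
  have hs := Real.sqrt_pos.2 hμ₂
  rcases hr.eq_or_lt with rfl | hr'
  · simp [cothSymbol]
  · have hy : 0 < √μ₂ * r := mul_pos hs hr'
    rw [cothSymbol, coth]
    set y := √μ₂ * r with hy'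
    have hr2 : r = y * (√μ₂)⁻¹ := by rw [hy']; field_simp
    -- Equivalent to y(cosh y - sinh y) = y e^(-y) ≤ sinh y, which follows from y e^(-y) ≤ y ≤ sinh
    -- y.
    have h1 : y * (Real.cosh y / Real.sinh y) ≤ y + 1 := by
      rw [mul_div_assoc', div_le_iff₀ (Real.sinh_pos_iff.2 hy)]
      have h2 := Real.self_le_sinh_iff.2 hy.le
      have h3 : Real.exp (-y) ≤ 1 := Real.exp_le_one_iff.2 (by linarith)
      have h4 := mul_le_mul_of_nonneg_left h3 hy.le
      rw [← Real.cosh_sub_sinh] at h4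
      linarith
    have h2 := mul_le_mul_of_nonneg_right h1 (inv_pos.2 hs).le
    rw [hr2]
    linarith

theorem measurable_cothSymbol (μ₂ : ℝ) : Measurable (cothSymbol μ₂) := by
  unfold cothSymbol coth
  exact measurable_id.mul ((Real.measurable_cosh.comp (measurable_id.const_mul _)).div
    (Real.measurable_sinh.comp (measurable_id.const_mul _)))

/-- The symbol of the dispersive terms of the second equation. -/
def alphaSym (c γ μ r : ℝ) : ℝ := (1 - γ) * (1 - c * μ * r ^ 2)

/-- The symbol of the dispersive terms of the first equation. -/
def betaSym (a γ μ μ₂ r : ℝ) : ℝ :=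
  1 / γ - √μ / γ ^ 2 * cothSymbol μ₂ r + μ / γ * (-a * r ^ 2 + 1 / γ ^ 2 * cothSymbol μ₂ r ^ 2)

/-- The symbol of `(1 - bμΔ)⁻¹`. -/
def jSym (b μ r : ℝ) : ℝ := (1 + b * μ * r ^ 2)⁻¹

/-- The constant in the comparison of the symbols with `1 + μ r²`. -/
def compConst (a c γ L : ℝ) : ℝ :=
  2 + (1 - γ)⁻¹ * (1 + (-c)⁻¹) + (1 - c) + γ⁻¹ * (1 + 2 * L / γ ^ 2 - a)

section Bounds

variable {a b c γ L μ μ₂ : ℝ}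

/-- Each of the four comparisons of α and β needs one summand of `compConst`, the summand 2 serving
the lower bound of β; positivity lets the others be dropped. -/
theorem compConst_summands_pos (ha : a ≤ 0) (hc : c < 0) (hγ₀ : 0 < γ) (hγ₁ : γ < 1)
    (hL : 1 ≤ L) : 0 < (1 - γ)⁻¹ * (1 + (-c)⁻¹) ∧ 0 < 1 - c ∧
      0 < γ⁻¹ * (1 + 2 * L / γ ^ 2 - a) := by
  have h1 : 0 < 1 - γ := by linarith
  have h2 : 0 < -c := by linarith
  have h3 : 0 < 2 * L / γ ^ 2 := by positivity
  refine ⟨by positivity, by linarith, mul_pos (by positivity) (by linarith)⟩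

theorem compConst_pos (ha : a ≤ 0) (hc : c < 0) (hγ₀ : 0 < γ) (hγ₁ : γ < 1) (hL : 1 ≤ L) :
    0 < compConst a c γ L := by
  obtain ⟨h1, h2, h3⟩ := compConst_summands_pos ha hc hγ₀ hγ₁ hL
  unfold compConst
  linarith

theorem comparable_alphaSym (ha : a ≤ 0) (hc : c < 0) (hγ₀ : 0 < γ) (hγ₁ : γ < 1) (hL : 1 ≤ L)
    (hμ : 0 < μ) : Comparable μ (compConst a c γ L) (alphaSym c γ μ) := by
  obtain ⟨h1, h2, h3⟩ := compConst_summands_pos ha hc hγ₀ hγ₁ hL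
  have h4 : 0 < 1 - γ := by linarith
  have h5 : 0 < -c := by linarith
  have hα : ∀ r, 0 ≤ alphaSym c γ μ r := fun r => by
    unfold alphaSym
    have : 0 ≤ -c * (μ * r ^ 2) := by positivity
    exact mul_nonneg h4.le (by linarith)
  refine ⟨by unfold alphaSym; fun_prop, fun r _ => ?_, fun r _ => ?_⟩
  · have e : 1 + μ * r ^ 2 ≤ ((1 - γ)⁻¹ * (1 + (-c)⁻¹)) * alphaSym c γ μ r := by
      have : ((1 - γ)⁻¹ * (1 + (-c)⁻¹)) * alphaSym c γ μ r
          = 1 + μ * r ^ 2 + (-c)⁻¹ + -c * (μ * r ^ 2) := by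
        unfold alphaSym
        have h6 : c ≠ 0 := hc.ne
        field_simp
        ring
      rw [this]
      have : 0 ≤ (-c)⁻¹ + -c * (μ * r ^ 2) := by positivity
      linarith
    refine e.trans (mul_le_mul_of_nonneg_right ?_ (hα r))
    unfold compConst
    linarith
  · have e : alphaSym c γ μ r ≤ (1 - c) * (1 + μ * r ^ 2) := by
      unfold alphaSym
      have hq : 0 ≤ μ * r ^ 2 := by positivity
      have h7 : 0 ≤ -c * (μ * r ^ 2) := by positivity
      have h8 : (1 - γ) * (1 - c * μ * r ^ 2) ≤ 1 * (1 - c * μ * r ^ 2) :=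
        mul_le_mul_of_nonneg_right (by linarith) (by linarith)
      linarith
    refine e.trans (mul_le_mul_of_nonneg_right ?_ (by positivity))
    unfold compConst
    linarith

/-- With x = √μ r coth(√μ₂ r)/γ one has γβ = 1 - x + x² - aμr². The negative term is absorbed by 2(1
- x + x²) ≥ 1 + x², and x² ≥ μr² because coth ≥ 1 and γ < 1. The upper bound uses r coth(√μ₂ r) ≤ r
+ μ₂^(-1/2), where μ₂ ≥ 1/L and μ ≤ 1 control the last term. -/
theorem comparable_betaSym (ha : a ≤ 0) (hc : c < 0) (hγ₀ : 0 < γ) (hγ₁ : γ < 1) (hL : 1 ≤ L)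
    (hμ : 0 < μ) (hμ₁ : μ ≤ 1) (hμ₂ : L⁻¹ ≤ μ₂) :
    Comparable μ (compConst a c γ L) (betaSym a γ μ μ₂) := by
  obtain ⟨h1, h2, h3⟩ := compConst_summands_pos ha hc hγ₀ hγ₁ hL
  have hμ₂' : 0 < μ₂ := lt_of_lt_of_le (by positivity) hμ₂
  have key : ∀ r, betaSym a γ μ μ₂ r = γ⁻¹ * (1 - √μ * cothSymbol μ₂ r / γ
      + (√μ * cothSymbol μ₂ r / γ) ^ 2 + -a * (μ * r ^ 2)) := fun r => by
    rw [betaSym, div_pow, mul_pow, Real.sq_sqrt hμ.le]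
    field_simp
    ring
  have hx : ∀ r, (√μ * cothSymbol μ₂ r / γ) ^ 2 = μ * cothSymbol μ₂ r ^ 2 / γ ^ 2 := fun r => by
    rw [div_pow, mul_pow, Real.sq_sqrt hμ.le]
  have hlow : ∀ r, 0 ≤ r → 1 + μ * r ^ 2 ≤ 2 * betaSym a γ μ μ₂ r := fun r hr => by
    have h4 : μ * r ^ 2 ≤ (√μ * cothSymbol μ₂ r / γ) ^ 2 := by
      rw [hx, le_div_iff₀ (by positivity)]
      have h5 := pow_le_pow_left₀ hr (le_cothSymbol hμ₂' hr) 2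
      have h6 : γ ^ 2 ≤ 1 := pow_le_one₀ hγ₀.le hγ₁.le
      calc μ * r ^ 2 * γ ^ 2 ≤ μ * r ^ 2 * 1 := by gcongr
        _ ≤ μ * cothSymbol μ₂ r ^ 2 := by rw [mul_one]; gcongr
    rw [key]
    set x := √μ * cothSymbol μ₂ r / γ
    have h7 : 1 ≤ γ⁻¹ := (one_le_inv₀ hγ₀).2 hγ₁.le
    have h8 : 0 ≤ -a * (μ * r ^ 2) := mul_nonneg (by linarith) (by positivity)
    have h9 : 1 + x ^ 2 ≤ 2 * (1 - x + x ^ 2 + -a * (μ * r ^ 2)) := by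
      nlinarith [sq_nonneg (1 - x)]
    have h10 : 0 ≤ 1 - x + x ^ 2 + -a * (μ * r ^ 2) := by nlinarith [sq_nonneg x]
    nlinarith [mul_le_mul_of_nonneg_right h7 h10]
  refine ⟨?_, fun r hr => (hlow r hr).trans (mul_le_mul_of_nonneg_right ?_ ?_), fun r hr => ?_⟩
  · have := measurable_cothSymbol μ₂
    unfold betaSym
    fun_prop
  · unfold compConst; linarith
  · have h4 : 0 ≤ 1 + μ * r ^ 2 := by positivity
    linarith [hlow r hr]
  · have h4 : cothSymbol μ₂ r ^ 2 ≤ 2 * r ^ 2 + 2 * L := by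
      have h5 := pow_le_pow_left₀ (hr.trans (le_cothSymbol hμ₂' hr)) (cothSymbol_le hμ₂' hr) 2
      have h6 : ((√μ₂)⁻¹) ^ 2 ≤ L := by
        rw [inv_pow, Real.sq_sqrt hμ₂'.le]
        exact inv_le_of_inv_le₀ (by linarith) hμ₂
      nlinarith [sq_nonneg (r - (√μ₂)⁻¹)]
    have hq : 0 ≤ μ * r ^ 2 := by positivity
    have h5 : (√μ * cothSymbol μ₂ r / γ) ^ 2 ≤ 2 * L / γ ^ 2 * (1 + μ * r ^ 2) := by
      rw [hx, div_mul_eq_mul_div]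
      refine div_le_div_of_nonneg_right ?_ (by positivity)
      have h6 := mul_le_mul_of_nonneg_left h4 hμ.le
      nlinarith [mul_le_mul_of_nonneg_right hμ₁ (show 0 ≤ L by linarith),
        mul_le_mul_of_nonneg_right hL hq]
    have e : betaSym a γ μ μ₂ r ≤ γ⁻¹ * (1 + 2 * L / γ ^ 2 - a) * (1 + μ * r ^ 2) := by
      rw [key, mul_assoc]
      refine mul_le_mul_of_nonneg_left ?_ (by positivity)
      have h6 : 0 ≤ √μ * cothSymbol μ₂ r / γ := by
        have := hr.trans (le_cothSymbol hμ₂' hr)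
        positivity
      nlinarith
    refine e.trans (mul_le_mul_of_nonneg_right ?_ (by positivity))
    unfold compConst
    linarith

theorem abs_jSym_le (hb : 0 < b) (hμ : 0 < μ) (r : ℝ) :
    |jSym b μ r| ≤ (1 + b⁻¹) * rho μ r ^ 2 := by
  rw [rho_sq hμ, jSym, abs_of_pos (by positivity), ← div_eq_mul_inv, inv_le_comm₀ (by positivity)
    (by positivity), inv_div, div_le_iff₀ (by positivity)]
  have e : (1 + b * μ * r ^ 2) * (1 + b⁻¹) = 1 + μ * r ^ 2 + (b⁻¹ + b * μ * r ^ 2) := by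
    field_simp
    ring
  rw [e]
  have : 0 ≤ b⁻¹ + b * μ * r ^ 2 := by positivity
  linarith

end Bounds

/-- The symbols of the Boussinesq-Full dispersion system. -/
def boussinesq {a b c γ L μ μ₂ : ℝ} (hb : 0 < b) (ha : a ≤ 0) (hc : c < 0) (hγ₀ : 0 < γ)
    (hγ₁ : γ < 1) (hL : 1 ≤ L) (hμ : 0 < μ) (hμ₁ : μ ≤ 1) (hμ₂ : L⁻¹ ≤ μ₂) : Dispersion where
  μ := μ
  m := compConst a c γ L
  B := 1 + b⁻¹
  α := alphaSym c γ μ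
  β := betaSym a γ μ μ₂
  j := jSym b μ
  μ_pos := hμ
  m_pos := compConst_pos ha hc hγ₀ hγ₁ hL
  α_comp := comparable_alphaSym ha hc hγ₀ hγ₁ hL hμ
  β_comp := comparable_betaSym ha hc hγ₀ hγ₁ hL hμ hμ₁ hμ₂
  j_meas := by unfold jSym; fun_prop
  j_le r _ := abs_jSym_le hb hμ r

/-! ### The system as an equation between distributions -/

/-- A radial symbol, without any boundedness. -/
def radSym (f : ℝ → ℝ) (ξ : Plane) : ℂ := (f (2 * Real.pi * ‖ξ‖) : ℂ)

theorem polyGrowth_radSym {f : ℝ → ℝ} (hf : Measurable f) {C : ℝ}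
    (h : ∀ r, 0 ≤ r → |f r| ≤ C * (1 + r ^ 2)) : PolyGrowth (radSym f) := by
  have hC : 0 ≤ C := by
    have := (abs_nonneg _).trans (h 0 le_rfl)
    simpa using this
  refine polyGrowth_of_le (C := C * (1 + (2 * Real.pi) ^ 2))
    (Complex.measurable_ofReal.comp (hf.comp (by fun_prop))) fun ξ => ?_
  rw [radSym, Complex.norm_real, mul_assoc C]
  refine (h _ (two_pi_norm_nonneg ξ)).trans (mul_le_mul_of_nonneg_left ?_ hC)
  nlinarith [sq_nonneg ‖ξ‖, sq_nonneg (2 * Real.pi)]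

theorem polyGrowth_sq : PolyGrowth (radSym fun r => r ^ 2) :=
  polyGrowth_radSym (by fun_prop) (C := 1) fun r _ => by
    rw [abs_of_nonneg (sq_nonneg r)]; linarith

theorem polyGrowth_coth {μ₂ : ℝ} (hμ₂ : 0 < μ₂) : PolyGrowth (radSym (cothSymbol μ₂)) := by
  refine polyGrowth_radSym (measurable_cothSymbol μ₂) (C := 1 + (√μ₂)⁻¹) fun r hr => ?_
  have h1 := cothSymbol_le hμ₂ hr
  have h2 : 0 < (√μ₂)⁻¹ := inv_pos.2 (Real.sqrt_pos.2 hμ₂)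
  rw [abs_of_nonneg (hr.trans (le_cothSymbol hμ₂ hr))]
  nlinarith [sq_nonneg (r - 1), mul_nonneg h2.le (sq_nonneg r)]

theorem polyGrowth_coth_sq {μ₂ : ℝ} (hμ₂ : 0 < μ₂) :
    PolyGrowth (radSym fun r => cothSymbol μ₂ r ^ 2) := by
  have h := (polyGrowth_coth hμ₂).mul (polyGrowth_coth hμ₂)
  have e : (radSym fun r => cothSymbol μ₂ r ^ 2)
      = fun ξ => radSym (cothSymbol μ₂) ξ * radSym (cothSymbol μ₂) ξ := by
    ext ξ
    simp only [radSym]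
    push_cast; ring
  rwa [e]

/-- The symbol of `1 - bμΔ`. -/
def massSym (b μ : ℝ) : Plane → ℂ := radSym fun r => 1 + b * μ * r ^ 2

theorem polyGrowth_massSym (b μ : ℝ) : PolyGrowth (massSym b μ) := by
  refine polyGrowth_radSym (by fun_prop) (C := 1 + |b * μ|) fun r _ => ?_
  refine (abs_add_le _ _).trans ?_
  rw [abs_one, abs_mul, abs_of_nonneg (sq_nonneg r)]
  nlinarith [sq_nonneg r, abs_nonneg (b * μ)]

theorem continuous_massSym (b μ : ℝ) : Continuous (massSym b μ) := by
  unfold massSym radSym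
  fun_prop

theorem massSym_ne_zero {b μ : ℝ} (hb : 0 < b) (hμ : 0 < μ) (ξ : Plane) : massSym b μ ξ ≠ 0 := by
  unfold massSym radSym
  rw [Complex.ofReal_ne_zero]
  positivity

theorem dist_smul_apply (r : ℝ) (T : Dist) (φ : 𝓢(Plane, ℂ)) : (r • T) φ = r * T φ :=
  Complex.real_smul

theorem mass_operator (b μ : ℝ) (u : L2) (φ : 𝓢(Plane, ℂ)) :
    (ofFun u - (b * μ) • dLap (ofFun u)) φ = symbDist (massSym b μ) u φ := by
  have e : massSym b μ = fun ξ =>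
      1 + (-(b * μ) : ℂ) * (-((2 * Real.pi * ‖ξ‖ : ℝ) : ℂ) ^ 2 * 1) := by
    ext ξ
    simp only [massSym, radSym]
    push_cast; ring
  have hp : PolyGrowth fun ξ : Plane => -((2 * Real.pi * ‖ξ‖ : ℝ) : ℂ) ^ 2 * 1 := by
    have := (polyGrowth_const (-1)).mul polyGrowth_sq
    simpa [radSym] using this
  rw [e, Pi.sub_apply, dist_smul_apply, ofFun_eq_symbDist, dLap_symbDist,
    symbDist_symb_add (polyGrowth_const 1) ((polyGrowth_const _).mul hp), symbDist_symb_smul]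
  push_cast
  ring

theorem ofFun_congr {f g : Plane → ℝ} (h : f =ᵐ[volume] g) : ofFun f = ofFun g := by
  ext φ
  refine integral_congr_ae ?_
  filter_upwards [h] with x hx
  rw [hx]

theorem dDiv_apply (T : Fin 2 → Dist) (φ : 𝓢(Plane, ℂ)) :
    dDiv T φ = dPartial 0 (T 0) φ + dPartial 1 (T 1) φ := by
  rw [dDiv, Fin.sum_univ_two]; rfl

theorem dPartial_ofFun (k : Fin 2) (u : L2) : dPartial k (ofFun u) = symbDist (dSym k) u := by
  rw [ofFun_eq_symbDist, dPartial_symbDist]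
  simp only [mul_one]

theorem dLap_dPartial_ofFun (k : Fin 2) (u : L2) (φ : 𝓢(Plane, ℂ)) :
    dLap (dPartial k (ofFun u)) φ
      = -symbDist (fun ξ => dSym k ξ * radSym (fun r => r ^ 2) ξ) u φ := by
  rw [dPartial_ofFun, dLap_symbDist, ← neg_one_mul, ← symbDist_symb_smul]
  congr 1
  ext ξ
  simp only [radSym]
  push_cast; ring

theorem dPartial_radialMultiplier (k : Fin 2) (f : ℝ → ℝ) (u : L2) :
    dPartial k (radialMultiplier f u) = symbDist (fun ξ => dSym k ξ * radSym f ξ) u :=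
  dPartial_symbDist k (radSym f) u

theorem symbDist_beta {a γ μ μ₂ : ℝ} (hμ₂ : 0 < μ₂) (k : Fin 2) (u : L2) (φ : 𝓢(Plane, ℂ)) :
    symbDist (fun ξ => dSym k ξ * radSym (betaSym a γ μ μ₂) ξ) u φ
      = 1 / γ * symbDist (dSym k) u φ
        - √μ / γ ^ 2 * symbDist (fun ξ => dSym k ξ * radSym (cothSymbol μ₂) ξ) u φ
        + μ / γ * (-a * symbDist (fun ξ => dSym k ξ * radSym (fun r => r ^ 2) ξ) u φ
          + 1 / γ ^ 2 * symbDist (fun ξ => dSym k ξ * radSym (fun r => cothSymbol μ₂ r ^ 2) ξ)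
            u φ) := by
  have hd := polyGrowth_dSym k
  have e : (fun ξ => dSym k ξ * radSym (betaSym a γ μ μ₂) ξ) = fun ξ =>
      ((1 / γ : ℂ) * dSym k ξ + (-(√μ / γ ^ 2) : ℂ) * (dSym k ξ * radSym (cothSymbol μ₂) ξ))
      + ((-(μ / γ * a) : ℂ) * (dSym k ξ * radSym (fun r => r ^ 2) ξ)
        + (μ / γ * (1 / γ ^ 2) : ℂ) * (dSym k ξ * radSym (fun r => cothSymbol μ₂ r ^ 2) ξ)) := by
    ext ξ
    simp only [radSym, betaSym]
    push_cast; ring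
  have h1 := (polyGrowth_const (1 / γ : ℂ)).mul hd
  have h2 := (polyGrowth_const (-(√μ / γ ^ 2) : ℂ)).mul (hd.mul (polyGrowth_coth hμ₂))
  have h3 := (polyGrowth_const (-(μ / γ * a) : ℂ)).mul (hd.mul polyGrowth_sq)
  have h4 := (polyGrowth_const (μ / γ * (1 / γ ^ 2) : ℂ)).mul (hd.mul (polyGrowth_coth_sq hμ₂))
  rw [e, symbDist_symb_add (h1.add h2) (h3.add h4), symbDist_symb_add h1 h2,
    symbDist_symb_add h3 h4, symbDist_symb_smul, symbDist_symb_smul, symbDist_symb_smul,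
    symbDist_symb_smul]
  ring

theorem symbDist_alpha {c γ μ : ℝ} (k : Fin 2) (u : L2) (φ : 𝓢(Plane, ℂ)) :
    symbDist (fun ξ => dSym k ξ * radSym (alphaSym c γ μ) ξ) u φ
      = (1 - γ) * symbDist (dSym k) u φ
        - c * μ * (1 - γ) * symbDist (fun ξ => dSym k ξ * radSym (fun r => r ^ 2) ξ) u φ := by
  have hd := polyGrowth_dSym k
  have e : (fun ξ => dSym k ξ * radSym (alphaSym c γ μ) ξ) = fun ξ =>
      (1 - γ : ℂ) * dSym k ξ
        + (-(c * μ * (1 - γ)) : ℂ) * (dSym k ξ * radSym (fun r => r ^ 2) ξ) := by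
    ext ξ
    simp only [radSym, alphaSym]
    push_cast; ring
  rw [e, symbDist_symb_add ((polyGrowth_const _).mul hd)
    ((polyGrowth_const _).mul (hd.mul polyGrowth_sq)), symbDist_symb_smul, symbDist_symb_smul]
  ring

/-! ### The terms of the system in the variables f -/

section Terms

variable {μ : ℝ} (hμ : 0 < μ)

/-- The velocity components of a state. -/
def vel (f : State) (k : Fin 2) : L2 := smooth hμ (f k.succ)

theorem dPartial_flux (ε : ℝ) (f : State) (k : Fin 2) (φ : 𝓢(Plane, ℂ)) :
    dPartial k (ofFun fun x => (1 - ε * smooth hμ (f 0) x) * vel hμ f k x) φ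
      = symbDist (dSym k) (vel hμ f k) φ
        - ε * symbDist (dSym k) (prodX hμ (f 0) (f k.succ)) φ := by
  have h : (fun x => (1 - ε * smooth hμ (f 0) x) * vel hμ f k x)
      =ᵐ[volume] (vel hμ f k + (-ε) • prodX hμ (f 0) (f k.succ) : L2) := by
    filter_upwards [Lp.coeFn_add (vel hμ f k) ((-ε) • prodX hμ (f 0) (f k.succ)),
      Lp.coeFn_smul (-ε) (prodX hμ (f 0) (f k.succ)), prodX_coe hμ (f 0) (f k.succ)]
      with x h1 h2 h3
    rw [h1, Pi.add_apply, h2, Pi.smul_apply, h3, smul_eq_mul, vel]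
    ring
  rw [ofFun_congr h, dPartial_ofFun, symbDist_add (polyGrowth_dSym k), symbDist_smul]
  push_cast; ring

theorem massTerms_eq {a γ ε μ₂ : ℝ} (hμ₂ : 0 < μ₂) (f : State) (φ : 𝓢(Plane, ℂ)) :
    massTerms a γ ε μ μ₂ (smooth hμ (f 0)) (vel hμ f) φ
      = ∑ k : Fin 2, (symbDist (fun ξ => dSym k ξ * radSym (betaSym a γ μ μ₂) ξ) (vel hμ f k) φ
        - ε / γ * symbDist (dSym k) (prodX hμ (f 0) (f k.succ)) φ) := by
  have hL : ∀ T : Fin 2 → Dist, dLap (dDiv T) φ = dLap (dPartial 0 (T 0)) φ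
      + dLap (dPartial 1 (T 1)) φ := fun T => dDiv_apply T (Δ φ)
  rw [massTerms, Pi.add_apply, Pi.sub_apply, dist_smul_apply, dist_smul_apply, dist_smul_apply,
    Pi.add_apply, dist_smul_apply, dist_smul_apply, hL, dDiv_apply, dDiv_apply, dDiv_apply,
    dPartial_flux, dPartial_flux, dPartial_radialMultiplier, dPartial_radialMultiplier,
    dPartial_radialMultiplier, dPartial_radialMultiplier, dLap_dPartial_ofFun,
    dLap_dPartial_ofFun, Fin.sum_univ_two, symbDist_beta hμ₂, symbDist_beta hμ₂]
  push_cast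
  ring

theorem momentumTerms_eq {c γ ε : ℝ} (f : State) (k : Fin 2) (φ : 𝓢(Plane, ℂ)) :
    momentumTerms c γ ε μ (smooth hμ (f 0)) (vel hμ f) k φ
      = symbDist (fun ξ => dSym k ξ * radSym (alphaSym c γ μ) ξ) (smooth hμ (f 0)) φ
        - ε / (2 * γ) * symbDist (dSym k) (bilX hμ f f 0) φ := by
  have h : (fun x => ∑ j, vel hμ f j x ^ 2) =ᵐ[volume] bilX hμ f f 0 := by
    rw [bilX_zero]
    filter_upwards [Lp.coeFn_add (prodX hμ (f 1) (f 1)) (prodX hμ (f 2) (f 2)),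
      prodX_coe hμ (f 1) (f 1), prodX_coe hμ (f 2) (f 2)] with x h1 h2 h3
    rw [h1, Pi.add_apply, h2, h3, Fin.sum_univ_two, pow_two, pow_two]
    rfl
  rw [momentumTerms, Pi.add_apply, Pi.sub_apply, dist_smul_apply, dist_smul_apply,
    dist_smul_apply, ofFun_congr h, dLap_dPartial_ofFun, dPartial_ofFun, dPartial_ofFun,
    symbDist_alpha]
  push_cast
  ring

end Terms

theorem opMat_offd_zero {f g : ℝ → ℝ} (hf : VecGood f) (hg : VecGood g) (y : State) :
    opMat (offd f g hf hg) y 0 = mult (vec 0 f hf) (y 1) + mult (vec 1 f hf) (y 2) := by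
  rw [opMat_apply]
  simp [offd]

theorem opMat_offd_succ {f g : ℝ → ℝ} (hf : VecGood f) (hg : VecGood g) (y : State) (k : Fin 2) :
    opMat (offd f g hf hg) y k.succ = mult (vec k g hg) (y 0) := by
  rw [opMat_apply]
  fin_cases k <;> simp [offd]

/-! ### Inverting 1 - bμΔ -/

section MassSym

variable {b μ : ℝ} (hb : 0 < b) (hμ : 0 < μ)

theorem massSym_mul_jSym (hb : 0 < b) (hμ : 0 < μ) (ξ : Plane) :
    massSym b μ ξ * radSym (jSym b μ) ξ = 1 := by
  have h : (1 + b * μ * (2 * Real.pi * ‖ξ‖) ^ 2) * jSym b μ (2 * Real.pi * ‖ξ‖) = 1 :=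
    mul_inv_cancel₀ (by positivity)
  rw [massSym, radSym, radSym, ← Complex.ofReal_mul, h, Complex.ofReal_one]

include hb hμ

theorem symbDist_massSym_vec (k : Fin 2) (h : VecGood (jSym b μ)) (u : L2) :
    symbDist (massSym b μ) (mult (vec k _ h) u) = symbDist (dSym k) u := by
  rw [symbDist_mult]
  congr 1
  ext ξ
  have := massSym_mul_jSym hb hμ ξ
  rw [vec_apply]
  change _ * (_ * radSym (jSym b μ) ξ) = _
  linear_combination dSym k ξ * this

theorem symbDist_massSym_vec_rho (k : Fin 2) {f : ℝ → ℝ}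
    (h : VecGood fun r => jSym b μ r * (f r * rho μ r)) (u : L2) :
    symbDist (massSym b μ) (mult (vec k _ h) u)
      = symbDist (fun ξ => dSym k ξ * radSym f ξ) (smooth hμ u) := by
  rw [symbDist_mult, smooth, symbDist_mult]
  congr 1
  ext ξ
  have := massSym_mul_jSym hb hμ ξ
  rw [vec_apply, rad_apply]
  simp only [radSym] at this ⊢
  push_cast
  linear_combination
    dSym k ξ * (f (2 * Real.pi * ‖ξ‖) : ℂ) * (rho μ (2 * Real.pi * ‖ξ‖) : ℂ) * this

end MassSym

/-! ### Equivalence of the distributional system with the flow -/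

section Weak

variable {a b c γ L μ μ₂ : ℝ} (hb : 0 < b) (ha : a ≤ 0) (hc : c < 0) (hγ₀ : 0 < γ)
    (hγ₁ : γ < 1) (hL : 1 ≤ L) (hμ : 0 < μ) (hμ₁ : μ ≤ 1) (hμ₂ : L⁻¹ ≤ μ₂)

theorem symbDist_rhs_zero (ε : ℝ) (f : State) (φ : 𝓢(Plane, ℂ)) :
    symbDist (massSym b μ)
      ((boussinesq hb ha hc hγ₀ hγ₁ hL hμ hμ₁ hμ₂).rhs (ε / (2 * γ)) f 0) φ
      = -massTerms a γ ε μ μ₂ (smooth hμ (f 0)) (vel hμ f) φ := by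
  have hμ₂' : 0 < μ₂ := lt_of_lt_of_le (by positivity) hμ₂
  have hp := polyGrowth_massSym b μ
  have hd := fun k => polyGrowth_dSym k
  rw [massTerms_eq hμ hμ₂', Fin.sum_univ_two, Dispersion.rhs, PiLp.sub_apply, Dispersion.nl,
    Dispersion.lin, opMat_offd_zero, opMat_offd_zero, ← symbDistCLM_apply hp, map_sub, map_add,
    map_add]
  simp only [symbDistCLM_apply]
  have e1 : ∀ (k : Fin 2) h u, symbDist (massSym b μ) (mult (vec k
      (boussinesq hb ha hc hγ₀ hγ₁ hL hμ hμ₁ hμ₂).j h) u) φ = symbDist (dSym k) u φ :=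
    fun k h u => congrFun (symbDist_massSym_vec hb hμ k h u) φ
  have e2 : ∀ (k : Fin 2) h u, symbDist (massSym b μ) (mult (vec k (fun r =>
      (boussinesq hb ha hc hγ₀ hγ₁ hL hμ hμ₁ hμ₂).j r
      * ((boussinesq hb ha hc hγ₀ hγ₁ hL hμ hμ₁ hμ₂).β r
      * rho (boussinesq hb ha hc hγ₀ hγ₁ hL hμ hμ₁ hμ₂).μ r)) h) u) φ
      = symbDist (fun ξ => dSym k ξ * radSym (betaSym a γ μ μ₂) ξ) (smooth hμ u) φ :=
    fun k h u => congrFun (symbDist_massSym_vec_rho hb hμ k h u) φ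
  -- This 2 turns κ = ε/(2γ) into the coefficient ε/γ of ∇·(ζv), while |v|² keeps ε/(2γ): one κ
  -- serves both equations.
  have e3 : ∀ k : Fin 2, bilX hμ f f k.succ = (2 : ℝ) • prodX hμ (f 0) (f k.succ) := fun k => by
    rw [two_smul]
    fin_cases k <;> rfl
  have e4 : ∀ k : Fin 2, symbDist (dSym k) (((ε / (2 * γ)) • bilX hμ f f) k.succ) φ
      = ε / γ * symbDist (dSym k) (prodX hμ (f 0) (f k.succ)) φ := fun k => by
    rw [PiLp.smul_apply, e3, smul_smul, symbDist_smul]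
    congr 1
    push_cast
    have : (γ : ℂ) ≠ 0 := Complex.ofReal_ne_zero.2 hγ₀.ne'
    field_simp
  rw [e1, e1, e2, e2]
  have e40 := e4 0
  have e41 := e4 1
  change symbDist (dSym 0) (((ε / (2 * γ)) • bilX hμ f f) 1) φ = _ at e40
  change symbDist (dSym 1) (((ε / (2 * γ)) • bilX hμ f f) 2) φ = _ at e41
  change symbDist (dSym 0) (((ε / (2 * γ)) • bilX hμ f f) 1) φ
    + symbDist (dSym 1) (((ε / (2 * γ)) • bilX hμ f f) 2) φ
    - (symbDist _ (vel hμ f 0) φ + symbDist _ (vel hμ f 1) φ) = _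
  rw [e40, e41]
  ring

theorem symbDist_rhs_succ (ε : ℝ) (f : State) (k : Fin 2) (φ : 𝓢(Plane, ℂ)) :
    symbDist (massSym b μ)
      ((boussinesq hb ha hc hγ₀ hγ₁ hL hμ hμ₁ hμ₂).rhs (ε / (2 * γ)) f k.succ) φ
      = -momentumTerms c γ ε μ (smooth hμ (f 0)) (vel hμ f) k φ := by
  have hp := polyGrowth_massSym b μ
  rw [momentumTerms_eq hμ, Dispersion.rhs, PiLp.sub_apply, Dispersion.nl,
    Dispersion.lin, opMat_offd_succ, opMat_offd_succ, ← symbDistCLM_apply hp, map_sub]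
  simp only [symbDistCLM_apply]
  have e1 : ∀ h u, symbDist (massSym b μ) (mult (vec k
      (boussinesq hb ha hc hγ₀ hγ₁ hL hμ hμ₁ hμ₂).j h) u) φ = symbDist (dSym k) u φ :=
    fun h u => congrFun (symbDist_massSym_vec hb hμ k h u) φ
  have e2 : ∀ h u, symbDist (massSym b μ) (mult (vec k (fun r =>
      (boussinesq hb ha hc hγ₀ hγ₁ hL hμ hμ₁ hμ₂).j r
      * ((boussinesq hb ha hc hγ₀ hγ₁ hL hμ hμ₁ hμ₂).α r
      * rho (boussinesq hb ha hc hγ₀ hγ₁ hL hμ hμ₁ hμ₂).μ r)) h) u) φ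
      = symbDist (fun ξ => dSym k ξ * radSym (alphaSym c γ μ) ξ) (smooth hμ u) φ :=
    fun h u => congrFun (symbDist_massSym_vec_rho hb hμ k h u) φ
  rw [e1, e2, PiLp.smul_apply, symbDist_smul]
  push_cast
  change ε / (2 * γ) * symbDist (dSym k) (bilX hμ f f 0) φ - _ = _
  ring

/-- A weakly differentiable curve in `L²` is differentiable. -/
theorem hasDerivWithinAt_of_symbDist {m : Plane → ℂ} (hp : PolyGrowth m) (hm : Continuous m)
    (hm0 : ∀ ξ, m ξ ≠ 0) {u g : ℝ → L2} (hg : ContinuousOn g (Ici 0))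
    (h : ∀ t, 0 ≤ t → ∀ φ, HasDerivWithinAt (fun s => symbDist m (u s) φ) (symbDist m (g t) φ)
      (Ici 0) t) {t : ℝ} (ht : 0 ≤ t) : HasDerivWithinAt u (g t) (Ici 0) t := by
  set g' : ℝ → L2 := fun s => g (max 0 s) with hg'
  have hgc : Continuous g' := hg.comp_continuous (by fun_prop) fun s => le_max_left 0 s
  set v : ℝ → L2 := fun t => u 0 + ∫ s in (0 : ℝ)..t, g' s with hv
  have hvd : ∀ t, 0 ≤ t → HasDerivWithinAt v (g t) (Ici 0) t := fun t ht => by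
    have e : g' t = g t := by rw [hg']; simp only [max_eq_right ht]
    rw [← e]
    exact ((intervalIntegral.integral_hasDerivAt_right (hgc.intervalIntegrable _ _)
      (hgc.stronglyMeasurableAtFilter _ _) hgc.continuousAt).const_add _).hasDerivWithinAt
  -- Paired with any test function, u and the primitive v of g have the same derivative and initial
  -- value; m has no zeros, so they coincide in L².
  have huv : ∀ t, 0 ≤ t → u t = v t := fun t ht => by
    refine eq_of_symbDist_eq hm hm0 (funext fun φ => ?_) hp
    have hd : ∀ s, 0 ≤ s → HasDerivWithinAt (fun s => symbDist m (u s) φ - symbDist m (v s) φ) 0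
        (Ici 0) s := fun s hs => by
      have h1 := (h s hs φ).sub
        ((symbDistCLM hp φ).hasFDerivAt.comp_hasDerivWithinAt s (hvd s hs))
      rw [symbDistCLM_apply, sub_self] at h1
      exact h1
    have h2 := constant_of_has_deriv_right_zero (a := 0) (b := t)
      (fun s hs => ((hd s hs.1).continuousWithinAt).mono Icc_subset_Ici_self)
      (fun s hs => (hd s hs.1).mono (Ici_subset_Ici.2 hs.1)) t ⟨ht, le_rfl⟩
    have h3 : v 0 = u 0 := by simp [hv]
    rw [h3, sub_self, sub_eq_zero] at h2
    exact h2
  exact (hvd t ht).congr (fun s hs => huv s hs) (huv t ht)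

theorem contInX_smooth {f : ℝ → L2} (hf : ContinuousOn f (Ici 0)) :
    ContInX μ fun t => smooth hμ (f t) := by
  refine ⟨fun t _ => memH1_smooth hμ _, fun t ht => ?_⟩
  simp only [← map_sub, normX_smooth]
  exact tendsto_iff_norm_sub_tendsto_zero.1 (hf t ht)

theorem continuousOn_of_contInX {f : ℝ → L2} (hf : ContInX μ fun t => smooth hμ (f t)) :
    ContinuousOn f (Ici 0) := fun t ht => by
  have h := hf.2 t ht
  simp only [← map_sub, normX_smooth] at h
  exact tendsto_iff_norm_sub_tendsto_zero.2 h

theorem isSolution_of_isFlow {ε : ℝ} {f : ℝ → State}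
    (hf : (boussinesq hb ha hc hγ₀ hγ₁ hL hμ hμ₁ hμ₂).IsFlow (ε / (2 * γ)) f (Ici 0)) :
    IsSolution a b c b γ ε μ μ₂ (smooth hμ (f 0 0)) (vel hμ (f 0))
      (fun t => smooth hμ (f t 0)) (fun t => vel hμ (f t)) := by
  have hfc : ∀ i, ContinuousOn (fun t => f t i) (Ici 0) := fun i =>
    (continuous_state_apply i).comp_continuousOn hf.cont
  have hd : ∀ i, ∀ t, 0 ≤ t → ∀ φ, HasDerivWithinAt
      (fun s => (ofFun (smooth hμ (f s i)) - (b * μ) • dLap (ofFun (smooth hμ (f s i)))) φ)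
      (symbDist (massSym b μ)
        ((boussinesq hb ha hc hγ₀ hγ₁ hL hμ hμ₁ hμ₂).rhs (ε / (2 * γ)) (f t) i) φ) (Ici 0) t :=
    fun i t ht φ => by
    have h1 := hasDerivWithinAt_state_apply (hf.deriv t ht) i
    simp only [Dispersion.group_R, opMat_smul_one] at h1
    have h2 := (symbDistCLM (polyGrowth_massSym b μ) φ).hasFDerivAt.comp_hasDerivWithinAt t h1
    simp only [mass_operator]
    exact h2
  refine ⟨contInX_smooth hμ (hfc 0), fun i => contInX_smooth hμ (hfc i.succ), rfl, rfl,
    fun t ht φ => ?_, fun i t ht φ => ?_⟩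
  · rw [← symbDist_rhs_zero hb ha hc hγ₀ hγ₁ hL hμ hμ₁ hμ₂]
    exact hd 0 t ht φ
  · rw [← symbDist_rhs_succ hb ha hc hγ₀ hγ₁ hL hμ hμ₁ hμ₂]
    exact hd i.succ t ht φ

/-- Uniqueness concerns all distributional solutions, so each must be shown to be a flow. Continuity
in X⁰_μ makes the right-hand side continuous in L², and `hasDerivWithinAt_of_symbDist` then upgrades
the tested equations to a derivative in L². -/
theorem exists_isFlow_of_isSolution {ε : ℝ} {ζ₀ : L2} {v₀ : Fin 2 → L2} {ζ : ℝ → L2}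
    {v : ℝ → Fin 2 → L2} (h : IsSolution a b c b γ ε μ μ₂ ζ₀ v₀ ζ v) :
    ∃ f : ℝ → State,
      (boussinesq hb ha hc hγ₀ hγ₁ hL hμ hμ₁ hμ₂).IsFlow (ε / (2 * γ)) f (Ici 0) ∧
      ∀ t, 0 ≤ t → smooth hμ (f t 0) = ζ t ∧ vel hμ (f t) = v t := by
  have hex : ∀ {u : ℝ → L2}, ContInX μ u → ∃ g : ℝ → L2, ContinuousOn g (Ici 0) ∧
      ∀ t, 0 ≤ t → smooth hμ (g t) = u t := fun {u} hu => by
    choose! g hg using fun t (ht : (0 : ℝ) ≤ t) => exists_smooth_eq hμ (hu.1 t ht)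
    refine ⟨g, continuousOn_of_contInX hμ ⟨fun t _ => memH1_smooth hμ _, fun t ht => ?_⟩, hg⟩
    refine (hu.2 t ht).congr' ?_
    filter_upwards [self_mem_nhdsWithin] with s hs
    rw [hg s hs, hg t ht]
  obtain ⟨g₀, hg₀, hgζ⟩ := hex h.cont_ζ
  choose g hgc hgv using fun i => hex (h.cont_v i)
  set f : ℝ → State := fun t => WithLp.toLp 2 ![g₀ t, g 0 t, g 1 t] with hf
  have hvel : ∀ t, 0 ≤ t → vel hμ (f t) = v t := fun t ht => by
    ext1 k
    rw [← hgv k t ht, vel]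
    fin_cases k <;> rfl
  have hfc : ContinuousOn f (Ici 0) := continuousOn_state fun i => by
    fin_cases i
    · exact hg₀
    · exact hgc 0
    · exact hgc 1
  refine ⟨f, ⟨hfc, fun t ht => hasDerivWithinAt_state fun i => ?_⟩,
    fun t ht => ⟨hgζ t ht, hvel t ht⟩⟩
  simp only [Dispersion.group_R, opMat_smul_one]
  refine hasDerivWithinAt_of_symbDist (polyGrowth_massSym b μ) (continuous_massSym b μ)
    (massSym_ne_zero hb hμ) (g := fun t =>
      (boussinesq hb ha hc hγ₀ hγ₁ hL hμ hμ₁ hμ₂).rhs (ε / (2 * γ)) (f t) i)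
    ((continuous_state_apply i).comp_continuousOn
      ((Dispersion.continuous_rhs _ _).comp_continuousOn hfc)) (fun t ht φ => ?_) ht
  refine Fin.cases ?_ (fun k => ?_) i
  · rw [symbDist_rhs_zero]
    have h1 := h.mass t ht φ
    rw [← hvel t ht, ← hgζ t ht] at h1
    refine h1.congr (fun s hs => ?_) ?_
    · rw [mass_operator, ← hgζ s hs]; rfl
    · rw [mass_operator, ← hgζ t ht]; rfl
  · rw [symbDist_rhs_succ]
    have h1 := h.momentum k t ht φ
    rw [← hvel t ht, ← hgζ t ht] at h1
    refine h1.congr (fun s hs => ?_) ?_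
    · rw [mass_operator, ← hvel s hs]; rfl
    · rw [mass_operator, ← hvel t ht]; rfl

end Weak

/-! ### Comparison of norms and the smallness condition -/

theorem normX_add_normXVec_vel {μ : ℝ} (hμ : 0 < μ) (f : State) :
    normX μ (smooth hμ (f 0)) + normXVec μ (vel hμ f) = ‖f 0‖ + √(‖f 1‖ ^ 2 + ‖f 2‖ ^ 2) := by
  rw [normXVec, Fin.sum_univ_two, vel, vel, normX_smooth, normX_smooth, normX_smooth]
  rfl

theorem norm_le_normX_add {μ : ℝ} (hμ : 0 < μ) (f : State) :
    ‖f‖ ≤ normX μ (smooth hμ (f 0)) + normXVec μ (vel hμ f) := by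
  rw [normX_add_normXVec_vel]
  refine (sq_le_sq₀ (norm_nonneg _) (by positivity)).1 ?_
  have h1 := Real.sq_sqrt (show 0 ≤ ‖f 1‖ ^ 2 + ‖f 2‖ ^ 2 by positivity)
  rw [norm_state_sq]
  nlinarith [mul_nonneg (norm_nonneg (f 0)) (Real.sqrt_nonneg (‖f 1‖ ^ 2 + ‖f 2‖ ^ 2))]

theorem normX_add_le {μ : ℝ} (hμ : 0 < μ) (f : State) :
    normX μ (smooth hμ (f 0)) + normXVec μ (vel hμ f) ≤ 2 * ‖f‖ := by
  rw [normX_add_normXVec_vel, two_mul]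
  refine add_le_add (PiLp.norm_apply_le f 0) (Real.sqrt_le_iff.2 ⟨norm_nonneg _, ?_⟩)
  rw [norm_state_sq]
  nlinarith [sq_nonneg ‖f 0‖]

theorem state_eq_of_smooth {μ : ℝ} (hμ : 0 < μ) {f g : State}
    (h0 : smooth hμ (f 0) = smooth hμ (g 0)) (hv : vel hμ f = vel hμ g) : f = g :=
  state_ext (smooth_injective hμ h0) (smooth_injective hμ (congrFun hv 0))
    (smooth_injective hμ (congrFun hv 1))

/-- The size of the nonlinearity is controlled by `ε / √μ`. -/
theorem div_sqrt_le {ε ε₀ μ K Q : ℝ} (hK : 0 < K) (hQ : 0 ≤ Q) (hε : 0 < ε) (hμ : 0 < μ)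
    (hε₀ : ε₀ = (K * (1 + 8 * Q) ^ 2)⁻¹) (h : ε ≤ ε₀) (hεμ : ε ≤ K * μ) :
    ε * (√μ)⁻¹ * Q ≤ 1 / 8 := by
  have h1 : ε * (√μ)⁻¹ ≤ (1 + 8 * Q)⁻¹ := by
    -- After squaring, ε²/μ = ε · (ε/μ) ≤ ε₀K, which the choice of ε₀ makes equal to (1 + 8Q)⁻².
    refine (sq_le_sq₀ (by positivity) (by positivity)).1 ?_
    rw [mul_pow, inv_pow, Real.sq_sqrt hμ.le, ← div_eq_mul_inv, div_le_iff₀ hμ]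
    calc ε ^ 2 = ε * ε := pow_two ε
      _ ≤ ε₀ * (K * μ) := mul_le_mul h hεμ hε.le (hε.le.trans h)
      _ = (1 + 8 * Q)⁻¹ ^ 2 * μ := by rw [hε₀]; field_simp
  refine (mul_le_mul_of_nonneg_right h1 hQ).trans ?_
  rw [inv_mul_le_iff₀ (by positivity)]
  linarith

end BoussinesqFD

end

/-! ### Global well-posedness -/

theorem theorem1p2 (a b c d γ L : ℝ) (hbd : b = d) (hb : 0 < b) (ha : a ≤ 0) (hc : c < 0)
    (hγ₀ : 0 < γ) (hγ₁ : γ < 1) (hL : 1 ≤ L) :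
    ∃ C : ℝ, 0 < C ∧ ∀ K : ℝ, 1 ≤ K → ∀ M : ℝ, 0 ≤ M → ∃ ε₀ : ℝ, 0 < ε₀ ∧
      ∀ ε μ μ₂ : ℝ, 0 < ε → ε ≤ ε₀ → 0 < μ → ε ≤ K * μ → μ ≤ K * ε → L⁻¹ ≤ μ₂ → μ₂ ≤ L →
      ∀ (ζ₀ : BoussinesqFD.L2) (v₀ : Fin 2 → BoussinesqFD.L2),
        BoussinesqFD.MemH1 ζ₀ → (∀ i, BoussinesqFD.MemH1 (v₀ i)) →
        BoussinesqFD.normX μ ζ₀ + BoussinesqFD.normXVec μ v₀ ≤ M →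
        ∃ (ζ : ℝ → BoussinesqFD.L2) (v : ℝ → Fin 2 → BoussinesqFD.L2),
          BoussinesqFD.IsSolution a b c d γ ε μ μ₂ ζ₀ v₀ ζ v ∧
          (∀ (ζ' : ℝ → BoussinesqFD.L2) (v' : ℝ → Fin 2 → BoussinesqFD.L2),
            BoussinesqFD.IsSolution a b c d γ ε μ μ₂ ζ₀ v₀ ζ' v' →
            ∀ t, 0 ≤ t → ζ' t = ζ t ∧ v' t = v t) ∧
          ∀ t, 0 ≤ t → BoussinesqFD.normX μ (ζ t) + BoussinesqFD.normXVec μ (v t) ≤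
            C * (BoussinesqFD.normX μ ζ₀ + BoussinesqFD.normXVec μ v₀) := by
  subst hbd
  have hm := BoussinesqFD.compConst_pos ha hc hγ₀ hγ₁ hL
  set m := BoussinesqFD.compConst a c γ L with hm_def
  -- The flow estimate gives 2m, and passing from ‖f‖ to the sum of the two X⁰_μ norms gives another
  -- 2.
  refine ⟨4 * m, by positivity, fun K hK M hM => ?_⟩
  -- Q is the smallness quantity of `Dispersion.exists_isFlow` with ε/√μ taken out. The radius 2√m M
  -- + 1 bounds twice the initial norm of W, and the 1 makes the inequality strict.
  set Q : ℝ := (2 * γ)⁻¹ * (6 * (4 * BoussinesqFD.gnsConst) * √m ^ 3) * (2 * √m * M + 1) with hQ_def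
  have hQ : 0 ≤ Q := by positivity
  have hK0 : 0 < K := by linarith
  -- This choice also gives μ ≤ Kε₀ ≤ 1, needed for the upper bound of β.
  refine ⟨(K * (1 + 8 * Q) ^ 2)⁻¹, by positivity, ?_⟩
  intro ε μ μ₂ hε hεε₀ hμ hεμ hμε hμ₂ _ ζ₀ v₀ hζ₀ hv₀ hM₀
  have hμ₁ : μ ≤ 1 := by
    refine (hμε.trans (mul_le_mul_of_nonneg_left hεε₀ hK0.le)).trans ?_
    rw [mul_inv, ← mul_assoc, mul_inv_cancel₀ hK0.ne', one_mul]
    exact inv_le_one_of_one_le₀ (one_le_pow₀ (by linarith))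
  have hsmall := BoussinesqFD.div_sqrt_le hK0 hQ hε hμ rfl hεε₀ hεμ
  obtain ⟨g₀, hg₀⟩ := BoussinesqFD.exists_smooth_eq hμ hζ₀
  choose g hg using fun i => BoussinesqFD.exists_smooth_eq hμ (hv₀ i)
  set f₀ : BoussinesqFD.State := WithLp.toLp 2 ![g₀, g 0, g 1] with hf₀
  have hζ : BoussinesqFD.smooth hμ (f₀ 0) = ζ₀ := hg₀
  have hv : BoussinesqFD.vel hμ f₀ = v₀ := by
    ext1 k
    rw [← hg k]
    fin_cases k <;> rfl
  have hf₀M := BoussinesqFD.norm_le_normX_add hμ f₀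
  rw [hζ, hv] at hf₀M
  set P := BoussinesqFD.boussinesq hb ha hc hγ₀ hγ₁ hL hμ hμ₁ hμ₂ with hP
  have hr : ε / (2 * γ) * (6 * BoussinesqFD.embConst P.μ * √P.m ^ 3) * (2 * √m * M + 1)
      ≤ 1 / 8 := by
    refine le_trans (le_of_eq ?_) hsmall
    change ε / (2 * γ) * (6 * BoussinesqFD.embConst μ * √m ^ 3) * (2 * √m * M + 1) = _
    rw [hQ_def, BoussinesqFD.embConst]
    ring
  have hr₀ : 2 * √P.m * ‖f₀‖ < 2 * √m * M + 1 := by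
    change 2 * √m * ‖f₀‖ < 2 * √m * M + 1
    have := mul_le_mul_of_nonneg_left (hf₀M.trans hM₀) (show 0 ≤ 2 * √m by positivity)
    linarith
  obtain ⟨f, hf0, hf, hfb⟩ := BoussinesqFD.Dispersion.exists_isFlow (P := P)
    (show 0 ≤ ε / (2 * γ) by positivity) hr hr₀
  have hsol := BoussinesqFD.isSolution_of_isFlow hb ha hc hγ₀ hγ₁ hL hμ hμ₁ hμ₂ hf
  rw [hf0, hζ, hv] at hsol
  refine ⟨_, _, hsol, fun ζ' v' h' t ht => ?_, fun t ht => ?_⟩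
  · obtain ⟨f', hf', hfζ⟩ :=
      BoussinesqFD.exists_isFlow_of_isSolution hb ha hc hγ₀ hγ₁ hL hμ hμ₁ hμ₂ h'
    have h0 : f' 0 = f 0 := by
      rw [hf0]
      exact BoussinesqFD.state_eq_of_smooth hμ
        ((hfζ 0 le_rfl).1.trans (h'.init_ζ.trans hζ.symm))
        ((hfζ 0 le_rfl).2.trans (h'.init_v.trans hv.symm))
    have h1 := hf'.eqOn hf h0 ht
    rw [← (hfζ t ht).1, ← (hfζ t ht).2, h1]
    exact ⟨rfl, rfl⟩
  · refine (BoussinesqFD.normX_add_le hμ (f t)).trans ?_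
    have h1 : ‖f t‖ ≤ 2 * m * ‖f₀‖ := hfb t ht
    have h2 := mul_le_mul_of_nonneg_left hf₀M (show 0 ≤ 4 * m by positivity)
    linarith
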